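/- Let $X_1,X_2,\dots$ be i.i.d. real random variables with a bounded density $p$ on $\mathbb{R}$, whose moment generating function $\phi(t)=E e^{tX_1}$ is finite in a neighbourhood of $0$. Put $S_1^n=X_1+\dots+X_n$ and $m(t)=\frac{d}{dt}\log\phi(t)$. Assume that for $x>0$ \[ p(x)=c\,\exp\bigl(-(g(x)-q(x))\bigr), \] where $c>0$, $g$ is positive and $g(x)/x\to\infty$ as $x\to\infty$. Let $x_0\ge 1$ be such that $g$ is differentiable on $(x_0,\infty)$, put $h=g'$ there and $\psi(u)=\inf\{x>x_0: h(x)\ge u\}$, and assume that for some $\vartheta>0$ and all large $x$ \[ \sup_{v>0,\ |v-x|<\vartheta x}|q(v)|\le \frac{1}{\sqrt{x\,h(x)}} . \] Call $\varepsilon$ an index function if it is twice differentiable on $[1,\infty)$ and $\varepsilon(x)\to0$ as $x\to\infty$, and set $l_\varepsilon(x)=\exp\int_1^x\frac{\varepsilon(u)}{u}\,du$. Assume that one of the following holds. (a) (Class $R_\beta$) For some $\beta>0$ and some index function $\varepsilon$ with $\limsup_{x\to\infty} x|\varepsilon'(x)|<\infty$ and $\limsup_{x\to\infty} x^2|\varepsilon''(x)|<\infty$,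 one has $h(x)=x^\beta l_\varepsilon(x)$ for all $x>x_0$. (b) (Class $R_\infty$) $h$ is strictly increasing on $(x_0,\infty)$, $\psi(u)\to\infty$ as $u\to\infty$, and for some index function $\varepsilon$ one has $\psi(u)=l_\varepsilon(u)$ for all large $u$, $\lim_{x\to\infty} x\varepsilon'(x)/\varepsilon(x)=0$, $\lim_{x\to\infty} x^2\varepsilon''(x)/\varepsilon(x)=0$, and $\liminf_{x\to\infty}x^{\eta}\varepsilon(x)>0$ for some $\eta\in(0,1/4)$. Let $a_n\to\infty$, and let $t_n$ satisfy $m(t_n)=a_n$ for all large $n$. Assume the growth condition \[ \lim_{n\to\infty}\frac{\psi(t_n)^2}{\sqrt{n\,\psi'(t_n)}}=0 . \] For $k\ge1$ let $p^{*k}$ be the $k$-fold convolution of $p$, and for $n\ge2$ let \[ p(X_1=y\mid S_1^n=s)=\frac{p(y)\,p^{*(n-1)}(s-y)}{p^{*n}(s)} . \] Then, for every $n\ge 2$, $y\mapsto p(X_1=y\mid S_1^n=s)$ is the density of the conditional law of $X_1$ given $S_1^n=s$ for almost every $s$ with respect to the law of $S_1^n$. Moreover $p^{*n}(na_n)>0$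 for all large $n$, and for every fixed $y_1\in\mathbb{R}$ \[ p(X_1=y_1\mid S_1^n=na_n)=\pi^{a_n}(y_1)\,\bigl(1+o(1)\bigr)\qquad(n\to\infty), \] where $\pi^{a_n}(x)=e^{t_nx}p(x)/\phi(t_n)$ is the tilted density with mean $a_n$. -/

import Mathlib

open MeasureTheory ProbabilityTheory Filter Topology

noncomputable section

namespace ExtremeGibbs

/-! ### Densities of sums and the conditional density -/

/-- `sumDensity p k` is the `k`-fold convolution `p * ⋯ * p`, that is, the density of the sum of
`k` independent variables with density `p` (for `k ≥ 1`; the value at `k = 0` is irrelevant).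
For a bounded density `p` and `k ≥ 2` this is the continuous version of the density. -/
def sumDensity (p : ℝ → ℝ) : ℕ → ℝ → ℝ
  | 0 => fun _ => 0
  | 1 => p
  | (k + 2) => fun x => ∫ y, p y * sumDensity p (k + 1) (x - y)

/-- The conditional density at `y` of the first of `n` independent variables with density `p`,
given that their sum equals `s`: the joint density `p y * sumDensity p (n - 1) (s - y)` of the
first variable and the sum, divided by the density of the sum. -/
def condDensity (p : ℝ → ℝ) (n : ℕ) (s y : ℝ) : ℝ :=
  p y * sumDensity p (n - 1) (s - y) / sumDensity p n s

/-- The exponentially tilted density `x ↦ exp (t x) p x / φ t`, where `φ` is the moment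
generating function of the density `p`. -/
def tiltedDensity (p φ : ℝ → ℝ) (t x : ℝ) : ℝ :=
  Real.exp (t * x) / φ t * p x

/-! ### The regularity classes -/

/-- `ε` is twice differentiable on `[1, ∞)` and tends to `0` at infinity. -/
structure IsR0Index (ε : ℝ → ℝ) : Prop where
  differentiableAt : ∀ x, 1 ≤ x → DifferentiableAt ℝ ε x
  differentiableAt_deriv : ∀ x, 1 ≤ x → DifferentiableAt ℝ (deriv ε) x
  tendsto_zero : Tendsto ε atTop (𝓝 0)

/-- The slowly varying function `x ↦ exp (∫_1^x ε(u)/u du)`, for `x ≥ 1`. -/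
def slowVar (ε : ℝ → ℝ) (x : ℝ) : ℝ :=
  Real.exp (∫ u in (1 : ℝ)..x, ε u / u)

/-- The class `R_β`: for `x > x₀` one has `h x = x ^ β * l x`, where `l` is the slowly varying
function with index function `ε`, and `x |ε' x|`, `x² |ε'' x|` are bounded for large `x`. -/
def ClassRBeta (β : ℝ) (h : ℝ → ℝ) (x₀ : ℝ) : Prop :=
  0 < β ∧ ∃ ε : ℝ → ℝ, IsR0Index ε ∧
    (∃ C : ℝ, ∀ᶠ x in atTop, x * |deriv ε x| ≤ C) ∧
    (∃ C : ℝ, ∀ᶠ x in atTop, x ^ 2 * |deriv (deriv ε) x| ≤ C) ∧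
    ∀ x, x₀ < x → h x = x ^ β * slowVar ε x

/-- The class `R̃₀` of slowly varying functions `l` (represented for large `x`). -/
def ClassRTilde (l : ℝ → ℝ) : Prop :=
  ∃ ε : ℝ → ℝ, IsR0Index ε ∧
    Tendsto l atTop atTop ∧
    Tendsto (fun x => x * deriv ε x / ε x) atTop (𝓝 0) ∧
    Tendsto (fun x => x ^ 2 * deriv (deriv ε) x / ε x) atTop (𝓝 0) ∧
    (∃ η : ℝ, 0 < η ∧ η < 1 / 4 ∧ ∃ c : ℝ, 0 < c ∧ ∀ᶠ x in atTop, c ≤ x ^ η * ε x) ∧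
    ∀ᶠ x in atTop, l x = slowVar ε x

/-- The inverse function `ψ u = inf {x > x₀ : h x ≥ u}` of `h`, where `(x₀, ∞)` is the range on
which `h` is regular. -/
def genInv (h : ℝ → ℝ) (x₀ u : ℝ) : ℝ :=
  sInf {x | x₀ < x ∧ u ≤ h x}

/-- The class `R_∞`: `h` is strictly increasing and its inverse function lies in `R̃₀`. -/
def ClassRInfty (h : ℝ → ℝ) (x₀ : ℝ) : Prop :=
  StrictMonoOn h (Set.Ioi x₀) ∧ ClassRTilde (genInv h x₀)

/-- The class `R = (⋃_{β > 0} R_β) ∪ R_∞`. -/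
def ClassR (h : ℝ → ℝ) (x₀ : ℝ) : Prop :=
  (∃ β : ℝ, ClassRBeta β h x₀) ∨ ClassRInfty h x₀

/-! ### `condDensity` is the density of the conditional law -/

section Law

/-- Basic properties of the densities of sums. -/
theorem sumDensity_props {p : ℝ → ℝ} (hm : Measurable p) (h0 : ∀ x, 0 ≤ p x) {M : ℝ}
    (hM : ∀ x, p x ≤ M) (hi : Integrable p) (h1 : ∫ x, p x = 1) (k : ℕ) :
    Measurable (sumDensity p (k + 1)) ∧ (∀ x, 0 ≤ sumDensity p (k + 1) x) ∧
      (∀ x, sumDensity p (k + 1) x ≤ M) := by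
  induction k with
  | zero => exact ⟨hm, h0, hM⟩
  | succ k ih =>
    obtain ⟨im, i0, iM⟩ := ih
    refine ⟨?_, ?_, ?_⟩
    · have : Measurable (fun z : ℝ × ℝ => p z.2 * sumDensity p (k + 1) (z.1 - z.2)) := by
        fun_prop
      exact (this.stronglyMeasurable.integral_prod_right (ν := volume)).measurable
    · intro x
      exact integral_nonneg fun y => mul_nonneg (h0 y) (i0 _)
    · intro x
      have hint : Integrable (fun y => p y * sumDensity p (k + 1) (x - y)) := by
        refine hi.mul_bdd (c := M) (Measurable.aestronglyMeasurable (by fun_prop)) (ae_of_all _ fun y => ?_)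
        rw [Real.norm_of_nonneg (i0 _)]
        exact iM _
      calc ∫ y, p y * sumDensity p (k + 1) (x - y) ≤ ∫ y, p y * M :=
            integral_mono hint (hi.mul_const M)
              fun y => mul_le_mul_of_nonneg_left (iM _) (h0 y)
        _ = M := by rw [integral_mul_const, h1, one_mul]

theorem integrable_conv {p : ℝ → ℝ} (hm : Measurable p) (h0 : ∀ x, 0 ≤ p x) {M : ℝ}
    (hM : ∀ x, p x ≤ M) (hi : Integrable p) (h1 : ∫ x, p x = 1) (k : ℕ) (x : ℝ) :
    Integrable (fun y => p y * sumDensity p (k + 1) (x - y)) := by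
  obtain ⟨im, i0, iM⟩ := sumDensity_props hm h0 hM hi h1 k
  refine hi.mul_bdd (c := M) (Measurable.aestronglyMeasurable (by fun_prop)) (ae_of_all _ fun y => ?_)
  rw [Real.norm_of_nonneg (i0 _)]
  exact iM _

theorem lintegral_conv {p : ℝ → ℝ} (hm : Measurable p) (h0 : ∀ x, 0 ≤ p x) {M : ℝ}
    (hM : ∀ x, p x ≤ M) (hi : Integrable p) (h1 : ∫ x, p x = 1) (k : ℕ) (x : ℝ) :
    ∫⁻ y, ENNReal.ofReal (p y * sumDensity p (k + 1) (x - y)) =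
      ENNReal.ofReal (sumDensity p (k + 2) x) := by
  obtain ⟨im, i0, iM⟩ := sumDensity_props hm h0 hM hi h1 k
  rw [← ofReal_integral_eq_lintegral_ofReal (integrable_conv hm h0 hM hi h1 k x)
    (ae_of_all _ fun y => mul_nonneg (h0 y) (i0 _))]
  rfl

variable {Ω : Type*} [MeasurableSpace Ω] {P : Measure Ω} [IsProbabilityMeasure P]

/-- Integration against the joint law of a variable with density `p` and its sum with an
independent variable with density `sumDensity p (k + 1)`. -/
theorem lintegral_joint {p : ℝ → ℝ} (hm : Measurable p) (h0 : ∀ x, 0 ≤ p x) {M : ℝ}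
    (hM : ∀ x, p x ≤ M) (hi : Integrable p) (h1 : ∫ x, p x = 1) (k : ℕ) {Y T : Ω → ℝ}
    (hY : Measurable Y) (hT : Measurable T)
    (lY : P.map Y = volume.withDensity fun x => ENNReal.ofReal (p x))
    (lT : P.map T = volume.withDensity fun x => ENNReal.ofReal (sumDensity p (k + 1) x))
    (hind : IndepFun Y T P) {F : ℝ × ℝ → ENNReal} (hF : Measurable F) :
    ∫⁻ ω, F (Y ω + T ω, Y ω) ∂P =
      ∫⁻ s, ∫⁻ y, F (s, y) * ENNReal.ofReal (p y * sumDensity p (k + 1) (s - y)) := by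
  obtain ⟨im, i0, iM⟩ := sumDensity_props hm h0 hM hi h1 k
  have e1 : ∫⁻ ω, F (Y ω + T ω, Y ω) ∂P =
      ∫⁻ z, F (z.1 + z.2, z.1) ∂(P.map fun ω => (Y ω, T ω)) := by
    rw [lintegral_map (by fun_prop) (by fun_prop)]
  have pT : IsProbabilityMeasure (P.map T) := Measure.isProbabilityMeasure_map hT.aemeasurable
  rw [e1, (indepFun_iff_map_prod_eq_prod_map_map hY.aemeasurable hT.aemeasurable).1 hind,
    lintegral_prod _ (by fun_prop), lY,
    lintegral_withDensity_eq_lintegral_mul _ (by fun_prop)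
      (Measurable.lintegral_prod_right (by fun_prop)), lT]
  rw [lintegral_lintegral_swap (by fun_prop)]
  refine lintegral_congr fun y => ?_
  rw [Pi.mul_apply, lintegral_withDensity_eq_lintegral_mul _ (by fun_prop) (by fun_prop),
    ← lintegral_const_mul _ (by fun_prop)]
  rw [← lintegral_sub_right_eq_self _ y]
  refine lintegral_congr fun s => ?_
  rw [Pi.mul_apply, ENNReal.ofReal_mul (h0 y), add_sub_cancel]
  ring

/-- A sum of `k + 1` independent variables with density `p` has density
`sumDensity p (k + 1)`. -/
theorem map_sum_eq {p : ℝ → ℝ} (hm : Measurable p) (h0 : ∀ x, 0 ≤ p x) {M : ℝ}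
    (hM : ∀ x, p x ≤ M) (hi : Integrable p) (h1 : ∫ x, p x = 1) {X : ℕ → Ω → ℝ}
    (hX : ∀ i, Measurable (X i)) (hind : iIndepFun X P)
    (hlaw : ∀ i, P.map (X i) = volume.withDensity fun x => ENNReal.ofReal (p x)) (k : ℕ) :
    ∀ s : Finset ℕ, s.card = k + 1 →
      P.map (fun ω => ∑ i ∈ s, X i ω) =
        volume.withDensity fun x => ENNReal.ofReal (sumDensity p (k + 1) x) := by
  induction k with
  | zero =>
    intro s hs
    obtain ⟨i, rfl⟩ := Finset.card_eq_one.1 hs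
    simp only [Finset.sum_singleton]
    exact hlaw i
  | succ k ih =>
    intro s hs
    obtain ⟨i, u, hiu, rfl, hu⟩ := Finset.card_eq_succ.1 hs
    have hTm : Measurable (fun ω => ∑ j ∈ u, X j ω) := by fun_prop
    have hi' : IndepFun (X i) (fun ω => ∑ j ∈ u, X j ω) P := by
      have := (hind.indepFun_finsetSum_of_notMem hX hiu).symm
      convert this using 1
      ext ω
      simp
    obtain ⟨im, i0, iM⟩ := sumDensity_props hm h0 hM hi h1 (k + 1)
    ext B hB
    rw [withDensity_apply _ hB, Measure.map_apply (by fun_prop) hB]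
    have := lintegral_joint hm h0 hM hi h1 k (hX i) hTm (hlaw i) (ih u hu) hi'
      (F := fun z => B.indicator 1 z.1)
      ((measurable_one.indicator hB).comp measurable_fst)
    have e2 : ∀ s y : ℝ, B.indicator (1 : ℝ → ENNReal) s *
        ENNReal.ofReal (p y * sumDensity p (k + 1) (s - y)) =
        B.indicator (fun s => ENNReal.ofReal (p y * sumDensity p (k + 1) (s - y))) s := by
      intro s y
      by_cases h : s ∈ B <;> simp [h]
    have e3 : ∀ s : ℝ, ∫⁻ y, B.indicator (1 : ℝ → ENNReal) s *
        ENNReal.ofReal (p y * sumDensity p (k + 1) (s - y)) =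
        B.indicator (fun s => ENNReal.ofReal (sumDensity p (k + 2) s)) s := by
      intro s
      by_cases h : s ∈ B
      · simp [h, lintegral_conv hm h0 hM hi h1 k s]
      · simp [h]
    simp only [e3] at this
    rw [lintegral_indicator hB] at this
    rw [← this, ← lintegral_indicator_one (by measurability)]
    refine lintegral_congr fun ω => ?_
    simp only [Finset.sum_insert hiu]
    rfl

/-- The conditional law of `X 0` given `X 0 + ⋯ + X (n - 1) = s` has density
`condDensity p n s`. -/
theorem condDistrib_eq {p : ℝ → ℝ} (hm : Measurable p) (h0 : ∀ x, 0 ≤ p x) {M : ℝ}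
    (hM : ∀ x, p x ≤ M) {X : ℕ → Ω → ℝ}
    (hX : ∀ i, Measurable (X i)) (hind : iIndepFun X P)
    (hlaw : ∀ i, P.map (X i) = volume.withDensity fun x => ENNReal.ofReal (p x))
    {n : ℕ} (hn : 2 ≤ n) :
    ∀ᵐ s ∂(P.map fun ω => ∑ i ∈ Finset.range n, X i ω),
      condDistrib (X 0) (fun ω => ∑ i ∈ Finset.range n, X i ω) P s =
        volume.withDensity fun y => ENNReal.ofReal (condDensity p n s y) := by
  have hl1 : ∫⁻ x, ENNReal.ofReal (p x) = 1 := by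
    have h : P.map (X 0) Set.univ = 1 := by
      have := Measure.isProbabilityMeasure_map (μ := P) (hX 0).aemeasurable
      exact measure_univ
    rw [hlaw 0, withDensity_apply _ MeasurableSet.univ] at h
    simpa using h
  have hi : Integrable p := by
    refine ⟨hm.aestronglyMeasurable, ?_⟩
    rw [hasFiniteIntegral_iff_ofReal (ae_of_all _ h0), hl1]
    exact ENNReal.one_lt_top
  have h1 : ∫ x, p x = 1 := by
    rw [integral_eq_lintegral_of_nonneg_ae (ae_of_all _ h0) hm.aestronglyMeasurable, hl1]
    simp
  obtain ⟨k, rfl⟩ : ∃ k, n = k + 2 := ⟨n - 2, by omega⟩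
  obtain ⟨am, a0, aM⟩ := sumDensity_props hm h0 hM hi h1 k
  obtain ⟨bm, b0, bM⟩ := sumDensity_props hm h0 hM hi h1 (k + 1)
  set S : Ω → ℝ := fun ω => ∑ i ∈ Finset.range (k + 2), X i ω with hS
  set T : Ω → ℝ := fun ω => ∑ i ∈ (Finset.range (k + 2)).erase 0, X i ω with hT
  have hSm : Measurable S := by fun_prop
  have hTm : Measurable T := by fun_prop
  have hST : ∀ ω, S ω = X 0 ω + T ω := fun ω =>
    (Finset.add_sum_erase _ (fun i => X i ω) (by simp)).symm
  have lT := map_sum_eq hm h0 hM hi h1 hX hind hlaw k ((Finset.range (k + 2)).erase 0)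
    (by simp)
  have lS := map_sum_eq hm h0 hM hi h1 hX hind hlaw (k + 1) (Finset.range (k + 2)) (by simp)
  have hi' : IndepFun (X 0) T P := by
    have := (hind.indepFun_finsetSum_of_notMem hX
      (s := (Finset.range (k + 2)).erase 0) (i := 0) (by simp)).symm
    convert this using 1
    ext ω
    simp [hT]
  have hcm : Measurable (Function.uncurry fun s y : ℝ =>
      ENNReal.ofReal (condDensity p (k + 2) s y)) := by
    unfold condDensity
    simp only [Nat.add_succ_sub_one, Function.uncurry_def]
    fun_prop
  let κ : Kernel ℝ ℝ := Kernel.withDensity (Kernel.const ℝ volume)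
    (fun s y => ENNReal.ofReal (condDensity p (k + 2) s y))
  have hκ : ∀ s, κ s = volume.withDensity
      fun y => ENNReal.ofReal (condDensity p (k + 2) s y) := fun s => by
    simp [κ, Kernel.withDensity_apply _ hcm]
  have hκf : IsFiniteKernel κ := by
    refine ⟨⟨1, ENNReal.one_lt_top, fun s => ?_⟩⟩
    rw [hκ, withDensity_apply _ MeasurableSet.univ, Measure.restrict_univ]
    have : ∀ y, ENNReal.ofReal (condDensity p (k + 2) s y) =
        ENNReal.ofReal (p y * sumDensity p (k + 1) (s - y)) *
          ENNReal.ofReal (sumDensity p (k + 2) s)⁻¹ := fun y => by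
      rw [← ENNReal.ofReal_mul (mul_nonneg (h0 _) (a0 _))]
      rfl
    simp only [this]
    rw [lintegral_mul_const _ (by fun_prop), lintegral_conv hm h0 hM hi h1 k s,
      ← ENNReal.ofReal_mul (b0 s)]
    exact ENNReal.ofReal_le_one.2 (mul_inv_le_one)
  have key : P.map (fun ω => (S ω, X 0 ω)) = (P.map S) ⊗ₘ κ := by
    have : IsProbabilityMeasure (P.map S) := Measure.isProbabilityMeasure_map hSm.aemeasurable
    refine Measure.ext_of_lintegral _ fun F hF => ?_
    rw [lintegral_map hF (by fun_prop), Measure.lintegral_compProd hF]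
    simp only [hST]
    rw [lintegral_joint hm h0 hM hi h1 k (hX 0) hTm (hlaw 0) lT hi' hF]
    have hg : Measurable fun s => ∫⁻ y, F (s, y) ∂κ s := by
      exact Measurable.lintegral_kernel_prod_right hF
    have : P.map S =
        volume.withDensity fun x => ENNReal.ofReal (sumDensity p (k + 2) x) := lS
    rw [this, lintegral_withDensity_eq_lintegral_mul _ (by fun_prop) hg]
    refine lintegral_congr fun s => ?_
    have hcs : Measurable fun y => ENNReal.ofReal (condDensity p (k + 2) s y) :=
      hcm.comp measurable_prodMk_left
    have hFs : Measurable fun y => F (s, y) := hF.comp measurable_prodMk_left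
    rw [Pi.mul_apply, hκ, lintegral_withDensity_eq_lintegral_mul _ hcs hFs,
      ← lintegral_const_mul _ (hcs.mul hFs)]
    rcases (b0 s).eq_or_lt with hz | hpos
    · have hz' : ∫⁻ y, ENNReal.ofReal (p y * sumDensity p (k + 1) (s - y)) = 0 := by
        rw [lintegral_conv hm h0 hM hi h1 k s, ← hz, ENNReal.ofReal_zero]
      rw [lintegral_eq_zero_iff (by fun_prop)] at hz'
      refine lintegral_congr_ae ?_
      filter_upwards [hz'] with y hy
      rw [hy, ← hz]
      simp
    · refine lintegral_congr fun y => ?_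
      have : ENNReal.ofReal (p y * sumDensity p (k + 1) (s - y)) =
          ENNReal.ofReal (sumDensity p (k + 2) s) *
            ENNReal.ofReal (condDensity p (k + 2) s y) := by
        rw [← ENNReal.ofReal_mul (b0 s)]
        congr 1
        unfold condDensity
        rw [mul_div_cancel₀ _ hpos.ne']
        rfl
      rw [this, Pi.mul_apply]
      ring
  filter_upwards [condDistrib_ae_eq_of_measure_eq_compProd S (hX 0).aemeasurable key] with s hs
  rw [hs, hκ]

end Law

end ExtremeGibbs

end

/-!
The conditional density is a ratio of densities of sums, and it does not change if every variable
is tilted by the same exponential: with `t = t n`, `x = ψ t`, `σ = √(ψ' t)` and `f` the density of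
the tilted law after the affine change of variable `y = x + σ z`,

  `p (X₁ = y | S = n a) = π (y) * F (n - 1) (...) / F n (...)`,

where `F k` is the `k`-fold convolution of `f` (`sumDensity_tilted`). In the denominator `F n` is
evaluated at the mean of the sum; in the numerator `F (n - 1)` is evaluated at distance
`(a - y) / σ` from the mean, which is `o(√n)` by the growth condition. Both are therefore
asymptotic to `1 / √(2πn)`, provided that a local limit theorem holds for the array of densities
`f = f n`, which depend on `n`.

The local limit theorem (`GaussianLimit.tendsto_sqrt_mul_sumDensity`) needs no rate: it holds as
soon as the `f n` converge pointwise to the standard normal density under a common bound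
`C exp (-|z| / 4)`. By Fourier inversion, `√n F n` is the integral of the `n`-th power of a centred
Fourier transform at `v / √n`. Domination gives the second-order Taylor expansion uniformly in `n`,
hence the pointwise limit and a Gaussian bound for `|v| ≤ δ √n`. Convergence in `L¹` bounds the
transforms away from `1` in modulus for `|v| ≥ δ √n`, where two of the `n` factors are spent on
square integrability, which follows from the boundedness of the density.

The Gaussian limit of the tilted densities is Laplace's method. Up to normalisation, `f` is
`exp (-B + q)` with `B z = g (x + σ z) - g x - h x σ z`. Pointwise `B z → z² / 2`, because `h'` is
asymptotically constant on windows of width comparable with `σ = 1 / √(h' x)`. Since `g` is convex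
near infinity, the values of `B` at `±1` force the linear lower bound `B z ≥ |z| / 4 - 1 / 2`, and
at the left end of the region of convexity this bound also controls the part of the law where
nothing but boundedness of `p` is known (`RegularTail.exists_rescaled_le`).

It remains to check that the classes `R_β` and `R_∞` have these regularity properties
(`ClassR.exists_regularTail`). In the first class `h'` is regularly varying. In the second one
`h' = h / (x ε(h))`, where `x ε(x)` is increasing and `ε(x) / x` decreasing near infinity, so that
a bound on the increments of `log ψ = ∫ ε(u) / u` controls those of both `h` and `ε(h)`.
-/

noncomputable section

namespace ExtremeGibbs

open scoped FourierTransform Convolution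

/-! ### Fourier analysis of convolution powers -/

/-- The convolution of an integrable function with a bounded integrable one is continuous, as a
uniform limit of convolutions with compactly supported continuous functions. -/
theorem continuous_integral_mul_sub {f G : ℝ → ℝ} (hf : Integrable f) (hG : Integrable G)
    {M : ℝ} (hM : ∀ x, ‖G x‖ ≤ M) : Continuous fun x => ∫ y, f y * G (x - y) := by
  have hM0 : 0 ≤ M := (norm_nonneg _).trans (hM 0)
  have hint : ∀ (u : ℝ → ℝ), Integrable u → ∀ x, Integrable fun y => u y * G (x - y) :=
    fun u hu x => hu.mul_bdd (c := M) (hG.comp_sub_left x).aestronglyMeasurable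
      (ae_of_all _ fun y => hM _)
  have key : ∀ ε : ℝ, 0 < ε → ∃ F : ℝ → ℝ, Continuous F ∧
      ∀ x, dist (∫ y, f y * G (x - y)) (F x) ≤ M * ε := by
    intro ε hε
    obtain ⟨u, hu, hfu, huc, hui⟩ := hf.exists_hasCompactSupport_integral_sub_le hε
    refine ⟨fun x => ∫ y, u y * G (x - y), ?_, fun x => ?_⟩
    · exact hu.continuous_convolution_left (ContinuousLinearMap.mul ℝ ℝ) huc
        hG.locallyIntegrable
    · rw [dist_eq_norm, ← integral_sub (hint f hf x) (hint u hui x)]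
      calc ‖∫ y, (f y * G (x - y) - u y * G (x - y))‖
          ≤ ∫ y, M * ‖f y - u y‖ := by
            refine norm_integral_le_of_norm_le ((hf.sub hui).norm.const_mul M)
              (ae_of_all _ fun y => ?_)
            rw [← sub_mul, norm_mul, mul_comm]
            exact mul_le_mul_of_nonneg_right (hM _) (norm_nonneg _)
        _ = M * ∫ y, ‖f y - u y‖ := integral_const_mul _ _
        _ ≤ M * ε := mul_le_mul_of_nonneg_left hfu hM0
  choose! F hFc hF using key
  have hlim : TendstoUniformly (fun n : ℕ => F (1 / ((n : ℝ) + 1)))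
      (fun x => ∫ y, f y * G (x - y)) atTop := by
    rw [Metric.tendstoUniformly_iff]
    intro ε hε
    have h0 : Tendsto (fun n : ℕ => M * (1 / ((n : ℝ) + 1))) atTop (𝓝 (M * 0)) :=
      tendsto_one_div_add_atTop_nhds_zero_nat.const_mul M
    rw [mul_zero] at h0
    filter_upwards [h0.eventually (gt_mem_nhds hε)] with n hn x
    exact (hF _ Nat.one_div_pos_of_nat x).trans_lt hn
  exact hlim.continuous (Frequently.of_forall fun n => hFc _ Nat.one_div_pos_of_nat)

/-- `f` is a probability density on the real line, bounded by `M`. -/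
structure IsBddDensity (f : ℝ → ℝ) (M : ℝ) : Prop where
  measurable : Measurable f
  nonneg : ∀ x, 0 ≤ f x
  le : ∀ x, f x ≤ M
  integrable : Integrable f
  integral_eq_one : ∫ x, f x = 1

namespace IsBddDensity

variable {f : ℝ → ℝ} {M : ℝ}

theorem sumDensity_props (hf : IsBddDensity f M) (k : ℕ) :
    Measurable (sumDensity f (k + 1)) ∧ (∀ x, 0 ≤ sumDensity f (k + 1) x) ∧
      (∀ x, sumDensity f (k + 1) x ≤ M) :=
  ExtremeGibbs.sumDensity_props hf.measurable hf.nonneg hf.le hf.integrable hf.integral_eq_one k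

theorem integrable_sumDensity (hf : IsBddDensity f M) (k : ℕ) : Integrable (sumDensity f (k + 1)) := by
  induction k with
  | zero => exact hf.integrable
  | succ k ih =>
    exact hf.integrable.integrable_convolution (ContinuousLinearMap.mul ℝ ℝ) ih

theorem continuous_sumDensity (hf : IsBddDensity f M) (k : ℕ) : Continuous (sumDensity f (k + 2)) := by
  obtain ⟨-, i0, iM⟩ := hf.sumDensity_props k
  exact continuous_integral_mul_sub hf.integrable (hf.integrable_sumDensity k)
    fun x => by rw [Real.norm_of_nonneg (i0 x)]; exact iM x

theorem fourier_sumDensity (hf : IsBddDensity f M) (k : ℕ) (w : ℝ) :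
    𝓕 (fun x => (sumDensity f (k + 1) x : ℂ)) w = 𝓕 (fun x => (f x : ℂ)) w ^ (k + 1) := by
  induction k with
  | zero => simp [sumDensity]
  | succ k ih =>
    have e : (fun x => (sumDensity f (k + 2) x : ℂ)) =
        (fun x => (f x : ℂ)) ⋆[ContinuousLinearMap.mul ℂ ℂ]
          (fun x => (sumDensity f (k + 1) x : ℂ)) := by
      ext x
      simp only [convolution, ContinuousLinearMap.mul_apply', sumDensity]
      rw [← integral_complex_ofReal]
      simp
    have h₁ : Integrable fun x => (f x : ℂ) := hf.integrable.ofReal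
    have h₂ : Integrable fun x => (sumDensity f (k + 1) x : ℂ) := (hf.integrable_sumDensity k).ofReal
    rw [e, Real.fourier_mul_convolution_eq h₁ h₂, ih, pow_succ' _ (k + 1)]

theorem norm_fourier_le_one (hf : IsBddDensity f M) (w : ℝ) : ‖𝓕 (fun x => (f x : ℂ)) w‖ ≤ 1 := by
  rw [Real.fourier_real_eq]
  refine (norm_integral_le_integral_norm _).trans ?_
  simp only [Circle.norm_smul, Complex.norm_real, Real.norm_of_nonneg (hf.nonneg _), hf.integral_eq_one, le_refl]

theorem continuous_fourier_density (hf : IsBddDensity f M) : Continuous (𝓕 (fun x => (f x : ℂ))) :=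
  VectorFourier.fourierIntegral_continuous Real.continuous_fourierChar
    (continuous_inner (𝕜 := ℝ) (E := ℝ)) hf.integrable.ofReal

/-- The regularised Plancherel inequality: the squared modulus of the Fourier transform of `f` is
the Fourier transform of the autocorrelation of `f`, which is bounded by `M`. -/
theorem integral_gaussian_mul_norm_sq_fourier_le (hf : IsBddDensity f M) {b : ℝ} (hb : 0 < b) :
    ∫ w : ℝ, Real.exp (-Real.pi * b * w ^ 2) * ‖𝓕 (fun x => (f x : ℂ)) w‖ ^ 2 ≤ M := by
  set F : ℝ → ℂ := fun x => (f x : ℂ) with hF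
  set H : ℝ → ℂ := F ⋆[ContinuousLinearMap.mul ℂ ℂ] (fun x => F (-x)) with hH
  have hFi : Integrable F := hf.integrable.ofReal
  have hHi : Integrable H := hFi.integrable_convolution _ hFi.comp_neg
  have e1 : ∀ w, 𝓕 H w = ((‖𝓕 F w‖ ^ 2 : ℝ) : ℂ) := by
    intro w
    rw [hH, Real.fourier_mul_convolution_eq hFi hFi.comp_neg]
    have : 𝓕 (fun x => F (-x)) w = (starRingEnd ℂ) (𝓕 F w) := by
      rw [Real.fourier_real_eq, Real.fourier_real_eq, ← integral_conj,
        ← integral_neg_eq_self]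
      refine integral_congr_ae (ae_of_all _ fun x => ?_)
      simp only [hF, neg_neg, Circle.smul_def, smul_eq_mul, map_mul, Complex.conj_ofReal]
      rw [← Circle.coe_inv_eq_conj, ← AddChar.map_neg_eq_inv]
      congr 3
      ring
    rw [this, Complex.mul_conj, Complex.normSq_eq_norm_sq]
  have hHM : ∀ x, ‖H x‖ ≤ M := by
    intro x
    have : ∫ y, f y * M = M := by rw [integral_mul_const, hf.integral_eq_one, one_mul]
    rw [hH, convolution, ← this]
    refine norm_integral_le_of_norm_le (hf.integrable.mul_const M) (ae_of_all _ fun y => ?_)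
    simp only [ContinuousLinearMap.mul_apply', norm_mul, hF, Complex.norm_real,
      Real.norm_of_nonneg (hf.nonneg _)]
    exact mul_le_mul_of_nonneg_left (hf.le _) (hf.nonneg _)
  set E : ℝ → ℂ := fun w => Complex.exp (-Real.pi * b * w ^ 2) with hE
  have hb' : 0 < (b : ℂ).re := by simpa using hb
  have hEi : Integrable E := by
    have := integrable_cexp_neg_mul_sq (b := (Real.pi * b : ℂ)) (by
      simpa using mul_pos Real.pi_pos hb)
    simpa [hE, neg_mul] using this
  have flip : ∫ w, 𝓕 H w • E w = ∫ x, H x • 𝓕 E x := by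
    have := VectorFourier.integral_fourierIntegral_smul_eq_flip (L := innerₗ ℝ)
      (μ := volume) (ν := volume) Real.continuous_fourierChar (by
        exact continuous_inner) hHi hEi
    rw [flip_innerₗ] at this
    exact this
  have e2 : ((∫ w : ℝ, Real.exp (-Real.pi * b * w ^ 2) * ‖𝓕 F w‖ ^ 2 : ℝ) : ℂ) =
      ∫ x, H x • 𝓕 E x := by
    rw [← flip, ← integral_complex_ofReal]
    refine integral_congr_ae (ae_of_all _ fun w => ?_)
    simp only [e1, smul_eq_mul, hE]
    push_cast
    ring
  have e3 : ∀ x : ℝ, ‖𝓕 E x‖ = 1 / b ^ (1 / 2 : ℝ) * Real.exp (-(Real.pi / b) * x ^ 2) := by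
    intro x
    rw [hE, fourier_gaussian_pi hb', norm_mul, norm_div, norm_one]
    congr 2
    · have : ((1 : ℂ) / 2) = ((1 / 2 : ℝ) : ℂ) := by push_cast; rfl
      rw [this, Complex.norm_cpow_eq_rpow_re_of_pos hb]
      simp
    · rw [Complex.norm_exp]
      congr 1
      have : (-(Real.pi : ℂ) / b * (x : ℂ) ^ 2) = ((-(Real.pi / b) * x ^ 2 : ℝ) : ℂ) := by
        push_cast; ring
      rw [this, Complex.ofReal_re]
  have e4 : ∫ x : ℝ, 1 / b ^ (1 / 2 : ℝ) * Real.exp (-(Real.pi / b) * x ^ 2) = 1 := by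
    rw [integral_const_mul, integral_gaussian, div_div_cancel₀ Real.pi_pos.ne',
      Real.sqrt_eq_rpow]
    have := (Real.rpow_pos_of_pos hb (1 / 2)).ne'
    field_simp
  have hgi : Integrable fun x : ℝ =>
      1 / b ^ (1 / 2 : ℝ) * Real.exp (-(Real.pi / b) * x ^ 2) :=
    (integrable_exp_neg_mul_sq (div_pos Real.pi_pos hb)).const_mul _
  calc ∫ w : ℝ, Real.exp (-Real.pi * b * w ^ 2) * ‖𝓕 F w‖ ^ 2
      ≤ ‖((∫ w : ℝ, Real.exp (-Real.pi * b * w ^ 2) * ‖𝓕 F w‖ ^ 2 : ℝ) : ℂ)‖ := by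
        rw [Complex.norm_real]; exact Real.le_norm_self _
    _ ≤ ∫ x : ℝ, M * (1 / b ^ (1 / 2 : ℝ) * Real.exp (-(Real.pi / b) * x ^ 2)) := by
        rw [e2]
        refine norm_integral_le_of_norm_le (hgi.const_mul M) (ae_of_all _ fun x => ?_)
        rw [norm_smul, e3]
        exact mul_le_mul_of_nonneg_right (hHM x) (by positivity)
    _ = M := by rw [integral_const_mul, e4, mul_one]

theorem lintegral_norm_sq_fourier_le (hf : IsBddDensity f M) :
    ∫⁻ w : ℝ, ENNReal.ofReal (‖𝓕 (fun x => (f x : ℂ)) w‖ ^ 2) ≤ ENNReal.ofReal M := by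
  have hc := hf.continuous_fourier_density
  have hn := hf.norm_fourier_le_one
  set Φ := 𝓕 (fun x => (f x : ℂ)) with hΦ
  have hb : ∀ n : ℕ, (0 : ℝ) < 1 / ((n : ℝ) + 1) := fun n => Nat.one_div_pos_of_nat
  have hlim : ∀ w : ℝ, Tendsto (fun n : ℕ => ENNReal.ofReal
      (Real.exp (-Real.pi * (1 / ((n : ℝ) + 1)) * w ^ 2) * ‖Φ w‖ ^ 2)) atTop
      (𝓝 (ENNReal.ofReal (‖Φ w‖ ^ 2))) := by
    intro w
    refine ENNReal.tendsto_ofReal ?_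
    have : Tendsto (fun n : ℕ => Real.exp (-Real.pi * (1 / ((n : ℝ) + 1)) * w ^ 2) * ‖Φ w‖ ^ 2)
        atTop (𝓝 (Real.exp (-Real.pi * 0 * w ^ 2) * ‖Φ w‖ ^ 2)) :=
      ((Real.continuous_exp.tendsto _).comp ((tendsto_one_div_add_atTop_nhds_zero_nat.const_mul
        (-Real.pi)).mul_const (w ^ 2))).mul_const _
    simpa using this
  calc ∫⁻ w, ENNReal.ofReal (‖Φ w‖ ^ 2)
      = ∫⁻ w, liminf (fun n : ℕ => ENNReal.ofReal
          (Real.exp (-Real.pi * (1 / ((n : ℝ) + 1)) * w ^ 2) * ‖Φ w‖ ^ 2)) atTop :=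
        lintegral_congr fun w => (hlim w).liminf_eq.symm
    _ ≤ liminf (fun n : ℕ => ∫⁻ w, ENNReal.ofReal
          (Real.exp (-Real.pi * (1 / ((n : ℝ) + 1)) * w ^ 2) * ‖Φ w‖ ^ 2)) atTop :=
        lintegral_liminf_le fun n => by fun_prop
    _ ≤ ENNReal.ofReal M := by
        refine liminf_le_of_frequently_le' (Frequently.of_forall fun n => ?_)
        rw [← ofReal_integral_eq_lintegral_ofReal]
        · exact ENNReal.ofReal_le_ofReal
            (hf.integral_gaussian_mul_norm_sq_fourier_le (hb n))
        · have hg := integrable_exp_neg_mul_sq (mul_pos Real.pi_pos (hb n))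
          refine (hg.mul_bdd (c := 1) (g := fun w => ‖Φ w‖ ^ 2)
            (hc.norm.pow 2).aestronglyMeasurable
            (ae_of_all _ fun w => ?_)).congr (ae_of_all _ fun w => ?_)
          · rw [norm_pow, norm_norm]
            exact pow_le_one₀ (norm_nonneg _) (hn w)
          · simp only [neg_mul]
        · exact ae_of_all _ fun w => by positivity

/-- Plancherel inequality for a density bounded by `M`. -/
theorem integrable_norm_sq_fourier (hf : IsBddDensity f M) :
    Integrable (fun w : ℝ => ‖𝓕 (fun x => (f x : ℂ)) w‖ ^ 2) := by
  have hc := hf.continuous_fourier_density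
  refine ⟨by fun_prop, ?_⟩
  rw [hasFiniteIntegral_iff_ofReal (ae_of_all _ fun w => by positivity)]
  exact (hf.lintegral_norm_sq_fourier_le).trans_lt ENNReal.ofReal_lt_top

theorem integral_norm_sq_fourier_le (hf : IsBddDensity f M) (hM0 : 0 ≤ M) :
    ∫ w : ℝ, ‖𝓕 (fun x => (f x : ℂ)) w‖ ^ 2 ≤ M := by
  have hc := hf.continuous_fourier_density
  rw [integral_eq_lintegral_of_nonneg_ae (ae_of_all _ fun w => by positivity) (by fun_prop)]
  exact ENNReal.toReal_le_of_le_ofReal hM0 (hf.lintegral_norm_sq_fourier_le)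

theorem integrable_fourier_pow (hf : IsBddDensity f M) (k : ℕ) :
    Integrable (fun w : ℝ => 𝓕 (fun x => (f x : ℂ)) w ^ (k + 2)) := by
  have hc := hf.continuous_fourier_density
  refine (hf.integrable_norm_sq_fourier).mono' (by fun_prop)
    (ae_of_all _ fun w => ?_)
  rw [norm_pow, pow_add]
  exact mul_le_of_le_one_left (by positivity)
    (pow_le_one₀ (norm_nonneg _) (hf.norm_fourier_le_one w))

/-- Fourier inversion for the density of a sum of at least two independent variables. -/
theorem sumDensity_eq_integral (hf : IsBddDensity f M) (k : ℕ) (x : ℝ) :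
    (sumDensity f (k + 2) x : ℂ) =
      ∫ w : ℝ, Complex.exp (2 * Real.pi * Complex.I * w * x) *
        𝓕 (fun x => (f x : ℂ)) w ^ (k + 2) := by
  have hs := hf.integrable_sumDensity (k + 1)
  have hF : 𝓕 (fun x => (sumDensity f (k + 2) x : ℂ)) =
      fun w => 𝓕 (fun x => (f x : ℂ)) w ^ (k + 2) :=
    funext fun w => hf.fourier_sumDensity (k + 1) w
  have hcont : Continuous fun x => (sumDensity f (k + 2) x : ℂ) :=
    Complex.continuous_ofReal.comp (hf.continuous_sumDensity k)
  have := congrFun (hcont.fourierInv_fourier_eq hs.ofReal (by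
    rw [hF]; exact hf.integrable_fourier_pow k)) x
  rw [← this, hF, Real.fourierInv_eq']
  refine integral_congr_ae (ae_of_all _ fun w => ?_)
  simp only [smul_eq_mul, RCLike.inner_apply, conj_trivial]
  congr 2
  push_cast
  ring

end IsBddDensity

/-! ### A local limit theorem for arrays of densities -/

/-- The probability densities `f n` converge pointwise to the standard normal density, and are
uniformly dominated by a double exponential. -/
structure GaussianLimit (f : ℕ → ℝ → ℝ) (C : ℝ) : Prop where
  density : ∀ᶠ n in atTop, IsBddDensity (f n) C
  dominated : ∀ᶠ n in atTop, ∀ x, f n x ≤ C * Real.exp (-|x| / 4)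
  tendsto : ∀ x, Tendsto (fun n => f n x) atTop (𝓝 (gaussianPDFReal 0 1 x))

theorem integrable_one_add_abs_pow_mul_exp (k : ℕ) :
    Integrable fun x : ℝ => (1 + |x|) ^ k * Real.exp (-|x| / 4) := by
  have h : IntegrableOn (fun x : ℝ => (1 + x) ^ k * Real.exp (-x / 4)) (Set.Ioi 0) := by
    refine integrable_of_isBigO_exp_neg (b := 1 / 8) (by norm_num)
      (by fun_prop) (Asymptotics.IsLittleO.isBigO ?_)
    have h1 : (fun x : ℝ => (1 + x) ^ k) =o[atTop] fun x => Real.exp (1 / 8 * x) := by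
      have := (isLittleO_pow_exp_pos_mul_atTop k (b := 1 / 8) (by norm_num)).comp_tendsto
        (tendsto_atTop_add_const_left atTop (1 : ℝ) tendsto_id)
      refine this.trans_isBigO (Asymptotics.IsBigO.of_bound (Real.exp (1 / 8))
        (Eventually.of_forall fun x => ?_))
      simp only [Function.comp, id, Real.norm_eq_abs, Real.abs_exp]
      rw [← Real.exp_add]
      exact (congrArg Real.exp (by ring)).le
    have h2 := h1.mul_isBigO (Asymptotics.isBigO_refl (fun x : ℝ => Real.exp (-x / 4)) atTop)
    refine h2.congr_right fun x => ?_
    rw [← Real.exp_add]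
    congr 1
    ring
  have hr : IntegrableOn (fun x : ℝ => (1 + |x|) ^ k * Real.exp (-|x| / 4)) (Set.Ioi 0) :=
    h.congr_fun (fun x hx => by simp only [abs_of_pos (Set.mem_Ioi.1 hx)]) measurableSet_Ioi
  have hl : IntegrableOn (fun x : ℝ => (1 + |x|) ^ k * Real.exp (-|x| / 4)) (Set.Iio 0) := by
    have := (integrable_indicator_iff measurableSet_Ioi).2 hr
    rw [← integrable_indicator_iff measurableSet_Iio]
    refine this.comp_neg.congr (ae_of_all _ fun x => ?_)
    simp only [Set.indicator, Set.mem_Ioi, Set.mem_Iio, abs_neg, Left.neg_pos_iff]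
  rw [← integrableOn_univ, ← Set.Iic_union_Ioi (a := (0 : ℝ)), integrableOn_union,
    integrableOn_Iic_iff_integrableOn_Iio]
  exact ⟨hl, hr⟩

/-- The quadratic Taylor bound for `exp (i z)`. -/
theorem norm_exp_I_sub_linear_le (z : ℝ) :
    ‖Complex.exp (z * Complex.I) - 1 - z * Complex.I‖ ≤ 3 * z ^ 2 := by
  rcases le_or_gt |z| 1 with h | h
  · have := Complex.norm_exp_sub_one_sub_id_le (x := z * Complex.I) (by simpa using h)
    simp only [norm_mul, Complex.norm_real, Complex.norm_I, mul_one, Real.norm_eq_abs,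
      sq_abs] at this
    nlinarith [sq_nonneg z]
  · calc ‖Complex.exp (z * Complex.I) - 1 - z * Complex.I‖
        ≤ ‖Complex.exp (z * Complex.I)‖ + ‖(1 : ℂ)‖ + ‖z * Complex.I‖ :=
          (norm_sub_le _ _).trans (add_le_add_left (norm_sub_le _ _) _)
      _ = 2 + |z| := by
          rw [Complex.norm_exp_ofReal_mul_I]; simp; norm_num
      _ ≤ 3 * z ^ 2 := by rw [← sq_abs]; nlinarith

/-- The cubic Taylor bound for `exp (i z)`. -/
theorem norm_exp_I_sub_quadratic_le (z : ℝ) :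
    ‖Complex.exp (z * Complex.I) - 1 - z * Complex.I + z ^ 2 / 2‖ ≤ 4 * |z| ^ 3 := by
  rcases le_or_gt |z| 1 with h | h
  · have := Complex.exp_bound (x := z * Complex.I) (by simpa using h) (n := 3) (by norm_num)
    simp only [Finset.sum_range_succ, Finset.sum_range_zero, norm_mul, Complex.norm_real,
      Complex.norm_I, mul_one, Real.norm_eq_abs, Nat.factorial] at this
    have e : Complex.exp (z * Complex.I) - 1 - z * Complex.I + z ^ 2 / 2 =
        Complex.exp (z * Complex.I) - (0 + (z * Complex.I) ^ 0 / ((1 : ℕ) : ℂ) +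
          (z * Complex.I) ^ 1 / (((0 + 1) * 1 : ℕ) : ℂ) +
          (z * Complex.I) ^ 2 / (((1 + 1) * ((0 + 1) * 1) : ℕ) : ℂ)) := by
      rw [mul_pow _ _ 2, Complex.I_sq]
      push_cast
      ring
    rw [e]
    refine this.trans ?_
    have := pow_nonneg (abs_nonneg z) 3
    norm_num
    nlinarith
  · calc ‖Complex.exp (z * Complex.I) - 1 - z * Complex.I + z ^ 2 / 2‖
        ≤ ‖Complex.exp (z * Complex.I) - 1 - z * Complex.I‖ + ‖(z : ℂ) ^ 2 / 2‖ := norm_add_le _ _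
      _ ≤ 3 * z ^ 2 + z ^ 2 / 2 := by
          refine add_le_add (norm_exp_I_sub_linear_le z) (le_of_eq ?_)
          simp
      _ ≤ 4 * |z| ^ 3 := by rw [← sq_abs]; nlinarith [sq_nonneg |z|]

/-- The Fourier transform of the density `f`, centred at the mean of `f`. -/
def centredFourier (f : ℝ → ℝ) (w : ℝ) : ℂ :=
  ∫ x, f x • Complex.exp (((-2 * Real.pi * w * (x - ∫ y, f y * y) : ℝ) : ℂ) * Complex.I)

theorem fourier_eq_centredFourier (f : ℝ → ℝ) (w : ℝ) :
    𝓕 (fun x => (f x : ℂ)) w =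
      Complex.exp (((-2 * Real.pi * w * ∫ y, f y * y : ℝ) : ℂ) * Complex.I) *
        centredFourier f w := by
  rw [centredFourier, Real.fourier_real_eq_integral_exp_smul, ← integral_const_mul]
  refine integral_congr_ae (ae_of_all _ fun x => ?_)
  simp only [smul_eq_mul, Complex.real_smul]
  rw [mul_left_comm, ← Complex.exp_add, mul_comm]
  congr 2
  push_cast
  ring

theorem norm_centredFourier (f : ℝ → ℝ) (w : ℝ) :
    ‖centredFourier f w‖ = ‖𝓕 (fun x => (f x : ℂ)) w‖ := by
  rw [fourier_eq_centredFourier, norm_mul, Complex.norm_exp_ofReal_mul_I, one_mul]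

namespace GaussianLimit

variable {f : ℕ → ℝ → ℝ} {C : ℝ}

/-- Dominated convergence against the densities `f n`, for integrands of polynomial growth. -/
theorem tendsto_integral_smul {E : Type*} [NormedAddCommGroup E] [NormedSpace ℝ E]
    (hf : GaussianLimit f C) {G : ℕ → ℝ → E} {L : ℝ → E} {K : ℝ} {k : ℕ}
    (hGm : ∀ n, AEStronglyMeasurable (G n))
    (hGb : ∀ᶠ n in atTop, ∀ x, ‖G n x‖ ≤ K * (1 + |x|) ^ k)
    (hGL : ∀ x, Tendsto (fun n => G n x) atTop (𝓝 (L x))) :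
    Tendsto (fun n => ∫ x, f n x • G n x) atTop (𝓝 (∫ x, gaussianPDFReal 0 1 x • L x)) := by
  refine tendsto_integral_filter_of_dominated_convergence
    (fun x => C * K * ((1 + |x|) ^ k * Real.exp (-|x| / 4))) ?_ ?_
    ((integrable_one_add_abs_pow_mul_exp k).const_mul _) ?_
  · filter_upwards [hf.density] with n hn
    exact hn.measurable.aestronglyMeasurable.smul (hGm n)
  · filter_upwards [hf.density, hf.dominated, hGb] with n hn hd hb
    refine ae_of_all _ fun x => ?_
    rw [norm_smul, Real.norm_of_nonneg (hn.nonneg x)]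
    calc f n x * ‖G n x‖ ≤ C * Real.exp (-|x| / 4) * (K * (1 + |x|) ^ k) :=
          mul_le_mul (hd x) (hb x) (norm_nonneg _) ((hn.nonneg x).trans (hd x))
      _ = _ := by ring
  · exact ae_of_all _ fun x => (hf.tendsto x).smul (hGL x)

theorem integrable_smul {E : Type*} [NormedAddCommGroup E] [NormedSpace ℝ E]
    {u : ℝ → ℝ} (hu : IsBddDensity u C) (hd : ∀ x, u x ≤ C * Real.exp (-|x| / 4))
    {G : ℝ → E} {K : ℝ} {k : ℕ} (hGm : AEStronglyMeasurable G)
    (hGb : ∀ x, ‖G x‖ ≤ K * (1 + |x|) ^ k) : Integrable fun x => u x • G x := by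
  refine ((integrable_one_add_abs_pow_mul_exp k).const_mul (C * K)).mono'
    (hu.measurable.aestronglyMeasurable.smul hGm) (ae_of_all _ fun x => ?_)
  rw [norm_smul, Real.norm_of_nonneg (hu.nonneg x)]
  calc u x * ‖G x‖ ≤ C * Real.exp (-|x| / 4) * (K * (1 + |x|) ^ k) :=
        mul_le_mul (hd x) (hGb x) (norm_nonneg _) ((hu.nonneg x).trans (hd x))
    _ = _ := by ring

theorem tendsto_mean (hf : GaussianLimit f C) :
    Tendsto (fun n => ∫ x, f n x * x) atTop (𝓝 0) := by
  have h := hf.tendsto_integral_smul (G := fun _ x => x) (L := fun x => x) (K := 1) (k := 1)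
    (fun n => aestronglyMeasurable_id) (Eventually.of_forall fun n x => by
      rw [Real.norm_eq_abs]; linarith) (fun x => tendsto_const_nhds)
  rw [← integral_gaussianReal_eq_integral_smul one_ne_zero, integral_id_gaussianReal] at h
  exact h

theorem tendsto_variance (hf : GaussianLimit f C) :
    Tendsto (fun n => ∫ x, f n x * (x - ∫ y, f n y * y) ^ 2) atTop (𝓝 1) := by
  have hμ := hf.tendsto_mean
  have h := hf.tendsto_integral_smul (G := fun n x => (x - ∫ y, f n y * y) ^ 2)
    (L := fun x => (x - 0) ^ 2) (K := 1) (k := 2)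
    (fun n => by fun_prop) ?_ (fun x => (hμ.const_sub x).pow 2)
  · rw [← integral_gaussianReal_eq_integral_smul one_ne_zero] at h
    have hv := variance_eq_integral (μ := gaussianReal 0 1) (X := id) aemeasurable_id
    rw [variance_id_gaussianReal] at hv
    simp only [id, integral_id_gaussianReal] at hv
    rw [← hv] at h
    simpa using h
  · filter_upwards [hμ.eventually (Metric.ball_mem_nhds 0 one_pos)] with n hn x
    rw [dist_zero_right, Real.norm_eq_abs] at hn
    rw [norm_pow, Real.norm_eq_abs, one_mul]
    exact pow_le_pow_left₀ (abs_nonneg _) (by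
      linarith [abs_sub x (∫ y, f n y * y)]) 2

theorem tendsto_integral_abs_sub (hf : GaussianLimit f C) :
    Tendsto (fun n => ∫ x, |f n x - gaussianPDFReal 0 1 x|) atTop (𝓝 0) := by
  have h : Tendsto (fun n => ∫ x, |f n x - gaussianPDFReal 0 1 x|) atTop
      (𝓝 (∫ _ : ℝ, (0 : ℝ))) := by
    refine tendsto_integral_filter_of_dominated_convergence
      (fun x => C * ((1 + |x|) ^ 0 * Real.exp (-|x| / 4)) + gaussianPDFReal 0 1 x) ?_ ?_
      (((integrable_one_add_abs_pow_mul_exp 0).const_mul _).add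
        (integrable_gaussianPDFReal 0 1)) ?_
    · filter_upwards [hf.density] with n hn
      exact (hn.measurable.sub (measurable_gaussianPDFReal 0 1)).abs.aestronglyMeasurable
    · filter_upwards [hf.density, hf.dominated] with n hn hd
      refine ae_of_all _ fun x => ?_
      rw [Real.norm_eq_abs, abs_abs, pow_zero, one_mul]
      refine (abs_sub _ _).trans (add_le_add ?_ ?_)
      · rw [abs_of_nonneg (hn.nonneg x)]; exact hd x
      · rw [abs_of_nonneg (gaussianPDFReal_nonneg 0 1 x)]
    · refine ae_of_all _ fun x => ?_
      simpa using ((hf.tendsto x).sub_const (gaussianPDFReal 0 1 x)).abs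
  simpa using h

/-- The difference between a centred Fourier transform and its first-order Taylor polynomial `1`,
as one integral. -/
theorem centredFourier_sub_one {u : ℝ → ℝ} (hu : IsBddDensity u C)
    (hd : ∀ x, u x ≤ C * Real.exp (-|x| / 4)) (w : ℝ) :
    centredFourier u w - 1 = ∫ x, u x •
      (Complex.exp (((-2 * Real.pi * w * (x - ∫ y, u y * y) : ℝ) : ℂ) * Complex.I) - 1 -
        ((-2 * Real.pi * w * (x - ∫ y, u y * y) : ℝ) : ℂ) * Complex.I) := by
  set μ := ∫ y, u y * y with hμ
  have i1 : Integrable fun x => u x •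
      Complex.exp (((-2 * Real.pi * w * (x - μ) : ℝ) : ℂ) * Complex.I) :=
    integrable_smul hu hd (K := 1) (k := 0) (by fun_prop) fun x => by
      rw [Complex.norm_exp_ofReal_mul_I]; simp
  have i2 : Integrable fun x => u x • (1 : ℂ) :=
    integrable_smul hu hd (K := 1) (k := 0) (by fun_prop) fun x => by simp
  have i3 : Integrable fun x => u x * (x - μ) := by
    refine integrable_smul hu hd (G := fun x => x - μ) (K := 1 + |μ|) (k := 1) (by fun_prop)
      fun x => ?_
    rw [Real.norm_eq_abs, pow_one]
    nlinarith [abs_sub x μ, abs_nonneg x, abs_nonneg μ, mul_nonneg (abs_nonneg x) (abs_nonneg μ)]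
  have i3' : Integrable fun x => u x * x :=
    integrable_smul hu hd (G := fun x => x) (K := 1) (k := 1) (by fun_prop) fun x => by
      rw [Real.norm_eq_abs]; linarith
  have e3 : ∫ x, u x * (x - μ) = 0 := by
    simp only [mul_sub]
    rw [integral_sub i3' (hu.integrable.mul_const μ), integral_mul_const, hu.integral_eq_one,
      ← hμ]
    ring
  have i4 : Integrable fun x => u x • (((-2 * Real.pi * w * (x - μ) : ℝ) : ℂ) * Complex.I) := by
    refine ((i3.ofReal (𝕜 := ℂ)).mul_const ((-2 * Real.pi * w : ℝ) * Complex.I)).congr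
      (ae_of_all _ fun x => ?_)
    simp only [Complex.real_smul, Complex.coe_algebraMap]
    push_cast
    ring
  have e4 : ∫ x, u x • (((-2 * Real.pi * w * (x - μ) : ℝ) : ℂ) * Complex.I) = 0 := by
    have : ∀ x, u x • (((-2 * Real.pi * w * (x - μ) : ℝ) : ℂ) * Complex.I) =
        ((u x * (x - μ) : ℝ) : ℂ) * ((-2 * Real.pi * w : ℝ) * Complex.I) := fun x => by
      simp only [Complex.real_smul]
      push_cast
      ring
    simp only [this]
    rw [integral_mul_const, integral_complex_ofReal, e3]
    simp
  have e2 : ∫ x, u x • (1 : ℂ) = 1 := by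
    rw [integral_smul_const, hu.integral_eq_one, one_smul]
  calc centredFourier u w - 1
      = (∫ x, (u x • Complex.exp (((-2 * Real.pi * w * (x - μ) : ℝ) : ℂ) * Complex.I) -
          u x • (1 : ℂ))) -
          ∫ x, u x • (((-2 * Real.pi * w * (x - μ) : ℝ) : ℂ) * Complex.I) := by
        rw [integral_sub i1 i2, e4, e2, sub_zero]
        rfl
    _ = _ := by
        have h := integral_sub (i1.sub i2) i4
        simp only [Pi.sub_apply, ← smul_sub] at h
        rw [h]
        simp only [smul_sub]

/-- Near the origin the centred Fourier transforms decay like a Gaussian, uniformly in `n`. -/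
theorem exists_norm_centredFourier_le_exp (hf : GaussianLimit f C) :
    ∃ δ : ℝ, 0 < δ ∧ ∀ᶠ n in atTop, ∀ w, |w| ≤ δ →
      ‖centredFourier (f n) w‖ ≤ Real.exp (-w ^ 2) := by
  set J : ℝ := ∫ x : ℝ, (1 + |x|) ^ 3 * Real.exp (-|x| / 4) with hJ
  have hJ0 : 0 ≤ J := integral_nonneg fun x => by positivity
  have hC0 : 0 ≤ C := by
    obtain ⟨n, hn⟩ := hf.density.exists
    exact (hn.nonneg 0).trans (hn.le 0)
  set K : ℝ := 4 * (2 * Real.pi) ^ 3 * (C * J) with hK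
  have hK0 : 0 ≤ K := by positivity
  have hπ := Real.pi_gt_three
  have hπ' := Real.pi_lt_four
  refine ⟨min (8 / (K + 1)) (1 / 10), by positivity, ?_⟩
  have hv1 := hf.tendsto_variance.eventually (lt_mem_nhds (show (1 / 2 : ℝ) < 1 by norm_num))
  have hv2 := hf.tendsto_variance.eventually (gt_mem_nhds (show (1 : ℝ) < 2 by norm_num))
  filter_upwards [hf.density, hf.dominated, hv1, hv2,
    hf.tendsto_mean.eventually (Metric.ball_mem_nhds 0 one_pos)] with n hn hd h1 h2 hμ w hw
  rw [dist_zero_right, Real.norm_eq_abs] at hμ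
  set μ := ∫ y, f n y * y with hμd
  set v := ∫ x, f n x * (x - μ) ^ 2 with hv
  have hxμ : ∀ x, |x - μ| ≤ 1 + |x| := fun x => by linarith [abs_sub x μ]
  set z : ℝ → ℝ := fun x => -2 * Real.pi * w * (x - μ) with hz
  have iA : Integrable fun x => f n x •
      (Complex.exp ((z x : ℂ) * Complex.I) - 1 - (z x : ℂ) * Complex.I) := by
    refine integrable_smul hn hd (K := 3 * (2 * Real.pi * w) ^ 2) (k := 2) (by fun_prop)
      fun x => (norm_exp_I_sub_linear_le _).trans ?_
    have : (z x) ^ 2 = (2 * Real.pi * w) ^ 2 * |x - μ| ^ 2 := by rw [sq_abs]; ring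
    have h2 := mul_le_mul_of_nonneg_left (pow_le_pow_left₀ (abs_nonneg _) (hxμ x) 2)
      (show 0 ≤ 3 * (2 * Real.pi * w) ^ 2 by positivity)
    change 3 * (z x) ^ 2 ≤ _
    rw [this]
    linarith
  have iB : Integrable fun x => f n x * (x - μ) ^ 2 := by
    refine integrable_smul hn hd (G := fun x => (x - μ) ^ 2) (K := 1) (k := 2) (by fun_prop)
      fun x => ?_
    rw [norm_pow, Real.norm_eq_abs, one_mul]
    exact pow_le_pow_left₀ (abs_nonneg _) (hxμ x) 2
  have iB' : Integrable fun x => f n x • ((z x : ℂ) ^ 2 / 2) := by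
    refine ((iB.ofReal (𝕜 := ℂ)).mul_const (2 * Real.pi ^ 2 * w ^ 2 : ℂ)).congr
      (ae_of_all _ fun x => ?_)
    simp only [Complex.real_smul, Complex.coe_algebraMap, hz]
    push_cast
    ring
  have eB : ∫ x, f n x • ((z x : ℂ) ^ 2 / 2) = ((2 * Real.pi ^ 2 * w ^ 2 * v : ℝ) : ℂ) := by
    have : ∀ x, f n x • ((z x : ℂ) ^ 2 / 2) =
        ((f n x * (x - μ) ^ 2 : ℝ) : ℂ) * (2 * Real.pi ^ 2 * w ^ 2 : ℂ) := fun x => by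
      simp only [Complex.real_smul, hz]
      push_cast
      ring
    simp only [this]
    rw [integral_mul_const, integral_complex_ofReal, ← hv]
    push_cast
    ring
  have e : centredFourier (f n) w - 1 + ((2 * Real.pi ^ 2 * w ^ 2 * v : ℝ) : ℂ) =
      ∫ x, f n x • (Complex.exp ((z x : ℂ) * Complex.I) - 1 - (z x : ℂ) * Complex.I +
        (z x : ℂ) ^ 2 / 2) := by
    simp only [smul_add]
    rw [centredFourier_sub_one hn hd, ← eB, integral_add iA iB']
  have hb : ‖centredFourier (f n) w - 1 + ((2 * Real.pi ^ 2 * w ^ 2 * v : ℝ) : ℂ)‖ ≤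
      K * |w| ^ 3 := by
    have : K * |w| ^ 3 = ∫ x : ℝ, 4 * (2 * Real.pi) ^ 3 * C * |w| ^ 3 *
        ((1 + |x|) ^ 3 * Real.exp (-|x| / 4)) := by
      rw [integral_const_mul, hK]; ring
    rw [e, this]
    refine norm_integral_le_of_norm_le
      ((integrable_one_add_abs_pow_mul_exp 3).const_mul _) (ae_of_all _ fun x => ?_)
    rw [norm_smul, Real.norm_of_nonneg (hn.nonneg x)]
    have hz3 : |z x| ^ 3 ≤ (2 * Real.pi) ^ 3 * |w| ^ 3 * (1 + |x|) ^ 3 := by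
      have : |z x| = 2 * Real.pi * |w| * |x - μ| := by
        simp only [hz, abs_mul, abs_neg, abs_two, abs_of_pos Real.pi_pos]
      rw [this, mul_pow, mul_pow]
      have := pow_le_pow_left₀ (abs_nonneg _) (hxμ x) 3
      gcongr
    calc f n x * ‖Complex.exp ((z x : ℂ) * Complex.I) - 1 - (z x : ℂ) * Complex.I +
          (z x : ℂ) ^ 2 / 2‖
        ≤ (C * Real.exp (-|x| / 4)) * (4 * ((2 * Real.pi) ^ 3 * |w| ^ 3 * (1 + |x|) ^ 3)) :=
          mul_le_mul (hd x) ((norm_exp_I_sub_quadratic_le _).trans (by linarith))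
            (norm_nonneg _) (by positivity)
      _ = _ := by ring
  have hw1 : |w| ≤ 8 / (K + 1) := hw.trans (min_le_left _ _)
  have hw2 : |w| ≤ 1 / 10 := hw.trans (min_le_right _ _)
  have hw3 : K * |w| ≤ 8 := by
    rw [le_div_iff₀ (by linarith)] at hw1
    nlinarith [abs_nonneg w]
  have hws : w ^ 2 ≤ 1 / 100 := by rw [← sq_abs]; nlinarith [abs_nonneg w]
  have hq1 : 2 * Real.pi ^ 2 * w ^ 2 * v ≤ 1 := by
    have : Real.pi ^ 2 ≤ 16 := by nlinarith
    have : 2 * Real.pi ^ 2 * w ^ 2 ≤ 32 / 100 := by nlinarith [sq_nonneg w]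
    nlinarith [mul_nonneg (mul_nonneg zero_le_two (sq_nonneg Real.pi)) (sq_nonneg w)]
  have hq2 : 9 * w ^ 2 ≤ 2 * Real.pi ^ 2 * w ^ 2 * v := by
    have h9 : 9 ≤ Real.pi ^ 2 := by nlinarith
    have : 9 ≤ 2 * Real.pi ^ 2 * v := by nlinarith
    nlinarith [sq_nonneg w]
  calc ‖centredFourier (f n) w‖
      = ‖(centredFourier (f n) w - 1 + ((2 * Real.pi ^ 2 * w ^ 2 * v : ℝ) : ℂ)) +
          ((1 - 2 * Real.pi ^ 2 * w ^ 2 * v : ℝ) : ℂ)‖ := by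
        congr 1; push_cast; ring
    _ ≤ K * |w| ^ 3 + (1 - 2 * Real.pi ^ 2 * w ^ 2 * v) := by
        refine (norm_add_le _ _).trans (add_le_add hb (le_of_eq ?_))
        rw [Complex.norm_real, Real.norm_of_nonneg (by linarith)]
    _ ≤ 8 * w ^ 2 + (1 - 9 * w ^ 2) := by
        have : K * |w| ^ 3 = K * |w| * w ^ 2 := by rw [← sq_abs]; ring
        rw [this]
        nlinarith [mul_le_mul_of_nonneg_right hw3 (sq_nonneg w)]
    _ ≤ Real.exp (-w ^ 2) := by linarith [Real.add_one_le_exp (-w ^ 2)]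

/-- Away from the origin the Fourier transforms are bounded away from one in modulus, uniformly
in `n`, by convergence in `L¹`. -/
theorem exists_norm_centredFourier_le_of_le (hf : GaussianLimit f C) {δ : ℝ} (hδ : 0 < δ) :
    ∃ ρ : ℝ, 0 < ρ ∧ ρ < 1 ∧ ∀ᶠ n in atTop, ∀ w, δ ≤ |w| → ‖centredFourier (f n) w‖ ≤ ρ := by
  set ρ₀ := Real.exp (-(2 * Real.pi ^ 2 * δ ^ 2)) with hρ₀
  have hρ1 : ρ₀ < 1 := Real.exp_lt_one_iff.2 (neg_lt_zero.2 (by have := Real.pi_pos; positivity))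
  have hρ0 : 0 < ρ₀ := Real.exp_pos _
  refine ⟨(ρ₀ + 1) / 2, by linarith, by linarith, ?_⟩
  filter_upwards [hf.density, hf.tendsto_integral_abs_sub.eventually
    (gt_mem_nhds (show 0 < (1 - ρ₀) / 2 by linarith))] with n hn h1 w hw
  rw [norm_centredFourier, Real.fourier_real_eq_integral_exp_smul]
  set e : ℝ → ℂ := fun x => Complex.exp (((-2 * Real.pi * w : ℝ) : ℂ) * x * Complex.I) with he
  have hen : ∀ x, ‖e x‖ = 1 := fun x => by
    have : e x = Complex.exp (((-2 * Real.pi * w * x : ℝ) : ℂ) * Complex.I) := by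
      simp only [he]; push_cast; rfl
    rw [this, Complex.norm_exp_ofReal_mul_I]
  have hec : Continuous e := by fun_prop
  have iu : ∀ u : ℝ → ℝ, Integrable u → Integrable fun x => u x • e x := fun u hu => by
    refine hu.smul_bdd 1 hec.aestronglyMeasurable (ae_of_all _ fun x => (hen x).le)
  have hg : ∫ x, gaussianPDFReal 0 1 x • e x = (Real.exp (-(2 * Real.pi ^ 2 * w ^ 2)) : ℂ) := by
    rw [← integral_gaussianReal_eq_integral_smul one_ne_zero]
    have := charFun_gaussianReal (μ := 0) (v := 1) (-2 * Real.pi * w)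
    rw [charFun_apply_real] at this
    rw [this]
    push_cast
    congr 1
    ring
  calc ‖∫ v : ℝ, Complex.exp (((-2 * Real.pi * v * w : ℝ) : ℂ) * Complex.I) • (f n v : ℂ)‖
      = ‖(∫ x, (f n x - gaussianPDFReal 0 1 x) • e x) + ∫ x, gaussianPDFReal 0 1 x • e x‖ := by
        simp only [sub_smul]
        rw [integral_sub (iu _ hn.integrable) (iu _ (integrable_gaussianPDFReal 0 1)),
          sub_add_cancel]
        congr 2
        ext x
        simp only [smul_eq_mul, Complex.real_smul, he]
        rw [mul_comm]
        congr 2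
        push_cast
        ring
    _ ≤ (∫ x, |f n x - gaussianPDFReal 0 1 x|) + ρ₀ := by
        refine (norm_add_le _ _).trans (add_le_add ?_ ?_)
        · refine norm_integral_le_of_norm_le
            (hn.integrable.sub (integrable_gaussianPDFReal 0 1)).abs (ae_of_all _ fun x => ?_)
          rw [norm_smul, hen, mul_one, Real.norm_eq_abs]
        · rw [hg, Complex.norm_real, Real.norm_of_nonneg (Real.exp_pos _).le, hρ₀]
          refine Real.exp_le_exp.2 ?_
          have := pow_le_pow_left₀ hδ.le hw 2
          rw [sq_abs] at this
          have := mul_le_mul_of_nonneg_left this (show 0 ≤ 2 * Real.pi ^ 2 by positivity)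
          linarith
    _ ≤ (ρ₀ + 1) / 2 := by linarith

end GaussianLimit

namespace GaussianLimit

variable {f : ℕ → ℝ → ℝ} {C : ℝ}

/-- The central limit theorem for the array, in terms of centred Fourier transforms. -/
theorem tendsto_centredFourier_pow (hf : GaussianLimit f C) (v : ℝ) :
    Tendsto (fun n : ℕ => centredFourier (f n) (v / Real.sqrt n) ^ n) atTop
      (𝓝 (Complex.exp (-2 * Real.pi ^ 2 * v ^ 2))) := by
  have hμ := hf.tendsto_mean
  set μ : ℕ → ℝ := fun n => ∫ y, f n y * y with hμd
  set z : ℕ → ℝ → ℝ := fun n x => -2 * Real.pi * (v / Real.sqrt n) * (x - μ n) with hz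
  set G : ℕ → ℝ → ℂ := fun n x => (n : ℂ) *
    (Complex.exp ((z n x : ℂ) * Complex.I) - 1 - (z n x : ℂ) * Complex.I) with hG
  have hzn : ∀ n : ℕ, 0 < n → ∀ x, (n : ℝ) * z n x ^ 2 = (2 * Real.pi * v * (x - μ n)) ^ 2 := by
    intro n hn x
    have hn' : (0 : ℝ) < n := by exact_mod_cast hn
    have hs := Real.sq_sqrt hn'.le
    simp only [hz]
    rw [mul_pow, mul_pow, div_pow, hs]
    field_simp
  have hlim := hf.tendsto_integral_smul (G := G)
    (L := fun x => (((-(2 * Real.pi * v * (x - 0)) ^ 2 / 2 : ℝ)) : ℂ))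
    (K := 3 * (2 * Real.pi * v) ^ 2) (k := 2) (fun n => by fun_prop) ?_ ?_
  · have hval : ∫ x, gaussianPDFReal 0 1 x • (((-(2 * Real.pi * v * (x - 0)) ^ 2 / 2 : ℝ)) : ℂ) =
        -2 * Real.pi ^ 2 * v ^ 2 := by
      have hv := variance_eq_integral (μ := gaussianReal 0 1) (X := id) aemeasurable_id
      rw [variance_id_gaussianReal] at hv
      simp only [id, integral_id_gaussianReal] at hv
      rw [← integral_gaussianReal_eq_integral_smul one_ne_zero, integral_complex_ofReal]
      have : ∀ x : ℝ, -(2 * Real.pi * v * (x - 0)) ^ 2 / 2 =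
        -2 * Real.pi ^ 2 * v ^ 2 * (x - 0) ^ 2 := fun x => by ring
      simp only [this]
      rw [integral_const_mul, ← hv]
      push_cast
      ring
    rw [hval] at hlim
    have h := Complex.tendsto_one_add_pow_exp_of_tendsto
      (g := fun n : ℕ => centredFourier (f n) (v / Real.sqrt n) - 1) (hlim.congr' ?_)
    · simpa using h
    · filter_upwards [hf.density, hf.dominated] with n hn hd
      rw [centredFourier_sub_one hn hd, ← integral_const_mul]
      refine integral_congr_ae (ae_of_all _ fun x => ?_)
      simp only [hG, hz, hμd, Complex.real_smul]
      ring
  · filter_upwards [eventually_gt_atTop 0, hμ.eventually (Metric.ball_mem_nhds 0 one_pos)]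
      with n hn hμn x
    rw [dist_zero_right, Real.norm_eq_abs] at hμn
    have hn' : (0 : ℝ) < n := by exact_mod_cast hn
    calc ‖G n x‖ = n * ‖Complex.exp ((z n x : ℂ) * Complex.I) - 1 - (z n x : ℂ) * Complex.I‖ := by
          rw [hG, norm_mul, Complex.norm_natCast]
      _ ≤ n * (3 * z n x ^ 2) :=
          mul_le_mul_of_nonneg_left (norm_exp_I_sub_linear_le _) hn'.le
      _ = 3 * (2 * Real.pi * v) ^ 2 * |x - μ n| ^ 2 := by
          rw [mul_left_comm, hzn n hn, sq_abs]; ring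
      _ ≤ _ := by
          refine mul_le_mul_of_nonneg_left (pow_le_pow_left₀ (abs_nonneg _) ?_ 2) (by positivity)
          linarith [abs_sub x (μ n)]
  · intro x
    have hx : Tendsto (fun n => x - μ n) atTop (𝓝 (x - 0)) := hμ.const_sub x
    have hinv : Tendsto (fun n : ℕ => (Real.sqrt n)⁻¹) atTop (𝓝 0) :=
      tendsto_inv_atTop_zero.comp (Real.tendsto_sqrt_atTop.comp tendsto_natCast_atTop_atTop)
    have hq : Tendsto (fun n : ℕ => ((-(2 * Real.pi * v * (x - μ n)) ^ 2 / 2 : ℝ) : ℂ)) atTop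
        (𝓝 ((-(2 * Real.pi * v * (x - 0)) ^ 2 / 2 : ℝ) : ℂ)) :=
      (Complex.continuous_ofReal.tendsto _).comp
        ((((hx.const_mul (2 * Real.pi * v)).pow 2).neg).div_const 2)
    have herr : Tendsto (fun n : ℕ => G n x - ((-(2 * Real.pi * v * (x - μ n)) ^ 2 / 2 : ℝ) : ℂ))
        atTop (𝓝 0) := by
      have hb : Tendsto (fun n : ℕ => 4 * |2 * Real.pi * v * (x - μ n)| ^ 3 * (Real.sqrt n)⁻¹)
          atTop (𝓝 (4 * |2 * Real.pi * v * (x - 0)| ^ 3 * 0)) :=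
        (((hx.const_mul (2 * Real.pi * v)).abs.pow 3).const_mul 4).mul hinv
      rw [mul_zero] at hb
      refine squeeze_zero_norm' ?_ hb
      filter_upwards [eventually_gt_atTop 0] with n hn
      have hn' : (0 : ℝ) < n := by exact_mod_cast hn
      have hs0 : 0 < Real.sqrt n := Real.sqrt_pos.2 hn'
      have hs := Real.mul_self_sqrt hn'.le
      have e1 : G n x - ((-(2 * Real.pi * v * (x - μ n)) ^ 2 / 2 : ℝ) : ℂ) =
          n * (Complex.exp ((z n x : ℂ) * Complex.I) - 1 - (z n x : ℂ) * Complex.I +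
            (z n x : ℂ) ^ 2 / 2) := by
        rw [← hzn n hn x, hG]
        push_cast
        ring
      have e2 : |z n x| = |2 * Real.pi * v * (x - μ n)| * (Real.sqrt n)⁻¹ := by
        have : z n x = -(2 * Real.pi * v * (x - μ n) * (Real.sqrt n)⁻¹) := by
          simp only [hz]; rw [div_eq_mul_inv]; ring
        rw [this, abs_neg, abs_mul, abs_of_pos (inv_pos.2 hs0)]
      rw [e1, norm_mul, Complex.norm_natCast]
      refine (mul_le_mul_of_nonneg_left (norm_exp_I_sub_quadratic_le _) hn'.le).trans
        (le_of_eq ?_)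
      rw [e2, mul_pow]
      have : (n : ℝ) * ((Real.sqrt n)⁻¹) ^ 3 = (Real.sqrt n)⁻¹ := by
        nth_rewrite 1 [← hs]
        field_simp
      linear_combination (4 * |2 * Real.pi * v * (x - μ n)| ^ 3) * this
    simpa using herr.add hq

theorem continuous_centredFourier {u : ℝ → ℝ} {D : ℝ} (hu : IsBddDensity u D) :
    Continuous (centredFourier u) := by
  have h := hu.continuous_fourier_density
  have e : centredFourier u = fun w =>
      Complex.exp (((2 * Real.pi * w * ∫ y, u y * y : ℝ) : ℂ) * Complex.I) *
        𝓕 (fun x => (u x : ℂ)) w := by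
    ext w
    rw [fourier_eq_centredFourier, ← mul_assoc, ← Complex.exp_add]
    push_cast
    ring_nf
    simp
  rw [e]
  fun_prop

/-- Fourier inversion around the mean, on the scale `√n`. -/
theorem sqrt_mul_sumDensity_eq {u : ℝ → ℝ} {D : ℝ} (hu : IsBddDensity u D) {n : ℕ} (hn : 2 ≤ n)
    (x : ℝ) :
    ((Real.sqrt n * sumDensity u n (n * (∫ y, u y * y) + x) : ℝ) : ℂ) =
      ∫ v : ℝ, Complex.exp (((2 * Real.pi * v * (x / Real.sqrt n) : ℝ) : ℂ) * Complex.I) *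
        centredFourier u (v / Real.sqrt n) ^ n := by
  obtain ⟨k, rfl⟩ : ∃ k, n = k + 2 := ⟨n - 2, by omega⟩
  have hs : 0 < Real.sqrt (k + 2 : ℕ) := Real.sqrt_pos.2 (by positivity)
  set s := Real.sqrt (k + 2 : ℕ) with hsd
  have h := Measure.integral_comp_div (fun w : ℝ =>
    Complex.exp (((2 * Real.pi * w * x : ℝ) : ℂ) * Complex.I) * centredFourier u w ^ (k + 2)) s
  have e1 : ∫ v : ℝ, Complex.exp (((2 * Real.pi * v * (x / s) : ℝ) : ℂ) * Complex.I) *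
        centredFourier u (v / s) ^ (k + 2) = ∫ v : ℝ, (fun w : ℝ =>
    Complex.exp (((2 * Real.pi * w * x : ℝ) : ℂ) * Complex.I) * centredFourier u w ^ (k + 2))
      (v / s) := by
    refine integral_congr_ae (ae_of_all _ fun v => ?_)
    simp only
    congr 4
    ring
  rw [e1, h, Complex.ofReal_mul, hu.sumDensity_eq_integral, abs_of_pos hs, Complex.real_smul]
  congr 1
  refine integral_congr_ae (ae_of_all _ fun w => ?_)
  simp only
  rw [fourier_eq_centredFourier, mul_pow, ← Complex.exp_nat_mul, ← mul_assoc, ← Complex.exp_add]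
  congr 2
  push_cast
  ring

/-- **Local limit theorem.** The density of the sum of `n` independent variables with density
`f n`, at distance `o(√n)` from its mean, is asymptotic to `1 / √(2πn)`. -/
theorem tendsto_sqrt_mul_sumDensity (hf : GaussianLimit f C) {x : ℕ → ℝ}
    (hx : Tendsto (fun n : ℕ => x n / Real.sqrt n) atTop (𝓝 0)) :
    Tendsto (fun n : ℕ => Real.sqrt n * sumDensity (f n) n (n * (∫ y, f n y * y) + x n)) atTop
      (𝓝 (Real.sqrt (2 * Real.pi))⁻¹) := by
  obtain ⟨δ, hδ, hnear⟩ := hf.exists_norm_centredFourier_le_exp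
  obtain ⟨ρ, hρ0, hρ1, hfar⟩ := hf.exists_norm_centredFourier_le_of_le hδ
  have hC0 : 0 ≤ C := by
    obtain ⟨n, hn⟩ := hf.density.exists
    exact (hn.nonneg 0).trans (hn.le 0)
  set J : ℕ → ℝ → ℂ := fun n v =>
    Complex.exp (((2 * Real.pi * v * (x n / Real.sqrt n) : ℝ) : ℂ) * Complex.I) *
        centredFourier (f n) (v / Real.sqrt n) ^ n with hJ
  have hJn : ∀ n v, ‖J n v‖ = ‖centredFourier (f n) (v / Real.sqrt n)‖ ^ n := fun n v => by
    rw [hJ, norm_mul, Complex.norm_exp_ofReal_mul_I, one_mul, norm_pow]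
  have hJc : ∀ n, IsBddDensity (f n) C → Continuous (J n) := fun n hn => by
    have := continuous_centredFourier hn
    fun_prop
  set S : ℕ → Set ℝ := fun n => {v | |v / Real.sqrt n| ≤ δ} with hS
  have hSm : ∀ n, MeasurableSet (S n) := fun n =>
    measurableSet_le (by fun_prop) measurable_const
  have hsq : Tendsto (fun n : ℕ => Real.sqrt n) atTop atTop :=
    Real.tendsto_sqrt_atTop.comp tendsto_natCast_atTop_atTop
  -- the central part of the Fourier integral
  have hcentral : Tendsto (fun n => ∫ v, (S n).indicator (J n) v) atTop
      (𝓝 (∫ v : ℝ, Complex.exp (-2 * Real.pi ^ 2 * v ^ 2))) := by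
    refine tendsto_integral_filter_of_dominated_convergence
      (fun v => Real.exp (-1 * v ^ 2)) ?_ ?_ (integrable_exp_neg_mul_sq one_pos) ?_
    · filter_upwards [hf.density] with n hn
      exact (hJc n hn).aestronglyMeasurable.indicator (hSm n)
    · filter_upwards [hnear, eventually_gt_atTop 0] with n hn hn0
      refine ae_of_all _ fun v => ?_
      by_cases hv : v ∈ S n
      · rw [Set.indicator_of_mem hv, hJn]
        have hn' : (0 : ℝ) < n := by exact_mod_cast hn0
        calc ‖centredFourier (f n) (v / Real.sqrt n)‖ ^ n
            ≤ Real.exp (-(v / Real.sqrt n) ^ 2) ^ n :=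
              pow_le_pow_left₀ (norm_nonneg _) (hn _ hv) n
          _ = Real.exp (-1 * v ^ 2) := by
              rw [← Real.exp_nat_mul, div_pow, Real.sq_sqrt hn'.le]
              congr 1
              field_simp
      · rw [Set.indicator_of_notMem hv, norm_zero]
        positivity
    · refine ae_of_all _ fun v => ?_
      have h1 : Tendsto (fun n => J n v) atTop (𝓝 (Complex.exp (-2 * Real.pi ^ 2 * v ^ 2))) := by
        have : Tendsto (fun n => Complex.exp
            (((2 * Real.pi * v * (x n / Real.sqrt n) : ℝ) : ℂ) * Complex.I)) atTop
            (𝓝 (Complex.exp (((2 * Real.pi * v * 0 : ℝ) : ℂ) * Complex.I))) :=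
          (Complex.continuous_exp.tendsto _).comp
            (((Complex.continuous_ofReal.tendsto _).comp (hx.const_mul _)).mul_const _)
        have h := this.mul (hf.tendsto_centredFourier_pow v)
        simp only [mul_zero, Complex.ofReal_zero, zero_mul, Complex.exp_zero, one_mul] at h
        exact h
      refine h1.congr' ?_
      have h2 : Tendsto (fun n : ℕ => |v / Real.sqrt n|) atTop (𝓝 0) := by
        simpa using (tendsto_const_nhds.div_atTop hsq).abs
      filter_upwards [h2.eventually (gt_mem_nhds hδ)] with n hn
      rw [Set.indicator_of_mem]
      exact hn.le
  -- the tails of the Fourier integral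
  have htail : Tendsto (fun n => ∫ v, (S n)ᶜ.indicator (J n) v) atTop (𝓝 0) := by
    have hb : Tendsto (fun n : ℕ => C * ρ⁻¹ ^ 2 * (n ^ 1 * ρ ^ n)) atTop
        (𝓝 (C * ρ⁻¹ ^ 2 * 0)) :=
      (tendsto_pow_const_mul_const_pow_of_abs_lt_one 1
        (by rwa [abs_of_pos hρ0])).const_mul _
    rw [mul_zero] at hb
    refine squeeze_zero_norm' ?_ hb
    filter_upwards [hf.density, hfar, eventually_ge_atTop 2] with n hn hfar hn2
    have hn1 : (1 : ℝ) ≤ n := by exact_mod_cast (by omega : 1 ≤ n)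
    have hs : 0 < Real.sqrt n := Real.sqrt_pos.2 (by linarith)
    have hsn : Real.sqrt n ≤ n := by
      rw [Real.sqrt_le_left (by linarith)]
      nlinarith
    set Q : ℝ → ℝ := fun w => ‖𝓕 (fun y => (f n y : ℂ)) w‖ ^ 2 with hQ
    have hQi : Integrable fun v => ρ ^ (n - 2) * Q (v / Real.sqrt n) :=
      (hn.integrable_norm_sq_fourier.comp_div hs.ne').const_mul _
    calc ‖∫ v, (S n)ᶜ.indicator (J n) v‖ ≤ ∫ v, ρ ^ (n - 2) * Q (v / Real.sqrt n) := by
          refine norm_integral_le_of_norm_le hQi (ae_of_all _ fun v => ?_)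
          by_cases hv : v ∈ (S n)ᶜ
          · have hQv : Q (v / Real.sqrt n) = ‖centredFourier (f n) (v / Real.sqrt n)‖ ^ 2 := by
              rw [norm_centredFourier]
            rw [Set.indicator_of_mem hv, hJn, hQv, ← Nat.sub_add_cancel hn2, pow_add,
              Nat.sub_add_cancel hn2]
            refine mul_le_mul_of_nonneg_right (pow_le_pow_left₀ (norm_nonneg _)
              (hfar _ (le_of_not_ge hv)) _) (by positivity)
          · rw [Set.indicator_of_notMem hv, norm_zero]
            positivity
      _ = ρ ^ (n - 2) * (Real.sqrt n * ∫ w, Q w) := by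
          rw [integral_const_mul, Measure.integral_comp_div, abs_of_pos hs, smul_eq_mul]
      _ ≤ ρ ^ (n - 2) * (n * C) := by
          refine mul_le_mul_of_nonneg_left (mul_le_mul hsn
            (hn.integral_norm_sq_fourier_le hC0)
            (integral_nonneg fun w => by positivity) (by linarith)) (by positivity)
      _ = C * ρ⁻¹ ^ 2 * (n ^ 1 * ρ ^ n) := by
          have hn3 : n = (n - 2) + 2 := by omega
          have : ρ ^ n = ρ ^ (n - 2) * ρ ^ 2 := by rw [← pow_add, ← hn3]
          rw [this]
          field_simp
  have hgauss : ∫ v : ℝ, Complex.exp (-2 * Real.pi ^ 2 * v ^ 2) =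
      (((Real.sqrt (2 * Real.pi))⁻¹ : ℝ) : ℂ) := by
    have h := integral_gaussian (2 * Real.pi ^ 2)
    have : Real.pi / (2 * Real.pi ^ 2) = (2 * Real.pi)⁻¹ := by
      have := Real.pi_pos
      field_simp
    rw [this, Real.sqrt_inv] at h
    rw [← h, ← integral_complex_ofReal]
    refine integral_congr_ae (ae_of_all _ fun v => ?_)
    simp only
    push_cast
    congr 1
    ring
  have hsum := hcentral.add htail
  rw [add_zero, hgauss] at hsum
  have hre := (Complex.continuous_re.tendsto _).comp hsum
  rw [Complex.ofReal_re] at hre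
  refine hre.congr' ?_
  filter_upwards [hf.density, eventually_ge_atTop 2] with n hn hn2
  have hJi : Integrable (J n) := by
    have hs : 0 < Real.sqrt n := Real.sqrt_pos.2 (by
      exact_mod_cast (by omega : 0 < n))
    refine (hn.integrable_norm_sq_fourier.comp_div hs.ne').mono'
      (hJc n hn).aestronglyMeasurable (ae_of_all _ fun v => ?_)
    rw [hJn, norm_centredFourier]
    exact pow_le_pow_of_le_one (norm_nonneg _) (hn.norm_fourier_le_one _) hn2
  have e := sqrt_mul_sumDensity_eq hn hn2 (x n)
  have : (∫ v, (S n).indicator (J n) v) + ∫ v, (S n)ᶜ.indicator (J n) v = ∫ v, J n v := by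
    rw [← integral_add (hJi.indicator (hSm n)) (hJi.indicator (hSm n).compl)]
    refine integral_congr_ae (ae_of_all _ fun v => ?_)
    exact congrFun (Set.indicator_self_add_compl (S n) (J n)) v
  simp only [Function.comp, this]
  rw [← Complex.ofReal_re (Real.sqrt n * _), e]

end GaussianLimit

/-! ### Laplace's method for the tilted density -/

/-- On `[A, ∞)` the function `g` is twice differentiable with `g' = h ≥ 0` and `g'' = h' > 0`,
and the natural scale `1 / √(h' x)` is negligible with respect to `x` and self-neglecting: on
windows of width comparable with it around `x`, the function `h'` is asymptotically constant. -/
structure RegularTail (g h h' : ℝ → ℝ) (A : ℝ) : Prop where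
  one_le : 1 ≤ A
  hasDerivAt_g : ∀ x, A ≤ x → HasDerivAt g (h x) x
  hasDerivAt_h : ∀ x, A ≤ x → HasDerivAt h (h' x) x
  h_nonneg : ∀ x, A ≤ x → 0 ≤ h x
  h'_pos : ∀ x, A ≤ x → 0 < h' x
  tendsto_sq : Tendsto (fun x => x ^ 2 * h' x) atTop atTop
  self_neglecting : ∀ R : ℝ, 0 < R → ∀ d : ℝ, 0 < d → ∀ᶠ x in atTop, ∀ y,
    |y - x| ≤ R * (Real.sqrt (h' x))⁻¹ → |h' y - h' x| ≤ d * h' x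

/-- The increment of the exponent `g` over its tangent line at `x`, at the distance `z` measured
in the unit `1 / √(h' x)`. -/
def tangentGap (g h h' : ℝ → ℝ) (x z : ℝ) : ℝ :=
  g (x + (Real.sqrt (h' x))⁻¹ * z) - g x - h x * ((Real.sqrt (h' x))⁻¹ * z)

/-- The density `p`, tilted by `h x` and rescaled around `x` with the unit `1 / √(h' x)`; the
normalisation makes it asymptotic to `exp (-z² / 2)`. -/
def rescaled (p g h h' : ℝ → ℝ) (c x z : ℝ) : ℝ :=
  Real.exp (g x + h x * ((Real.sqrt (h' x))⁻¹ * z)) * p (x + (Real.sqrt (h' x))⁻¹ * z) / c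

namespace RegularTail

variable {g h h' : ℝ → ℝ} {A : ℝ}

theorem mono (H : RegularTail g h h' A) {A' : ℝ} (hA : A ≤ A') : RegularTail g h h' A' where
  one_le := H.one_le.trans hA
  hasDerivAt_g x hx := H.hasDerivAt_g x (hA.trans hx)
  hasDerivAt_h x hx := H.hasDerivAt_h x (hA.trans hx)
  h_nonneg x hx := H.h_nonneg x (hA.trans hx)
  h'_pos x hx := H.h'_pos x (hA.trans hx)
  tendsto_sq := H.tendsto_sq
  self_neglecting := H.self_neglecting

theorem tendsto_scale_div (H : RegularTail g h h' A) :
    Tendsto (fun x => (Real.sqrt (h' x))⁻¹ / x) atTop (𝓝 0) := by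
  have h1 : Tendsto (fun x => (Real.sqrt (x ^ 2 * h' x))⁻¹) atTop (𝓝 0) :=
    tendsto_inv_atTop_zero.comp (Real.tendsto_sqrt_atTop.comp H.tendsto_sq)
  refine h1.congr' ?_
  filter_upwards [eventually_ge_atTop 0] with x hx
  rw [Real.sqrt_mul (sq_nonneg x), Real.sqrt_sq hx, mul_inv, div_eq_mul_inv, mul_comm]

theorem eventually_scale_le (H : RegularTail g h h' A) {R : ℝ} (hR : 0 < R) :
    ∀ᶠ x in atTop, R * (Real.sqrt (h' x))⁻¹ ≤ x / 2 := by
  filter_upwards [H.tendsto_scale_div.eventually (gt_mem_nhds (show 0 < 1 / (2 * R) by positivity)),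
    eventually_gt_atTop 0] with x hx hx0
  rw [div_lt_iff₀ hx0] at hx
  have := mul_le_mul_of_nonneg_left hx.le hR.le
  calc _ ≤ _ := this
    _ = x / 2 := by field_simp

/-- The increment over the tangent line is asymptotically quadratic, locally uniformly. -/
theorem eventually_abs_tangentGap_sub_le (H : RegularTail g h h' A) {R d : ℝ} (hR : 0 < R)
    (hd : 0 < d) : ∀ᶠ x in atTop, ∀ z, |z| ≤ R → |tangentGap g h h' x z - z ^ 2 / 2| ≤ d := by
  filter_upwards [H.self_neglecting R hR (d / R ^ 2) (by positivity), H.eventually_scale_le hR,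
    eventually_ge_atTop (2 * A)] with x h1 h2 hx z hz
  have hA := H.one_le
  set σ := (Real.sqrt (h' x))⁻¹ with hσ
  have hpos := H.h'_pos x (by linarith)
  have hσ0 : 0 < σ := inv_pos.2 (Real.sqrt_pos.2 hpos)
  have hσ2 : σ ^ 2 * h' x = 1 := by
    rw [hσ, inv_pow, Real.sq_sqrt hpos.le, inv_mul_cancel₀ hpos.ne']
  have hin : ∀ w ∈ Set.Icc (-R) R, A ≤ x + σ * w := fun w hw => by
    have : -(R * σ) ≤ σ * w := by nlinarith [hw.1]
    linarith
  have hcv : Convex ℝ (Set.Icc (-R) R) := convex_Icc _ _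
  have h0mem : (0 : ℝ) ∈ Set.Icc (-R) R := ⟨by linarith, hR.le⟩
  -- the second derivative of the difference is small, hence so is the first
  have hline : ∀ w, HasDerivAt (fun w => x + σ * w) σ w := fun w => by
    simpa using ((hasDerivAt_id w).const_mul σ).const_add x
  have D1 : ∀ w ∈ Set.Icc (-R) R, |σ * (h (x + σ * w) - h x) - w| ≤ d / R := by
    intro w hw
    have := hcv.norm_image_sub_le_of_norm_hasDerivWithin_le (C := d / R ^ 2)
      (f := fun w => σ * (h (x + σ * w) - h x) - w)
      (f' := fun w => σ * (h' (x + σ * w) * σ) - 1) (fun w hw => by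
        exact (((((H.hasDerivAt_h _ (hin w hw)).comp w (hline w)).sub_const (h x)).const_mul
          σ).sub (hasDerivAt_id w)).hasDerivWithinAt) (fun w hw => ?_) h0mem hw
    · simp only [mul_zero, add_zero, sub_self, sub_zero, Real.norm_eq_abs] at this
      refine this.trans ?_
      have hwR : |w| ≤ R := abs_le.2 hw
      calc d / R ^ 2 * |w| ≤ d / R ^ 2 * R := mul_le_mul_of_nonneg_left hwR (by positivity)
        _ = d / R := by field_simp
    · have hb := h1 (x + σ * w) (by
        rw [add_sub_cancel_left, abs_mul, abs_of_pos hσ0, mul_comm]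
        exact mul_le_mul_of_nonneg_right (abs_le.2 hw) hσ0.le)
      have e : σ * (h' (x + σ * w) * σ) - 1 = σ ^ 2 * (h' (x + σ * w) - h' x) := by
        rw [mul_sub, hσ2]; ring
      rw [Real.norm_eq_abs, e, abs_mul, abs_of_pos (pow_pos hσ0 2)]
      calc σ ^ 2 * |h' (x + σ * w) - h' x| ≤ σ ^ 2 * (d / R ^ 2 * h' x) :=
            mul_le_mul_of_nonneg_left hb (sq_nonneg _)
        _ = d / R ^ 2 * (σ ^ 2 * h' x) := by ring
        _ = d / R ^ 2 := by rw [hσ2, mul_one]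
  have D0 := hcv.norm_image_sub_le_of_norm_hasDerivWithin_le (C := d / R)
      (f := fun w => g (x + σ * w) - g x - h x * (σ * w) - w ^ 2 / 2)
      (f' := fun w => σ * (h (x + σ * w) - h x) - w) (fun w hw => by
        have e1 := ((H.hasDerivAt_g _ (hin w hw)).comp w (hline w)).sub_const (g x)
        have e2 := ((hasDerivAt_id w).const_mul σ).const_mul (h x)
        have e3 := ((hasDerivAt_id w).pow 2).div_const 2
        refine ((e1.sub e2).sub e3).hasDerivWithinAt.congr_deriv ?_
        simp only [id]
        ring) (fun w hw => D1 w hw) h0mem (abs_le.1 hz)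
  simp only [mul_zero, add_zero, sub_self, sub_zero, Real.norm_eq_abs, ne_eq, OfNat.ofNat_ne_zero,
    not_false_eq_true, zero_pow, zero_div] at D0
  refine D0.trans ?_
  calc d / R * |z| ≤ d / R * R := mul_le_mul_of_nonneg_left hz (by positivity)
    _ = d := by field_simp

theorem monotoneOn_h (H : RegularTail g h h' A) : MonotoneOn h (Set.Ici A) := by
  refine monotoneOn_of_deriv_nonneg (convex_Ici A)
    (fun x hx => (H.hasDerivAt_h x hx).continuousAt.continuousWithinAt)
    (fun x hx => ?_) (fun x hx => ?_)
  all_goals rw [interior_Ici] at hx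
  · exact (H.hasDerivAt_h x (Set.mem_Ioi.1 hx).le).differentiableAt.differentiableWithinAt
  · rw [(H.hasDerivAt_h x (Set.mem_Ioi.1 hx).le).deriv]
    exact (H.h'_pos x (Set.mem_Ioi.1 hx).le).le

theorem monotoneOn_g (H : RegularTail g h h' A) : MonotoneOn g (Set.Ici A) := by
  refine monotoneOn_of_deriv_nonneg (convex_Ici A)
    (fun x hx => (H.hasDerivAt_g x hx).continuousAt.continuousWithinAt)
    (fun x hx => ?_) (fun x hx => ?_)
  all_goals rw [interior_Ici] at hx
  · exact (H.hasDerivAt_g x (Set.mem_Ioi.1 hx).le).differentiableAt.differentiableWithinAt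
  · rw [(H.hasDerivAt_g x (Set.mem_Ioi.1 hx).le).deriv]
    exact H.h_nonneg x (Set.mem_Ioi.1 hx).le

theorem convexOn_g (H : RegularTail g h h' A) : ConvexOn ℝ (Set.Ici A) g := by
  refine MonotoneOn.convexOn_of_deriv (convex_Ici A)
    (fun x hx => (H.hasDerivAt_g x hx).continuousAt.continuousWithinAt)
    (fun x hx => ?_) (fun x hx y hy hxy => ?_)
  · rw [interior_Ici] at hx
    exact (H.hasDerivAt_g x (Set.mem_Ioi.1 hx).le).differentiableAt.differentiableWithinAt
  · rw [interior_Ici] at hx hy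
    rw [(H.hasDerivAt_g x (Set.mem_Ioi.1 hx).le).deriv,
      (H.hasDerivAt_g y (Set.mem_Ioi.1 hy).le).deriv]
    exact H.monotoneOn_h (Set.mem_Ioi.1 hx).le (Set.mem_Ioi.1 hy).le hxy

/-- By convexity, the increment over the tangent line grows at least linearly on the whole
half-line where `g` is regular. -/
theorem eventually_le_tangentGap (H : RegularTail g h h' A) :
    ∀ᶠ x in atTop, ∀ z, A ≤ x + (Real.sqrt (h' x))⁻¹ * z →
      |z| / 4 - 1 / 2 ≤ tangentGap g h h' x z := by
  filter_upwards [H.eventually_abs_tangentGap_sub_le one_pos (show (0 : ℝ) < 1 / 8 by norm_num),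
    eventually_ge_atTop A] with x h1 hx z hz
  set σ := (Real.sqrt (h' x))⁻¹ with hσ
  rcases le_or_gt |z| 1 with hz1 | hz1
  · have := (abs_le.1 (h1 z hz1)).1
    nlinarith [sq_nonneg z]
  · have hz0 : 0 < |z| := by linarith
    set e := z / |z| with he
    have hez : |z| * e = z := by rw [he]; field_simp
    have he1 : |e| = 1 := by rw [he, abs_div, abs_abs, div_self hz0.ne']
    have he2 : e ^ 2 = 1 := by rw [← sq_abs, he1, one_pow]
    have hq := (abs_le.1 (h1 e he1.le)).1
    rw [he2] at hq
    have hc := H.convexOn_g.2 hx hz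
      (show 0 ≤ 1 - 1 / |z| by rw [sub_nonneg, div_le_one hz0]; exact hz1.le)
      (show 0 ≤ 1 / |z| by positivity) (by ring)
    have hpt : (1 - 1 / |z|) • x + (1 / |z|) • (x + σ * z) = x + σ * e := by
      simp only [smul_eq_mul, he]
      field_simp
      ring
    rw [hpt] at hc
    simp only [smul_eq_mul] at hc
    have hc' : |z| * g (x + σ * e) ≤ (|z| - 1) * g x + g (x + σ * z) := by
      have := mul_le_mul_of_nonneg_left hc hz0.le
      calc _ ≤ _ := this
        _ = _ := by field_simp
    have hgap : |z| * tangentGap g h h' x e ≤ tangentGap g h h' x z := by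
      unfold tangentGap
      rw [← hσ]
      have : h x * (σ * z) = |z| * (h x * (σ * e)) := by
        nth_rewrite 1 [← hez]; ring
      rw [this]
      nlinarith
    nlinarith

/-- The unit `1 / √(h' x)` is not small compared with `1 / h x`. -/
theorem eventually_le_mul_scale (H : RegularTail g h h' A) :
    ∀ᶠ x in atTop, 1 / 4 ≤ h x * (Real.sqrt (h' x))⁻¹ := by
  filter_upwards [H.eventually_abs_tangentGap_sub_le one_pos (show (0 : ℝ) < 1 / 8 by norm_num),
    H.eventually_scale_le one_pos, eventually_ge_atTop (2 * A)] with x h1 h2 hx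
  have hA := H.one_le
  have hq := (abs_le.1 (h1 (-1) (by norm_num))).1
  have hσ : 0 ≤ (Real.sqrt (h' x))⁻¹ := by positivity
  rw [one_mul] at h2
  have hm := H.monotoneOn_g (a := x + (Real.sqrt (h' x))⁻¹ * (-1)) (b := x)
    (Set.mem_Ici.2 (by linarith)) (Set.mem_Ici.2 (by linarith)) (by linarith)
  unfold tangentGap at hq
  linarith

section Density

variable {p q : ℝ → ℝ} {c M : ℝ}

theorem rescaled_eq (hc : 0 < c) (hform : ∀ x, 0 < x → p x = c * Real.exp (-(g x - q x)))
    {x z : ℝ} (hpos : 0 < x + (Real.sqrt (h' x))⁻¹ * z) :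
    rescaled p g h h' c x z =
      Real.exp (-tangentGap g h h' x z + q (x + (Real.sqrt (h' x))⁻¹ * z)) := by
  rw [rescaled, hform _ hpos, mul_left_comm, mul_div_cancel_left₀ _ hc.ne', ← Real.exp_add,
    tangentGap]
  congr 1
  ring

theorem tendsto_rescaled (H : RegularTail g h h' A) (hc : 0 < c)
    (hform : ∀ x, 0 < x → p x = c * Real.exp (-(g x - q x))) (hq : Tendsto q atTop (𝓝 0)) (z : ℝ) :
    Tendsto (fun x => rescaled p g h h' c x z) atTop (𝓝 (Real.exp (-z ^ 2 / 2))) := by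
  have hR : 0 < |z| + 1 := by positivity
  have hgap : Tendsto (fun x => tangentGap g h h' x z) atTop (𝓝 (z ^ 2 / 2)) := by
    rw [Metric.tendsto_nhds]
    intro ε hε
    filter_upwards [H.eventually_abs_tangentGap_sub_le hR (half_pos hε)] with x hx
    rw [Real.dist_eq]
    exact (hx z (by linarith)).trans_lt (by linarith)
  have hlow : ∀ᶠ x in atTop, x / 2 ≤ x + (Real.sqrt (h' x))⁻¹ * z := by
    filter_upwards [H.eventually_scale_le hR] with x hx
    have hσ : 0 ≤ (Real.sqrt (h' x))⁻¹ := by positivity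
    nlinarith [neg_abs_le z]
  have harg : Tendsto (fun x => x + (Real.sqrt (h' x))⁻¹ * z) atTop atTop :=
    tendsto_atTop_mono' _ hlow (tendsto_id.atTop_div_const two_pos)
  have := (Real.continuous_exp.tendsto _).comp (hgap.neg.add (hq.comp harg))
  rw [add_zero, ← neg_div] at this
  refine this.congr' ?_
  filter_upwards [harg.eventually_gt_atTop 0] with x hx
  rw [rescaled_eq hc hform hx]
  rfl

/-- The rescaled tilted density is dominated by a double exponential. To the left of `A`, where
only boundedness of `p` is known, the bound at `A` is propagated by the factor `exp (h x * ·)`. -/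
theorem exists_rescaled_le (H : RegularTail g h h' A) (hc : 0 < c)
    (hform : ∀ x, 0 < x → p x = c * Real.exp (-(g x - q x))) (hq : Tendsto q atTop (𝓝 0))
    (hM : ∀ x, p x ≤ M) :
    ∃ K : ℝ, 0 < K ∧ ∀ᶠ x in atTop, ∀ z, rescaled p g h h' c x z ≤ K * Real.exp (-|z| / 4) := by
  obtain ⟨A₁, hA₁⟩ := eventually_atTop.1 (hq.eventually (gt_mem_nhds (one_pos (α := ℝ))))
  set A' := max A A₁ with hA'
  have H' := H.mono (le_max_left A A₁)
  rw [← hA'] at H'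
  have hA1 := H'.one_le
  have hM0 : 0 < M := lt_of_lt_of_le (by rw [hform 1 one_pos]; positivity) (hM 1)
  refine ⟨Real.exp (3 / 2) + M / c * Real.exp (g A' + 1 / 2), by positivity, ?_⟩
  filter_upwards [H'.eventually_le_tangentGap, H'.eventually_le_mul_scale,
    eventually_ge_atTop A'] with x h1 h2 hx z
  set σ := (Real.sqrt (h' x))⁻¹ with hσd
  have hσ : 0 < σ := inv_pos.2 (Real.sqrt_pos.2 (H'.h'_pos x hx))
  rw [add_mul]
  rcases le_or_gt A' (x + σ * z) with hz | hz
  · rw [rescaled_eq hc hform (by rw [← hσd]; linarith), ← hσd]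
    have hq1 := hA₁ (x + σ * z) ((le_max_right _ _).trans hz)
    have : Real.exp (-tangentGap g h h' x z + q (x + σ * z)) ≤
        Real.exp (3 / 2) * Real.exp (-|z| / 4) := by
      rw [← Real.exp_add]
      exact Real.exp_le_exp.2 (by linarith [h1 z hz])
    have h0 : 0 ≤ M / c * Real.exp (g A' + 1 / 2) * Real.exp (-|z| / 4) := by positivity
    linarith
  · have hz0 : z < 0 := by
      by_contra hcon
      have := mul_nonneg hσ.le (not_lt.1 hcon)
      linarith
    set zA := (A' - x) / σ with hzA
    have hσzA : σ * zA = A' - x := by rw [hzA]; field_simp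
    have hzA0 : zA ≤ 0 := div_nonpos_of_nonpos_of_nonneg (by linarith) hσ.le
    have hzzA : z ≤ zA := by
      rw [hzA, le_div_iff₀ hσ]; linarith
    have hgap := h1 zA (by rw [hσzA]; linarith)
    rw [abs_of_nonpos hzA0, tangentGap, ← hσd, hσzA, add_sub_cancel] at hgap
    have hstep : h x * (σ * z) ≤ h x * (A' - x) + (z - zA) / 4 := by
      rw [← hσzA]
      nlinarith
    have hexp : g x + h x * (σ * z) ≤ g A' + 1 / 2 + -|z| / 4 := by
      rw [abs_of_neg hz0]
      linarith
    have : rescaled p g h h' c x z ≤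
        M / c * Real.exp (g A' + 1 / 2) * Real.exp (-|z| / 4) := by
      rw [rescaled, ← hσd, mul_assoc, ← Real.exp_add, div_mul_eq_mul_div]
      refine div_le_div_of_nonneg_right ?_ hc.le
      rw [mul_comm]
      exact mul_le_mul (hM _) (Real.exp_le_exp.2 hexp) (Real.exp_pos _).le hM0.le
    have h0 : 0 ≤ Real.exp (3 / 2) * Real.exp (-|z| / 4) := by positivity
    linarith

theorem measurable_rescaled (hp : Measurable p) (x : ℝ) :
    Measurable (rescaled p g h h' c x) := by
  unfold rescaled
  fun_prop

theorem rescaled_nonneg (hc : 0 < c) (h0 : ∀ x, 0 ≤ p x) (x z : ℝ) :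
    0 ≤ rescaled p g h h' c x z :=
  div_nonneg (mul_nonneg (Real.exp_pos _).le (h0 _)) hc.le

theorem eventually_integrable_rescaled (H : RegularTail g h h' A) (hc : 0 < c)
    (hform : ∀ x, 0 < x → p x = c * Real.exp (-(g x - q x))) (hq : Tendsto q atTop (𝓝 0))
    (hM : ∀ x, p x ≤ M) (hp : Measurable p) (h0 : ∀ x, 0 ≤ p x) :
    ∀ᶠ x in atTop, Integrable (rescaled p g h h' c x) := by
  obtain ⟨K, hK, hdom⟩ := H.exists_rescaled_le hc hform hq hM
  filter_upwards [hdom] with x hx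
  refine ((integrable_one_add_abs_pow_mul_exp 0).const_mul K).mono'
    (measurable_rescaled hp x).aestronglyMeasurable (ae_of_all _ fun z => ?_)
  rw [Real.norm_of_nonneg (rescaled_nonneg hc h0 x z), pow_zero, one_mul]
  exact hx z

theorem integral_exp_neg_sq_div_two :
    ∫ z : ℝ, Real.exp (-z ^ 2 / 2) = Real.sqrt (2 * Real.pi) := by
  have h := integral_gaussian (1 / 2)
  rw [div_div_eq_mul_div, div_one, mul_comm Real.pi] at h
  rw [← h]
  congr 1
  ext z
  congr 1
  ring

theorem tendsto_integral_rescaled (H : RegularTail g h h' A) (hc : 0 < c)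
    (hform : ∀ x, 0 < x → p x = c * Real.exp (-(g x - q x))) (hq : Tendsto q atTop (𝓝 0))
    (hM : ∀ x, p x ≤ M) (hp : Measurable p) (h0 : ∀ x, 0 ≤ p x) :
    Tendsto (fun x => ∫ z, rescaled p g h h' c x z) atTop (𝓝 (Real.sqrt (2 * Real.pi))) := by
  obtain ⟨K, hK, hdom⟩ := H.exists_rescaled_le hc hform hq hM
  rw [← integral_exp_neg_sq_div_two]
  refine tendsto_integral_filter_of_dominated_convergence
    (fun z => K * ((1 + |z|) ^ 0 * Real.exp (-|z| / 4)))
    (Eventually.of_forall fun x => (measurable_rescaled hp x).aestronglyMeasurable) ?_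
    ((integrable_one_add_abs_pow_mul_exp 0).const_mul K)
    (ae_of_all _ fun z => H.tendsto_rescaled hc hform hq z)
  filter_upwards [hdom] with x hx
  refine ae_of_all _ fun z => ?_
  rw [Real.norm_of_nonneg (rescaled_nonneg hc h0 x z), pow_zero, one_mul]
  exact hx z

/-- The normalised rescaled tilted densities have a Gaussian limit. -/
theorem gaussianLimit_rescaled (H : RegularTail g h h' A) (hc : 0 < c)
    (hform : ∀ x, 0 < x → p x = c * Real.exp (-(g x - q x))) (hq : Tendsto q atTop (𝓝 0))
    (hM : ∀ x, p x ≤ M) (hp : Measurable p) (h0 : ∀ x, 0 ≤ p x) {x : ℕ → ℝ}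
    (hx : Tendsto x atTop atTop) :
    ∃ C, GaussianLimit (fun n z => rescaled p g h h' c (x n) z /
      ∫ w, rescaled p g h h' c (x n) w) C := by
  obtain ⟨K, hK, hdom⟩ := H.exists_rescaled_le hc hform hq hM
  have hI := H.tendsto_integral_rescaled hc hform hq hM hp h0
  have h2π : 1 < Real.sqrt (2 * Real.pi) := by
    rw [Real.lt_sqrt zero_le_one]
    linarith [Real.pi_gt_three]
  have hI1 := hx.eventually (hI.eventually (lt_mem_nhds h2π))
  have hint := hx.eventually (H.eventually_integrable_rescaled hc hform hq hM hp h0)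
  have hle : ∀ᶠ n in atTop, ∀ z, rescaled p g h h' c (x n) z /
      (∫ w, rescaled p g h h' c (x n) w) ≤ K * Real.exp (-|z| / 4) := by
    filter_upwards [hI1, hx.eventually hdom] with n h1 h3 z
    exact (div_le_self (rescaled_nonneg hc h0 _ _) h1.le).trans (h3 z)
  refine ⟨K, ?_, hle, fun z => ?_⟩
  · filter_upwards [hI1, hint, hle] with n h1 h2 h3
    refine ⟨(measurable_rescaled hp _).div_const _, fun z => div_nonneg
      (rescaled_nonneg hc h0 _ _) (by linarith), fun z => (h3 z).trans ?_, h2.div_const _, ?_⟩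
    · refine mul_le_of_le_one_right hK.le (Real.exp_le_one_iff.2 ?_)
      linarith [abs_nonneg z]
    · rw [integral_div, div_self (by linarith)]
  · have := ((H.tendsto_rescaled hc hform hq z).div hI (by linarith)).comp hx
    convert! this using 2
    simp [gaussianPDFReal, div_eq_inv_mul]

end Density

end RegularTail

/-! ### Regular variation -/

/-- Convergence along every selection from the windows around `x` implies uniform closeness on
these windows. -/
theorem eventually_forall_of_tendsto_selection {h' w : ℝ → ℝ} (hpos : ∀ᶠ x in atTop, 0 < h' x)
    (hw : ∀ᶠ x in atTop, 0 ≤ w x)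
    (hsel : ∀ y : ℝ → ℝ, (∀ᶠ x in atTop, |y x - x| ≤ w x) →
      Tendsto (fun x => h' (y x) / h' x) atTop (𝓝 1)) {d : ℝ} (hd : 0 < d) :
    ∀ᶠ x in atTop, ∀ y, |y - x| ≤ w x → |h' y - h' x| ≤ d * h' x := by
  classical
  set bad : ℝ → ℝ → Prop := fun x y => |y - x| ≤ w x ∧ d * h' x < |h' y - h' x| with hbad
  set y : ℝ → ℝ := fun x => if hx : ∃ y, bad x y then hx.choose else x with hy
  have hyw : ∀ᶠ x in atTop, |y x - x| ≤ w x := by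
    filter_upwards [hw] with x hx
    simp only [hy]
    split_ifs with hex
    · exact hex.choose_spec.1
    · simpa using hx
  have h1 := hsel y hyw
  rw [Metric.tendsto_nhds] at h1
  filter_upwards [h1 d hd, hpos] with x hx hp
  by_contra! hcon
  have hex : ∃ y, bad x y := hcon
  have hyx : y x = hex.choose := by simp only [hy, dif_pos hex]
  have h2 := hex.choose_spec.2
  rw [← hyx] at h2
  rw [Real.dist_eq, div_sub_one hp.ne', abs_div, abs_of_pos hp, div_lt_iff₀ hp] at hx
  linarith

theorem genInv_apply_eq {h : ℝ → ℝ} {x₀ x : ℝ} (hx : x₀ < x) (hlt : ∀ y, x₀ < y → y < x → h y < h x)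
    (hle : ∀ y, x ≤ y → h x ≤ h y) : genInv h x₀ (h x) = x := by
  have : {y | x₀ < y ∧ h x ≤ h y} = Set.Ici x := by
    ext y
    simp only [Set.mem_ofPred_eq, Set.mem_Ici]
    refine ⟨fun hy => ?_, fun hy => ⟨hx.trans_le hy, hle y hy⟩⟩
    by_contra hcon
    exact absurd (hlt y hy.1 (not_le.1 hcon)) (not_lt.2 hy.2)
  rw [genInv, this, csInf_Ici]

namespace IsR0Index

variable {ε : ℝ → ℝ}

theorem continuousOn_div (hε : IsR0Index ε) : ContinuousOn (fun u => ε u / u) (Set.Ici 1) :=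
  fun u hu => ((hε.differentiableAt u hu).continuousAt.div continuousAt_id
    (by have : (1 : ℝ) ≤ u := hu; simp only [id]; linarith)).continuousWithinAt

theorem intervalIntegrable (hε : IsR0Index ε) {a b : ℝ} (ha : 1 ≤ a) (hb : 1 ≤ b) :
    IntervalIntegrable (fun u => ε u / u) volume a b :=
  (hε.continuousOn_div.mono fun _ hu => (le_min ha hb).trans hu.1).intervalIntegrable

theorem hasDerivAt_integral (hε : IsR0Index ε) {x : ℝ} (hx : 1 < x) :
    HasDerivAt (fun x => ∫ u in (1 : ℝ)..x, ε u / u) (ε x / x) x := by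
  refine intervalIntegral.integral_hasDerivAt_right (hε.intervalIntegrable le_rfl hx.le) ?_ ?_
  · exact (hε.continuousOn_div.mono Set.Ioi_subset_Ici_self).stronglyMeasurableAtFilter isOpen_Ioi
      x hx
  · exact (hε.differentiableAt x hx.le).continuousAt.div continuousAt_id
      (ne_of_gt (by linarith : (0 : ℝ) < x))

theorem hasDerivAt_slowVar (hε : IsR0Index ε) {x : ℝ} (hx : 1 < x) :
    HasDerivAt (slowVar ε) (slowVar ε x * (ε x / x)) x :=
  (hε.hasDerivAt_integral hx).exp

theorem slowVar_pos (ε : ℝ → ℝ) (x : ℝ) : 0 < slowVar ε x := Real.exp_pos _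

theorem log_slowVar (ε : ℝ → ℝ) (x : ℝ) : Real.log (slowVar ε x) = ∫ u in (1 : ℝ)..x, ε u / u :=
  Real.log_exp _

theorem hasDerivAt_rpow_mul_slowVar (hε : IsR0Index ε) (β : ℝ) {x : ℝ} (hx : 1 < x) :
    HasDerivAt (fun x => x ^ β * slowVar ε x) (x ^ β * slowVar ε x * (β + ε x) / x) x := by
  have hx0 : 0 < x := by linarith
  refine ((Real.hasDerivAt_rpow_const (Or.inl hx0.ne')).mul
    (hε.hasDerivAt_slowVar hx)).congr_deriv ?_
  rw [Real.rpow_sub_one hx0.ne']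
  field_simp

theorem tendsto_rpow_mul_slowVar (hε : IsR0Index ε) {β : ℝ} (hβ : 0 < β) :
    Tendsto (fun x => x ^ β * slowVar ε x) atTop atTop := by
  obtain ⟨U, hU⟩ := eventually_atTop.1
    (hε.tendsto_zero.eventually (lt_mem_nhds (show -(β / 2) < 0 by linarith)))
  set V := max U 2 with hV
  have hV2 : 2 ≤ V := le_max_right _ _
  have hmono : MonotoneOn (fun x => x ^ (β / 2) * slowVar ε x) (Set.Ici V) := by
    refine monotoneOn_of_deriv_nonneg (convex_Ici V) (fun x hx => ?_) (fun x hx => ?_)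
      (fun x hx => ?_)
    · have : V ≤ x := hx
      exact (hε.hasDerivAt_rpow_mul_slowVar _ (by linarith)).continuousAt.continuousWithinAt
    all_goals
      rw [interior_Ici] at hx
      have hx' : V < x := hx
    · exact (hε.hasDerivAt_rpow_mul_slowVar _
        (by linarith)).differentiableAt.differentiableWithinAt
    · rw [(hε.hasDerivAt_rpow_mul_slowVar _ (by linarith)).deriv]
      have := hU x ((le_max_left _ _).trans hx'.le)
      have h2 := slowVar_pos ε x
      have h3 : 0 ≤ x := by linarith
      have h4 : 0 ≤ β / 2 + ε x := by linarith
      positivity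
  have hVpos : 0 < V ^ (β / 2) * slowVar ε V :=
    mul_pos (Real.rpow_pos_of_pos (by linarith) _) (slowVar_pos ε V)
  refine tendsto_atTop_mono' _ ?_ ((tendsto_rpow_atTop (half_pos hβ)).atTop_mul_const hVpos)
  filter_upwards [eventually_ge_atTop V] with x hx
  have h1 := hmono (Set.mem_Ici.2 le_rfl) (Set.mem_Ici.2 hx) hx
  calc x ^ (β / 2) * (V ^ (β / 2) * slowVar ε V)
      ≤ x ^ (β / 2) * (x ^ (β / 2) * slowVar ε x) :=
        mul_le_mul_of_nonneg_left h1 (Real.rpow_nonneg (by linarith) _)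
    _ = x ^ β * slowVar ε x := by
        rw [← mul_assoc, ← Real.rpow_add (by linarith), add_halves]

/-- Slow variation of `slowVar ε`, along any `y` asymptotically equal to `x`. -/
theorem tendsto_slowVar_div (hε : IsR0Index ε) {y : ℝ → ℝ}
    (hy : Tendsto (fun x => y x / x) atTop (𝓝 1)) :
    Tendsto (fun x => slowVar ε (y x) / slowVar ε x) atTop (𝓝 1) := by
  obtain ⟨U, hU⟩ := eventually_atTop.1 (hε.tendsto_zero.abs.eventually
    (gt_mem_nhds (show |(0 : ℝ)| < 1 by simp)))
  have hint : Tendsto (fun x => ∫ u in x..(y x), ε u / u) atTop (𝓝 0) := by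
    have hb : Tendsto (fun x => 2 * |y x / x - 1|) atTop (𝓝 (2 * |(1 : ℝ) - 1|)) :=
      (hy.sub_const 1).abs.const_mul 2
    rw [sub_self, abs_zero, mul_zero] at hb
    refine squeeze_zero_norm' ?_ hb
    filter_upwards [eventually_ge_atTop (2 * U), eventually_gt_atTop 0,
      hy.eventually (lt_mem_nhds (show (1 / 2 : ℝ) < 1 by norm_num))] with x hx hx0 hyx
    rw [lt_div_iff₀ hx0] at hyx
    have := intervalIntegral.norm_integral_le_of_norm_le_const (a := x) (b := y x)
      (f := fun u => ε u / u) (C := 2 / x) (fun u hu => ?_)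
    · refine this.trans (le_of_eq ?_)
      rw [div_sub_one hx0.ne', abs_div, abs_of_pos hx0]
      ring
    · have hu' : x / 2 ≤ u := by
        have := hu.1
        rcases min_lt_iff.1 this with h | h <;> linarith
      have hu0 : 0 < u := by linarith
      rw [norm_div, Real.norm_eq_abs, Real.norm_of_nonneg hu0.le, div_le_div_iff₀ hu0 hx0]
      have := (hU u (by linarith)).le
      nlinarith
  have := (Real.continuous_exp.tendsto _).comp hint
  rw [Real.exp_zero] at this
  refine this.congr' ?_
  filter_upwards [eventually_ge_atTop 2,
    hy.eventually (lt_mem_nhds (show (1 / 2 : ℝ) < 1 by norm_num))] with x hx hyx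
  rw [lt_div_iff₀ (by linarith)] at hyx
  simp only [Function.comp, slowVar]
  rw [← Real.exp_sub]
  congr 1
  rw [intervalIntegral.integral_interval_sub_left (hε.intervalIntegrable le_rfl (by linarith))
    (hε.intervalIntegrable le_rfl (by linarith))]

end IsR0Index

/-- A window function that is negligible with respect to `x` only contains points asymptotically
equal to `x`. -/
theorem tendsto_div_of_abs_sub_le {h' : ℝ → ℝ}
    (hsq : Tendsto (fun x => x ^ 2 * h' x) atTop atTop) {R : ℝ} {y : ℝ → ℝ}
    (hy : ∀ᶠ x in atTop, |y x - x| ≤ R * (Real.sqrt (h' x))⁻¹) :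
    Tendsto (fun x => y x / x) atTop (𝓝 1) := by
  have h1 : Tendsto (fun x => R * (Real.sqrt (x ^ 2 * h' x))⁻¹) atTop (𝓝 (R * 0)) :=
    (tendsto_inv_atTop_zero.comp (Real.tendsto_sqrt_atTop.comp hsq)).const_mul R
  rw [mul_zero] at h1
  rw [tendsto_iff_norm_sub_tendsto_zero]
  refine squeeze_zero' (Eventually.of_forall fun x => norm_nonneg _) ?_ h1
  filter_upwards [hy, eventually_gt_atTop 0] with x hx hx0
  rw [Real.norm_eq_abs, div_sub_one hx0.ne', abs_div, abs_of_pos hx0, div_le_iff₀ hx0,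
    Real.sqrt_mul (sq_nonneg x), Real.sqrt_sq hx0.le, mul_inv]
  refine hx.trans (le_of_eq ?_)
  field_simp

theorem strictMonoOn_of_hasDerivAt_pos {h h' : ℝ → ℝ} {A : ℝ}
    (hd : ∀ x, A ≤ x → HasDerivAt h (h' x) x) (hpos : ∀ x, A ≤ x → 0 < h' x) :
    StrictMonoOn h (Set.Ici A) := by
  refine strictMonoOn_of_deriv_pos (convex_Ici A)
    (fun x hx => (hd x hx).continuousAt.continuousWithinAt) fun x hx => ?_
  rw [interior_Ici] at hx
  rw [(hd x (Set.mem_Ioi.1 hx).le).deriv]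
  exact hpos x (Set.mem_Ioi.1 hx).le

/-- For `h` in the class `R_β`, the derivative `h'` is regularly varying of index `β - 1`. -/
theorem ClassRBeta.exists_regularTail {β : ℝ} {g h : ℝ → ℝ} {x₀ : ℝ} (hx₀ : 1 ≤ x₀)
    (hg : ∀ x, x₀ < x → HasDerivAt g (h x) x) (hh : ClassRBeta β h x₀) :
    ∃ (A : ℝ) (h' : ℝ → ℝ), RegularTail g h h' A ∧ Tendsto h atTop atTop ∧
      ∀ x, A ≤ x → genInv h x₀ (h x) = x := by
  obtain ⟨hβ, ε, hε, -, -, hform⟩ := hh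
  set h' : ℝ → ℝ := fun x => x ^ β * slowVar ε x * (β + ε x) / x with hh'
  have htend : Tendsto h atTop atTop := by
    refine (hε.tendsto_rpow_mul_slowVar hβ).congr' ?_
    filter_upwards [eventually_gt_atTop x₀] with x hx using (hform x hx).symm
  have hder : ∀ x, x₀ < x → HasDerivAt h (h' x) x := fun x hx =>
    (hε.hasDerivAt_rpow_mul_slowVar β (hx₀.trans_lt hx)).congr_of_eventuallyEq <| by
      filter_upwards [lt_mem_nhds hx] with y hy using hform y hy
  have hβε : Tendsto (fun x => β + ε x) atTop (𝓝 β) := by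
    simpa using hε.tendsto_zero.const_add β
  obtain ⟨U, hU⟩ := eventually_atTop.1 (hβε.eventually (lt_mem_nhds hβ))
  set A := max U (x₀ + 1) with hA
  have hAx₀ : x₀ < A := lt_of_lt_of_le (by linarith) (le_max_right _ _)
  have hh'pos : ∀ x, A ≤ x → 0 < h' x := fun x hx => by
    have h1 := hU x ((le_max_left _ _).trans hx)
    have hx0 : 0 < x := by linarith
    have := Real.rpow_pos_of_pos hx0 β
    have := IsR0Index.slowVar_pos ε x
    positivity
  have hmono := strictMonoOn_of_hasDerivAt_pos (fun x hx => hder x (hAx₀.trans_le hx)) hh'pos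
  -- `h` is bounded between `x₀` and `A`
  obtain ⟨B, hB⟩ : ∃ B, ∀ x, x₀ < x → x ≤ A → h x ≤ B := by
    obtain ⟨D, hD⟩ := (isCompact_Icc (a := (1 : ℝ)) (b := A)).exists_bound_of_continuousOn
      (hε.continuousOn_div.mono Set.Icc_subset_Ici_self)
    refine ⟨A ^ β * Real.exp (D * |A - 1|), fun x hx hxA => ?_⟩
    have hx1 : 1 < x := by linarith
    rw [hform x hx, slowVar]
    refine mul_le_mul (Real.rpow_le_rpow (by linarith) hxA hβ.le) (Real.exp_le_exp.2 ?_)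
      (Real.exp_pos _).le (Real.rpow_nonneg (by linarith) _)
    have h1 := intervalIntegral.norm_integral_le_of_norm_le_const (a := 1) (b := x)
      (f := fun u => ε u / u) (C := D) (fun u hu => by
        rw [Set.uIoc_of_le hx1.le] at hu
        exact hD u ⟨hu.1.le, hu.2.trans hxA⟩)
    have hD0 : 0 ≤ D := (norm_nonneg _).trans (hD 1 ⟨le_rfl, by linarith⟩)
    refine ((Real.le_norm_self _).trans h1).trans (mul_le_mul_of_nonneg_left ?_ hD0)
    rw [abs_of_nonneg (by linarith), abs_of_nonneg (by linarith)]
    linarith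
  obtain ⟨A₂, hA₂⟩ := eventually_atTop.1 (htend.eventually_gt_atTop B)
  have hsq : Tendsto (fun x => x ^ 2 * h' x) atTop atTop := by
    have := ((tendsto_id (α := ℝ)).atTop_mul_atTop₀ htend).atTop_mul_pos hβ hβε
    refine this.congr' ?_
    filter_upwards [eventually_gt_atTop x₀, eventually_gt_atTop 0] with x hx hx0
    simp only [id, hh', hform x hx]
    field_simp
  have hpos_ev : ∀ᶠ x in atTop, 0 < h' x :=
    eventually_atTop.2 ⟨A, hh'pos⟩
  refine ⟨max A A₂, h', ⟨?_, ?_, ?_, ?_, ?_, hsq, ?_⟩, htend, ?_⟩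
  · exact (by linarith : (1 : ℝ) ≤ A).trans (le_max_left _ _)
  · exact fun x hx => hg x (hAx₀.trans_le ((le_max_left _ _).trans hx))
  · exact fun x hx => hder x (hAx₀.trans_le ((le_max_left _ _).trans hx))
  · intro x hx
    have hx1 : A ≤ x := (le_max_left _ _).trans hx
    rw [hform x (hAx₀.trans_le hx1)]
    exact mul_nonneg (Real.rpow_nonneg (by linarith) _) (IsR0Index.slowVar_pos ε x).le
  · exact fun x hx => hh'pos x ((le_max_left _ _).trans hx)
  · intro R hR d hd
    refine eventually_forall_of_tendsto_selection hpos_ev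
      (Eventually.of_forall fun x => by positivity) (fun y hy => ?_) hd
    have hyx := tendsto_div_of_abs_sub_le hsq hy
    have hytop : Tendsto y atTop atTop := by
      refine (hyx.pos_mul_atTop one_pos tendsto_id).congr' ?_
      filter_upwards [eventually_gt_atTop 0] with x hx
      simp only [id]
      field_simp
    have h1 : Tendsto (fun x => (y x / x) ^ β) atTop (𝓝 1) := by
      have := hyx.rpow_const (p := β) (Or.inl one_ne_zero)
      rwa [Real.one_rpow] at this
    have h2 := hε.tendsto_slowVar_div hyx
    have h3 : Tendsto (fun x => (β + ε (y x)) / (β + ε x)) atTop (𝓝 1) := by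
      have := (hβε.comp hytop).div hβε hβ.ne'
      rwa [div_self hβ.ne'] at this
    have h4 := hyx.inv₀ one_ne_zero
    have := ((h1.mul h2).mul h3).mul h4
    simp only [mul_one, inv_one] at this
    refine this.congr' ?_
    filter_upwards [eventually_gt_atTop 0, hytop.eventually_gt_atTop 0] with x hx hy0
    rw [Real.div_rpow hy0.le hx.le]
    simp only [hh']
    have e1 := (Real.rpow_pos_of_pos hx β).ne'
    have e2 := (IsR0Index.slowVar_pos ε x).ne'
    by_cases e3 : β + ε x = 0
    · simp [e3]
    · field_simp
  · intro x hx
    have hx1 : A ≤ x := (le_max_left _ _).trans hx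
    refine genInv_apply_eq (hAx₀.trans_le hx1) (fun y hy hyx => ?_) fun y hy =>
      hmono.monotoneOn hx1 (hx1.trans hy) hy
    rcases le_or_gt y A with hyA | hyA
    · exact (hB y hy hyA).trans_lt (hA₂ x ((le_max_right _ _).trans hx))
    · exact hmono hyA.le hx1 hyx

/-! ### Rapid variation -/

/-- A positive index function with `|x ε'(x)| ≤ ε x`: both `x ε(x)` and `x / ε(x)` are
nondecreasing. -/
structure IsSlowIndex (ε : ℝ → ℝ) (S : ℝ) : Prop where
  isR0Index : IsR0Index ε
  one_lt : 1 < S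
  pos : ∀ s, S ≤ s → 0 < ε s
  mul_deriv_le : ∀ s, S ≤ s → |s * deriv ε s| ≤ ε s

namespace IsSlowIndex

variable {ε : ℝ → ℝ} {S : ℝ}

theorem hasDerivAt (hε : IsSlowIndex ε S) {s : ℝ} (hs : S ≤ s) : HasDerivAt ε (deriv ε s) s :=
  (hε.isR0Index.differentiableAt s (hε.one_lt.le.trans hs)).hasDerivAt

theorem monotoneOn_mul (hε : IsSlowIndex ε S) : MonotoneOn (fun s => s * ε s) (Set.Ici S) := by
  have hd : ∀ s, S ≤ s → HasDerivAt (fun s => s * ε s) (1 * ε s + s * deriv ε s) s :=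
    fun s hs => (hasDerivAt_id s).mul (hε.hasDerivAt hs)
  refine monotoneOn_of_deriv_nonneg (convex_Ici S)
    (fun s hs => (hd s hs).continuousAt.continuousWithinAt) (fun s hs => ?_) (fun s hs => ?_)
  all_goals
    rw [interior_Ici] at hs
    have hs' : S ≤ s := (Set.mem_Ioi.1 hs).le
  · exact (hd s hs').differentiableAt.differentiableWithinAt
  · rw [(hd s hs').deriv]
    linarith [(abs_le.1 (hε.mul_deriv_le s hs')).1]

theorem antitoneOn_div (hε : IsSlowIndex ε S) : AntitoneOn (fun s => ε s / s) (Set.Ici S) := by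
  have h1 := hε.one_lt
  have hd : ∀ s, S ≤ s → HasDerivAt (fun s => ε s / s) ((deriv ε s * s - ε s * 1) / s ^ 2) s :=
    fun s hs => (hε.hasDerivAt hs).div (hasDerivAt_id s)
      (ne_of_gt (by linarith : (0 : ℝ) < s))
  refine antitoneOn_of_deriv_nonpos (convex_Ici S)
    (fun s hs => (hd s hs).continuousAt.continuousWithinAt) (fun s hs => ?_) (fun s hs => ?_)
  all_goals
    rw [interior_Ici] at hs
    have hs' : S ≤ s := (Set.mem_Ioi.1 hs).le
  · exact (hd s hs').differentiableAt.differentiableWithinAt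
  · rw [(hd s hs').deriv]
    refine div_nonpos_of_nonpos_of_nonneg ?_ (sq_nonneg s)
    linarith [(abs_le.1 (hε.mul_deriv_le s hs')).2]

/-- A lower bound for the increments of `log (slowVar ε)`, obtained by comparison with
`-u ε(u) / s` to the right of `u` and with `ε(u) s / u` to the left of `u`. -/
theorem mul_one_sub_min_le (hε : IsSlowIndex ε S) {u w : ℝ} (hu : S ≤ u) (hw : S ≤ w) :
    ε u * (1 - min (u / w) (w / u)) ≤
      |Real.log (slowVar ε w) - Real.log (slowVar ε u)| := by
  have h1 := hε.one_lt
  have hu0 : 0 < u := by linarith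
  have hw0 : 0 < w := by linarith
  simp only [IsR0Index.log_slowVar]
  set L : ℝ → ℝ := fun x => ∫ r in (1 : ℝ)..x, ε r / r with hL
  have hLd : ∀ s, S ≤ s → HasDerivAt L (ε s / s) s := fun s hs =>
    hε.isR0Index.hasDerivAt_integral (by linarith)
  rcases le_total u w with huw | hwu
  · have hd : ∀ s, u ≤ s → HasDerivAt (fun s => L s + u * ε u * s⁻¹)
        (ε s / s + u * ε u * (-(s ^ 2)⁻¹)) s := fun s hs =>
      (hLd s (hu.trans hs)).add ((hasDerivAt_inv (ne_of_gt (by linarith))).const_mul _)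
    have hm : MonotoneOn (fun s => L s + u * ε u * s⁻¹) (Set.Ici u) := by
      refine monotoneOn_of_deriv_nonneg (convex_Ici u)
        (fun s hs => (hd s hs).continuousAt.continuousWithinAt) (fun s hs => ?_) (fun s hs => ?_)
      all_goals
        rw [interior_Ici] at hs
        have hs' : u ≤ s := (Set.mem_Ioi.1 hs).le
      · exact (hd s hs').differentiableAt.differentiableWithinAt
      · rw [(hd s hs').deriv]
        have hE := hε.monotoneOn_mul hu (hu.trans hs') hs'
        simp only at hE
        have hs0 : 0 < s := by linarith
        have : ε s / s + u * ε u * (-(s ^ 2)⁻¹) = (s * ε s - u * ε u) / s ^ 2 := by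
          field_simp
          ring
        rw [this]
        exact div_nonneg (by linarith) (sq_nonneg s)
    have := hm (Set.mem_Ici.2 le_rfl) (Set.mem_Ici.2 huw) huw
    simp only at this
    have hmin : min (u / w) (w / u) = u / w := by
      refine min_eq_left (((div_le_one hw0).2 huw).trans ((one_le_div hu0).2 huw))
    have e1 : u * ε u * u⁻¹ = ε u := by field_simp
    have e2 : u * ε u * w⁻¹ = ε u * (u / w) := by rw [div_eq_mul_inv]; ring
    rw [hmin]
    refine le_trans ?_ (le_abs_self _)
    linarith
  · have hd : ∀ s, S ≤ s → HasDerivAt (fun s => L s - ε u / u * s) (ε s / s - ε u / u * 1) s :=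
      fun s hs => (hLd s hs).sub ((hasDerivAt_id s).const_mul _)
    have hm : MonotoneOn (fun s => L s - ε u / u * s) (Set.Icc S u) := by
      refine monotoneOn_of_deriv_nonneg (convex_Icc S u)
        (fun s hs => (hd s hs.1).continuousAt.continuousWithinAt) (fun s hs => ?_) (fun s hs => ?_)
      all_goals
        rw [interior_Icc] at hs
      · exact (hd s hs.1.le).differentiableAt.differentiableWithinAt
      · rw [(hd s hs.1.le).deriv]
        have hE := hε.antitoneOn_div hs.1.le hu hs.2.le
        simp only at hE
        linarith
    have := hm ⟨hw, hwu⟩ ⟨hu, le_rfl⟩ hwu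
    simp only at this
    have hmin : min (u / w) (w / u) = w / u := by
      refine min_eq_right (((div_le_one hu0).2 hwu).trans ((one_le_div hw0).2 hwu))
    have e1 : ε u / u * u = ε u := by field_simp
    have e2 : ε u / u * w = ε u * (w / u) := by ring
    rw [hmin, abs_sub_comm]
    refine le_trans ?_ (le_abs_self _)
    linarith

/-- The ratios of arguments and of values of `ε` are both controlled by `min (u / w) (w / u)`. -/
theorem ratio_bounds (hε : IsSlowIndex ε S) {u w : ℝ} (hu : S ≤ u) (hw : S ≤ w) :
    min (u / w) (w / u) ≤ ε u / ε w ∧ ε u / ε w ≤ (min (u / w) (w / u))⁻¹ ∧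
      min (u / w) (w / u) ≤ w / u ∧ w / u ≤ (min (u / w) (w / u))⁻¹ := by
  have h1 := hε.one_lt
  have hu0 : 0 < u := by linarith
  have hw0 : 0 < w := by linarith
  have eu := hε.pos u hu
  have ew := hε.pos w hw
  have key : ∀ a b : ℝ, S ≤ a → a ≤ b → a * ε a ≤ b * ε b ∧ ε b * a ≤ ε a * b := by
    intro a b ha hab
    have ha0 : 0 < a := by linarith
    refine ⟨hε.monotoneOn_mul ha (ha.trans hab) hab, ?_⟩
    have := hε.antitoneOn_div ha (ha.trans hab) hab
    simp only at this
    rwa [div_le_div_iff₀ (by linarith) ha0] at this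
  rcases le_total u w with huw | hwu
  · have hmin : min (u / w) (w / u) = u / w :=
      min_eq_left (((div_le_one hw0).2 huw).trans ((one_le_div hu0).2 huw))
    obtain ⟨k1, k2⟩ := key u w hu huw
    rw [hmin, inv_div]
    refine ⟨?_, ?_, ((div_le_one hw0).2 huw).trans ((one_le_div hu0).2 huw), le_rfl⟩
    · rw [div_le_div_iff₀ hw0 ew]; linarith
    · rw [div_le_div_iff₀ ew hu0]; linarith
  · have hmin : min (u / w) (w / u) = w / u :=
      min_eq_right (((div_le_one hu0).2 hwu).trans ((one_le_div hw0).2 hwu))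
    obtain ⟨k1, k2⟩ := key w u hw hwu
    rw [hmin, inv_div]
    refine ⟨?_, ?_, le_rfl, ((div_le_one hu0).2 hwu).trans ((one_le_div hw0).2 hwu)⟩
    · rw [div_le_div_iff₀ hu0 ew]; linarith
    · rw [div_le_div_iff₀ ew hw0]; linarith

theorem strictMonoOn_slowVar (hε : IsSlowIndex ε S) : StrictMonoOn (slowVar ε) (Set.Ici S) := by
  have h1 := hε.one_lt
  refine strictMonoOn_of_hasDerivAt_pos
    (fun x hx => hε.isR0Index.hasDerivAt_slowVar (by linarith)) fun x hx => ?_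
  have := hε.pos x hx
  have := IsR0Index.slowVar_pos ε x
  have : 0 < x := by linarith
  positivity

/-- If `slowVar ε` inverts `h` near infinity, with `h' = h / (x ε(h))`, then `1 / √h'` is
self-neglecting. -/
theorem self_neglecting (hε : IsSlowIndex ε S) {h h' : ℝ → ℝ} (htend : Tendsto h atTop atTop)
    (hmul : Tendsto (fun u => u * ε u) atTop atTop)
    (hinv : ∀ᶠ x in atTop, slowVar ε (h x) = x)
    (hh' : ∀ᶠ x in atTop, h' x = h x / (x * ε (h x)))
    (hsq : Tendsto (fun x => x ^ 2 * h' x) atTop atTop) (R : ℝ) (hR : 0 < R) (d : ℝ) (hd : 0 < d) :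
    ∀ᶠ x in atTop, ∀ y, |y - x| ≤ R * (Real.sqrt (h' x))⁻¹ → |h' y - h' x| ≤ d * h' x := by
  have h1 := hε.one_lt
  have hpos_ev : ∀ᶠ x in atTop, 0 < h' x := by
    filter_upwards [hsq.eventually_gt_atTop 0, eventually_gt_atTop 0] with x hx hx0
    exact pos_of_mul_pos_right hx (sq_nonneg x)
  refine eventually_forall_of_tendsto_selection hpos_ev
    (Eventually.of_forall fun x => by positivity) (fun y hy => ?_) hd
  have hyx := tendsto_div_of_abs_sub_le hsq hy
  have hytop : Tendsto y atTop atTop := by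
    refine (hyx.pos_mul_atTop one_pos tendsto_id).congr' ?_
    filter_upwards [eventually_gt_atTop 0] with x hx
    simp only [id]
    field_simp
  set r : ℝ → ℝ := fun x => min (h x / h (y x)) (h (y x) / h x) with hr
  have hrlim : Tendsto r atTop (𝓝 1) := by
    have hx1 : Tendsto (fun x => 2 * R * (Real.sqrt (x * (h x * ε (h x))))⁻¹) atTop
        (𝓝 (2 * R * 0)) :=
      (tendsto_inv_atTop_zero.comp (Real.tendsto_sqrt_atTop.comp
        (tendsto_id.atTop_mul_atTop₀ (hmul.comp htend)))).const_mul _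
    rw [mul_zero] at hx1
    rw [tendsto_iff_norm_sub_tendsto_zero]
    refine squeeze_zero' (Eventually.of_forall fun x => norm_nonneg _) ?_ hx1
    filter_upwards [hy, eventually_gt_atTop 0, htend.eventually_ge_atTop S,
      (htend.comp hytop).eventually_ge_atTop S, hinv, hytop.eventually hinv, hh',
      hyx.eventually (lt_mem_nhds (show (1 / 2 : ℝ) < 1 by norm_num)),
      hytop.eventually_gt_atTop 0, hpos_ev] with x hyw hx0 hS hSy hix hiy hh'x hyx2 hy0 hp
    have hSy' : S ≤ h (y x) := hSy
    have hu0 : 0 < h x := by linarith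
    have hw0 : 0 < h (y x) := by linarith
    have hu := hε.pos (h x) hS
    have hle := hε.mul_one_sub_min_le hS hSy'
    rw [hix, hiy] at hle
    rw [lt_div_iff₀ hx0] at hyx2
    have hlog : |Real.log (y x) - Real.log x| ≤ 2 * |y x - x| / x := by
      rw [abs_le]
      constructor
      · have := Real.log_le_sub_one_of_pos (div_pos hx0 hy0)
        rw [Real.log_div hx0.ne' hy0.ne'] at this
        have h2 : x / y x - 1 ≤ 2 * |y x - x| / x := by
          rw [div_sub_one hy0.ne', div_le_div_iff₀ hy0 hx0]
          have e1 : x - y x ≤ |y x - x| := by rw [abs_sub_comm]; exact le_abs_self _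
          nlinarith [abs_nonneg (y x - x)]
        linarith
      · have := Real.log_le_sub_one_of_pos (div_pos hy0 hx0)
        rw [Real.log_div hy0.ne' hx0.ne'] at this
        have h2 : y x / x - 1 ≤ 2 * |y x - x| / x := by
          rw [div_sub_one hx0.ne']
          refine div_le_div_of_nonneg_right ?_ hx0.le
          linarith [le_abs_self (y x - x), abs_nonneg (y x - x)]
        linarith
    have hrle : r x ≤ 1 := by
      rcases le_total (h x) (h (y x)) with hc | hc
      · exact (min_le_left _ _).trans ((div_le_one hw0).2 hc)
      · exact (min_le_right _ _).trans ((div_le_one hu0).2 hc)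
    rw [Real.norm_eq_abs, abs_sub_comm, abs_of_nonneg (sub_nonneg.2 hrle)]
    have hfin : ε (h x) * (1 - r x) ≤ 2 * (R * (Real.sqrt (h' x))⁻¹) / x :=
      (hle.trans hlog).trans (div_le_div_of_nonneg_right (by linarith) hx0.le)
    -- `σ / (x ε) = 1 / √(x u ε)` because `σ² = x ε / u`
    have hkey : (Real.sqrt (h' x))⁻¹ = x * ε (h x) * (Real.sqrt (x * (h x * ε (h x))))⁻¹ := by
      have e : x * (h x * ε (h x)) = (x * ε (h x)) ^ 2 * h' x := by
        rw [hh'x]; field_simp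
      rw [e, Real.sqrt_mul (sq_nonneg _), Real.sqrt_sq (by positivity), mul_inv]
      field_simp
    rw [hkey] at hfin
    have : 2 * (R * (x * ε (h x) * (Real.sqrt (x * (h x * ε (h x))))⁻¹)) / x =
        ε (h x) * (2 * R * (Real.sqrt (x * (h x * ε (h x))))⁻¹) := by
      field_simp
    rw [this] at hfin
    exact le_of_mul_le_mul_left hfin hu
  have hrinv : Tendsto (fun x => (r x)⁻¹) atTop (𝓝 1) := by
    simpa using hrlim.inv₀ one_ne_zero
  have hbounds : ∀ᶠ x in atTop, r x ≤ ε (h x) / ε (h (y x)) ∧ ε (h x) / ε (h (y x)) ≤ (r x)⁻¹ ∧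
      r x ≤ h (y x) / h x ∧ h (y x) / h x ≤ (r x)⁻¹ := by
    filter_upwards [htend.eventually_ge_atTop S, (htend.comp hytop).eventually_ge_atTop S]
      with x h2 h3 using hε.ratio_bounds h2 h3
  have l1 : Tendsto (fun x => ε (h x) / ε (h (y x))) atTop (𝓝 1) :=
    tendsto_of_tendsto_of_tendsto_of_le_of_le' hrlim hrinv (hbounds.mono fun x hx => hx.1)
      (hbounds.mono fun x hx => hx.2.1)
  have l2 : Tendsto (fun x => h (y x) / h x) atTop (𝓝 1) :=
    tendsto_of_tendsto_of_tendsto_of_le_of_le' hrlim hrinv (hbounds.mono fun x hx => hx.2.2.1)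
      (hbounds.mono fun x hx => hx.2.2.2)
  have := (l2.mul l1).mul (hyx.inv₀ one_ne_zero)
  simp only [mul_one, inv_one] at this
  refine this.congr' ?_
  filter_upwards [hh', hytop.eventually hh', htend.eventually_ge_atTop S,
    (htend.comp hytop).eventually_ge_atTop S, eventually_gt_atTop 0,
    hytop.eventually_gt_atTop 0] with x e1 e2 hS hSy hx0 hy0
  have hSy' : S ≤ h (y x) := hSy
  have hu := hε.pos (h x) hS
  have hw := hε.pos (h (y x)) hSy'
  have hu0 : 0 < h x := by linarith
  have hw0 : 0 < h (y x) := by linarith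
  rw [e1, e2]
  field_simp

end IsSlowIndex

/-- For `h` in the class `R_∞`, the inverse function theorem gives `h' = h / (x ε(h))`. -/
theorem ClassRInfty.exists_regularTail {g h : ℝ → ℝ} {x₀ : ℝ}
    (hg : ∀ x, x₀ < x → HasDerivAt g (h x) x) (hh : ClassRInfty h x₀) :
    ∃ (A : ℝ) (h' : ℝ → ℝ), RegularTail g h h' A ∧ Tendsto h atTop atTop ∧
      ∀ x, A ≤ x → genInv h x₀ (h x) = x := by
  obtain ⟨hmono, ε, hε, hψ, hd1, -, ⟨η, hη0, hη1, c, hc, hηc⟩, hform⟩ := hh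
  set ψ := genInv h x₀ with hψd
  have hψh : ∀ x, x₀ < x → ψ (h x) = x := fun x hx =>
    genInv_apply_eq hx (fun y hy hyx => hmono hy hx hyx)
      fun y hy => hmono.monotoneOn hx (hx.trans_le hy) hy
  -- the index function is positive and slowly varying near infinity
  have hpos : ∀ᶠ u in atTop, 0 < ε u := by
    filter_upwards [hηc, eventually_gt_atTop 0] with u hu hu0
    exact pos_of_mul_pos_right (hc.trans_le hu) (Real.rpow_pos_of_pos hu0 η).le
  have hder : ∀ᶠ u in atTop, |u * deriv ε u| ≤ ε u := by
    filter_upwards [hd1.abs.eventually (gt_mem_nhds (show |(0 : ℝ)| < 1 by simp)), hpos]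
      with u hu hp
    rw [abs_div, abs_of_pos hp, div_lt_one hp] at hu
    exact hu.le
  have hmul : Tendsto (fun u => u * ε u) atTop atTop := by
    refine tendsto_atTop_mono' _ ?_
      ((tendsto_rpow_atTop (show 0 < 1 - η by linarith)).atTop_mul_const hc)
    filter_upwards [hηc, eventually_gt_atTop 0] with u hu hu0
    calc u ^ (1 - η) * c ≤ u ^ (1 - η) * (u ^ η * ε u) :=
          mul_le_mul_of_nonneg_left hu (Real.rpow_nonneg hu0.le _)
      _ = u * ε u := by
          rw [← mul_assoc, ← Real.rpow_add hu0, sub_add_cancel, Real.rpow_one]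
  obtain ⟨S, hS⟩ := eventually_atTop.1 ((hpos.and hder).and
    (hform.and (eventually_gt_atTop (1 : ℝ))))
  have hslow : IsSlowIndex ε S := ⟨hε, (hS S le_rfl).2.2, fun s hs => (hS s hs).1.1,
    fun s hs => (hS s hs).1.2⟩
  have hψS : ∀ u, S ≤ u → ψ u = slowVar ε u := fun u hu => (hS u hu).2.1
  -- `h` is unbounded, since the infimum of the empty set is `0`
  have hunb : ∀ u, ∃ x, x₀ < x ∧ u ≤ h x := by
    intro u
    by_contra hcon
    have hempty : {x | x₀ < x ∧ max u S ≤ h x} = ∅ := by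
      ext x
      simp only [Set.mem_ofPred_eq, Set.mem_empty_iff_false, iff_false]
      exact fun hx => hcon ⟨x, hx.1, (le_max_left _ _).trans hx.2⟩
    have h0 : ψ (max u S) = 0 := by rw [hψd, genInv, hempty, Real.sInf_empty]
    rw [hψS _ (le_max_right _ _)] at h0
    exact (IsR0Index.slowVar_pos ε _).ne' h0
  have htend : Tendsto h atTop atTop := by
    refine tendsto_atTop.2 fun u => ?_
    obtain ⟨x, hx, hux⟩ := hunb u
    filter_upwards [eventually_ge_atTop x] with y hy
    exact hux.trans (hmono.monotoneOn hx (hx.trans_le hy) hy)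
  obtain ⟨A₀, hA₀⟩ := eventually_atTop.1 ((htend.eventually_gt_atTop S).and
    (eventually_gt_atTop x₀))
  have hinv : ∀ x, A₀ ≤ x → slowVar ε (h x) = x := fun x hx => by
    rw [← hψS _ (hA₀ x hx).1.le, hψh x (hA₀ x hx).2]
  -- `h` is a right inverse of `ψ` near infinity, hence has no jumps
  have hright : ∀ᶠ u in atTop, h (ψ u) = u ∧ A₀ < ψ u := by
    filter_upwards [hψ.eventually_gt_atTop A₀, eventually_ge_atTop S] with u hu huS
    refine ⟨hslow.strictMonoOn_slowVar.injOn (hA₀ _ hu.le).1.le huS ?_, hu⟩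
    rw [hinv _ hu.le, hψS u huS]
  obtain ⟨S₁, hS₁⟩ := eventually_atTop.1 hright
  have hcont : ∀ x, A₀ < x → S₁ < h x → ContinuousAt h x := by
    intro x hx hxS
    refine continuousAt_of_monotoneOn_of_image_mem_nhds (s := Set.Ioi A₀)
      (fun a ha b hb hab => hmono.monotoneOn (hA₀ a (Set.mem_Ioi.1 ha).le).2
        (hA₀ b (Set.mem_Ioi.1 hb).le).2 hab) (Ioi_mem_nhds hx) ?_
    refine mem_of_superset (Ioi_mem_nhds hxS) fun u hu => ?_
    exact ⟨ψ u, (hS₁ u (Set.mem_Ioi.1 hu).le).2, (hS₁ u (Set.mem_Ioi.1 hu).le).1⟩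
  set h' : ℝ → ℝ := fun x => h x / (x * ε (h x)) with hh'
  obtain ⟨A, hA⟩ := eventually_atTop.1 (((htend.eventually_gt_atTop S₁).and
    (eventually_gt_atTop A₀)).and ((htend.eventually_gt_atTop 0).and (eventually_ge_atTop 1)))
  have hdh : ∀ x, A ≤ x → HasDerivAt h (h' x) x := by
    intro x hx
    obtain ⟨⟨k1, k2⟩, k3, k4⟩ := hA x hx
    have hSx := (hA₀ x k2.le).1
    have hd := hε.hasDerivAt_slowVar (hslow.one_lt.trans hSx)
    rw [hinv x k2.le] at hd
    have hp := hslow.pos _ hSx.le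
    have := HasDerivAt.of_local_left_inverse (hcont x k2 k1) hd
      (by have : 0 < x := by linarith
          positivity)
      (by filter_upwards [lt_mem_nhds k2] with y hy using hinv y hy.le)
    refine this.congr_deriv ?_
    rw [hh', ← mul_div_assoc, inv_div]
  have hsq : Tendsto (fun x => x ^ 2 * h' x) atTop atTop := by
    refine tendsto_atTop_mono' _ ?_ (tendsto_id.atTop_mul_atTop₀ htend)
    filter_upwards [htend.eventually_gt_atTop 0, eventually_gt_atTop 0, htend.eventually hpos,
      htend.eventually (hε.tendsto_zero.eventually (gt_mem_nhds one_pos))] with x k1 k2 k3 k4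
    have e : x ^ 2 * h' x = x * h x / ε (h x) := by
      rw [hh']; field_simp
    rw [e, le_div_iff₀ k3]
    exact mul_le_of_le_one_right (by simp only [id]; positivity) k4.le
  refine ⟨A, h', ⟨(hA A le_rfl).2.2, ?_, hdh, ?_, ?_, hsq, ?_⟩, htend, ?_⟩
  · exact fun x hx => hg x (hA₀ x (hA x hx).1.2.le).2
  · exact fun x hx => (hA x hx).2.1.le
  · intro x hx
    obtain ⟨⟨k1, k2⟩, k3, k4⟩ := hA x hx
    have hp := hslow.pos _ (hA₀ x k2.le).1.le
    have : 0 < x := by linarith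
    exact div_pos k3 (mul_pos this hp)
  · exact hslow.self_neglecting htend hmul
      (eventually_atTop.2 ⟨A₀, hinv⟩) (Eventually.of_forall fun x => rfl) hsq
  · exact fun x hx => hψh x (hA₀ x (hA x hx).1.2.le).2

theorem ClassR.exists_regularTail {g h : ℝ → ℝ} {x₀ : ℝ} (hx₀ : 1 ≤ x₀)
    (hg : ∀ x, x₀ < x → HasDerivAt g (h x) x) (hh : ClassR h x₀) :
    ∃ (A : ℝ) (h' : ℝ → ℝ), RegularTail g h h' A ∧ Tendsto h atTop atTop ∧
      ∀ x, A ≤ x → genInv h x₀ (h x) = x := by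
  rcases hh with ⟨β, hβ⟩ | hinf
  · exact hβ.exists_regularTail hx₀ hg
  · exact hinf.exists_regularTail hg

/-- Near infinity `genInv h x₀` is a genuine inverse of `h`, with the expected derivative. -/
theorem RegularTail.eventually_genInv {g h h' : ℝ → ℝ} {A x₀ : ℝ} (H : RegularTail g h h' A)
    (htend : Tendsto h atTop atTop) (hinv : ∀ x, A ≤ x → genInv h x₀ (h x) = x) :
    (∀ᶠ u in atTop, h (genInv h x₀ u) = u ∧
      deriv (genInv h x₀) u = (h' (genInv h x₀ u))⁻¹) ∧
    Tendsto (genInv h x₀) atTop atTop := by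
  have hmono := strictMonoOn_of_hasDerivAt_pos H.hasDerivAt_h H.h'_pos
  have hsurj : ∀ u, h A ≤ u → ∃ x, A ≤ x ∧ h x = u := by
    intro u hu
    obtain ⟨B, hB⟩ := ((htend.eventually_ge_atTop u).and (eventually_ge_atTop A)).exists
    obtain ⟨x, hx, hxu⟩ := intermediate_value_Icc hB.2
      (fun x hx => (H.hasDerivAt_h x hx.1).continuousAt.continuousWithinAt) ⟨hu, hB.1⟩
    exact ⟨x, hx.1, hxu⟩
  have hψ : ∀ u, h A ≤ u → A ≤ genInv h x₀ u ∧ h (genInv h x₀ u) = u := by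
    intro u hu
    obtain ⟨x, hx, rfl⟩ := hsurj u hu
    rw [hinv x hx]
    exact ⟨hx, rfl⟩
  have hψm : MonotoneOn (genInv h x₀) (Set.Ioi (h A)) := by
    intro u hu v hv huv
    obtain ⟨k1, k2⟩ := hψ u (Set.mem_Ioi.1 hu).le
    obtain ⟨k3, k4⟩ := hψ v (Set.mem_Ioi.1 hv).le
    rw [← hmono.le_iff_le k1 k3, k2, k4]
    exact huv
  refine ⟨?_, ?_⟩
  · filter_upwards [eventually_gt_atTop (h A)] with u hu
    obtain ⟨k1, k2⟩ := hψ u hu.le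
    have hAψ : A < genInv h x₀ u := by
      rw [← hmono.lt_iff_lt (Set.mem_Ici.2 le_rfl) k1, k2]
      exact hu
    refine ⟨k2, ?_⟩
    have hc : ContinuousAt (genInv h x₀) u := by
      refine continuousAt_of_monotoneOn_of_image_mem_nhds hψm (Ioi_mem_nhds hu)
        (mem_of_superset (Ioi_mem_nhds hAψ) fun x hx => ?_)
      have hx' : A < x := hx
      exact ⟨h x, hmono (Set.mem_Ici.2 le_rfl) hx'.le hx', hinv x hx'.le⟩
    exact (HasDerivAt.of_local_left_inverse hc (H.hasDerivAt_h _ k1) (H.h'_pos _ k1).ne'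
      (by filter_upwards [lt_mem_nhds hu] with v hv using (hψ v hv.le).2)).deriv
  · refine tendsto_atTop.2 fun B => ?_
    filter_upwards [eventually_ge_atTop (h (max A B))] with u hu
    have hA : h A ≤ u := (hmono.monotoneOn (Set.mem_Ici.2 le_rfl)
      (Set.mem_Ici.2 (le_max_left A B)) (le_max_left A B)).trans hu
    obtain ⟨k1, k2⟩ := hψ u hA
    rw [← k2, hmono.le_iff_le (Set.mem_Ici.2 (le_max_left A B)) k1] at hu
    exact (le_max_right _ _).trans hu

/-! ### Tilting and rescaling of convolution powers -/

theorem integral_eq_of_comp_add_mul {F : ℝ → ℝ} (G : ℝ → ℝ) (x : ℝ) {σ : ℝ} (hσ : 0 < σ)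
    (hFG : ∀ z, F z = G (x + σ * z)) : ∫ z, F z = σ⁻¹ * ∫ y, G y := by
  rw [integral_congr_ae (ae_of_all _ hFG), ← smul_eq_mul,
    Measure.integral_comp_mul_left (fun y => G (x + y)) σ, integral_add_left_eq_self G x,
    abs_of_pos (inv_pos.2 hσ)]

/-- Exponential tilting and affine rescaling commute with convolution powers. -/
theorem sumDensity_tilted (p φ : ℝ → ℝ) (t x : ℝ) {σ : ℝ} (hσ : 0 < σ) (k : ℕ) (z : ℝ) :
    sumDensity (fun z => σ * tiltedDensity p φ t (x + σ * z)) (k + 1) z =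
      σ * (Real.exp (t * ((k + 1) * x + σ * z)) / φ t ^ (k + 1)) *
        sumDensity p (k + 1) ((k + 1) * x + σ * z) := by
  induction k generalizing z with
  | zero => simp [sumDensity, tiltedDensity, mul_assoc]
  | succ k ih =>
    have hσ' := hσ.ne'
    set c := σ * (Real.exp (t * ((k + 1 + 1) * x + σ * z)) / φ t ^ (k + 2)) * σ with hc
    have e1 : ∀ w, (σ * tiltedDensity p φ t (x + σ * w)) *
        sumDensity (fun z => σ * tiltedDensity p φ t (x + σ * z)) (k + 1) (z - w) =
        (fun y => c * (p y * sumDensity p (k + 1) (((k + 1 + 1) * x + σ * z) - y)))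
          (x + σ * w) := by
      intro w
      rw [ih, tiltedDensity]
      have ea : ((k + 1 + 1) * x + σ * z) - (x + σ * w) = (k + 1) * x + σ * (z - w) := by ring
      have eb : Real.exp (t * ((k + 1 + 1) * x + σ * z)) =
          Real.exp (t * (x + σ * w)) * Real.exp (t * ((k + 1) * x + σ * (z - w))) := by
        rw [← Real.exp_add]; congr 1; ring
      simp only [ea, hc, eb, pow_succ]
      field_simp
    have e2 : sumDensity (fun z => σ * tiltedDensity p φ t (x + σ * z)) (k + 1 + 1) z =
        ∫ w, (σ * tiltedDensity p φ t (x + σ * w)) *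
          sumDensity (fun z => σ * tiltedDensity p φ t (x + σ * z)) (k + 1) (z - w) := rfl
    rw [e2, integral_eq_of_comp_add_mul (fun y => c *
      (p y * sumDensity p (k + 1) (((k + 1 + 1) * x + σ * z) - y))) x hσ e1, integral_const_mul, hc]
    have e3 : sumDensity p (k + 1 + 1) ((k + 1 + 1) * x + σ * z) =
        ∫ y, p y * sumDensity p (k + 1) (((k + 1 + 1) * x + σ * z) - y) := rfl
    push_cast
    rw [e3]
    field_simp

/-- The normalised rescaled density is the density of the affinely rescaled tilted law. -/
theorem rescaled_div_integral_eq {p φ g h h' : ℝ → ℝ} {c x : ℝ} (hc : 0 < c) (hh' : 0 < h' x)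
    (hφ : φ (h x) = ∫ y, Real.exp (h x * y) * p y) (z : ℝ) :
    rescaled p g h h' c x z / ∫ w, rescaled p g h h' c x w =
      (Real.sqrt (h' x))⁻¹ * tiltedDensity p φ (h x) (x + (Real.sqrt (h' x))⁻¹ * z) := by
  set σ := (Real.sqrt (h' x))⁻¹ with hσd
  have hσ : 0 < σ := inv_pos.2 (Real.sqrt_pos.2 hh')
  have e : ∀ w, rescaled p g h h' c x w = (fun y => Real.exp (g x - h x * x) / c *
      (Real.exp (h x * y) * p y)) (x + σ * w) := by
    intro w
    have hexp : Real.exp (g x + h x * (σ * w)) =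
        Real.exp (g x - h x * x) * Real.exp (h x * (x + σ * w)) := by
      rw [← Real.exp_add]; congr 1; ring
    simp only [rescaled, ← hσd, hexp]
    ring
  have hE := Real.exp_pos (g x - h x * x)
  rw [integral_eq_of_comp_add_mul (fun y => Real.exp (g x - h x * x) / c *
      (Real.exp (h x * y) * p y)) x hσ e, integral_const_mul, ← hφ, e z, tiltedDensity]
  field_simp

/-- The local Gibbs principle for the densities, with the tilting parameters `h (x n)`: after
tilting, both the numerator and the denominator of the conditional density are densities of sums
of independent variables near their means, and the local limit theorem applies to each. -/
theorem tendsto_condDensity {p φ q g h h' : ℝ → ℝ} {A c M : ℝ} (H : RegularTail g h h' A)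
    (hc : 0 < c) (hform : ∀ x, 0 < x → p x = c * Real.exp (-(g x - q x)))
    (hq : Tendsto q atTop (𝓝 0)) (hM : ∀ x, p x ≤ M) (hp : Measurable p) (h0 : ∀ x, 0 ≤ p x)
    {x a : ℕ → ℝ} (hx : Tendsto x atTop atTop)
    (hφ : ∀ᶠ n in atTop, 0 < φ (h (x n)) ∧ φ (h (x n)) = ∫ y, Real.exp (h (x n) * y) * p y)
    (ha : ∀ᶠ n in atTop, a n = ∫ y, y * tiltedDensity p φ (h (x n)) y)
    (hgrowth : Tendsto (fun n : ℕ => x n ^ 2 / ((Real.sqrt (h' (x n)))⁻¹ * Real.sqrt n)) atTop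
      (𝓝 0)) (y₁ : ℝ) :
    (∀ᶠ n : ℕ in atTop, 0 < sumDensity p n (n * a n)) ∧
    ∃ r : ℕ → ℝ, Tendsto r atTop (𝓝 0) ∧ ∀ᶠ n : ℕ in atTop, condDensity p n (n * a n) y₁ =
      tiltedDensity p φ (h (x n)) y₁ * (1 + r n) := by
  obtain ⟨C, hG⟩ := H.gaussianLimit_rescaled hc hform hq hM hp h0 hx
  set σ : ℕ → ℝ := fun n => (Real.sqrt (h' (x n)))⁻¹ with hσd
  set f : ℕ → ℝ → ℝ := fun n z => rescaled p g h h' c (x n) z /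
      ∫ w, rescaled p g h h' c (x n) w with hf
  set μ : ℕ → ℝ := fun n => ∫ z, f n z * z with hμ
  have hμ0 : Tendsto μ atTop (𝓝 0) := hG.tendsto_mean
  have hσpos : ∀ᶠ n in atTop, 0 < σ n := by
    filter_upwards [hx.eventually_ge_atTop A] with n hn
    exact inv_pos.2 (Real.sqrt_pos.2 (H.h'_pos _ hn))
  have hfeq : ∀ᶠ n in atTop, f n = fun z => σ n * tiltedDensity p φ (h (x n)) (x n + σ n * z) := by
    filter_upwards [hφ, hx.eventually_ge_atTop A] with n hn hA
    exact funext fun z => rescaled_div_integral_eq hc (H.h'_pos _ hA) hn.2 z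
  -- the mean of the tilted law in terms of the mean of the rescaled one
  have hmean : ∀ᶠ n in atTop, a n = x n + σ n * μ n := by
    filter_upwards [hG.density, hG.dominated, hfeq, ha, hσpos] with n hn hd he han hσ
    have i1 : Integrable fun z => f n z * z :=
      GaussianLimit.integrable_smul hn hd (G := fun z => z) (K := 1) (k := 1) (by fun_prop)
        fun z => by rw [Real.norm_eq_abs]; linarith
    have e1 : ∫ z, f n z * (x n + σ n * z) = x n + σ n * μ n := by
      have : ∀ z, f n z * (x n + σ n * z) = f n z * x n + σ n * (f n z * z) := fun z => by ring
      simp only [this]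
      rw [integral_add (hn.integrable.mul_const _) (i1.const_mul _), integral_mul_const,
        integral_const_mul, hn.integral_eq_one, one_mul]
    rw [← e1, han, he]
    have : ∀ z, σ n * tiltedDensity p φ (h (x n)) (x n + σ n * z) * (x n + σ n * z) =
        (fun y => σ n * (y * tiltedDensity p φ (h (x n)) y)) (x n + σ n * z) := fun z => by
      simp only; ring
    rw [integral_eq_of_comp_add_mul (fun y => σ n * (y * tiltedDensity p φ (h (x n)) y)) (x n) hσ
      this, integral_const_mul, inv_mul_cancel_left₀ hσ.ne']
  -- the displacement caused by removing one variable is negligible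
  have hshift : Tendsto (fun n : ℕ => (a n - y₁) / σ n / Real.sqrt n) atTop (𝓝 0) := by
    have hsq : Tendsto (fun n : ℕ => (Real.sqrt n)⁻¹) atTop (𝓝 0) :=
      tendsto_inv_atTop_zero.comp (Real.tendsto_sqrt_atTop.comp tendsto_natCast_atTop_atTop)
    have hb : Tendsto (fun n : ℕ => 2 * (x n ^ 2 / (σ n * Real.sqrt n)) +
        |μ n| * (Real.sqrt n)⁻¹) atTop (𝓝 (2 * 0 + |(0 : ℝ)| * 0)) :=
      (hgrowth.const_mul 2).add (hμ0.abs.mul hsq)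
    rw [mul_zero, mul_zero, add_zero] at hb
    refine squeeze_zero_norm' ?_ hb
    filter_upwards [hmean, hσpos, eventually_gt_atTop 0, hx.eventually_ge_atTop 1,
      hx.eventually_ge_atTop |y₁|] with n hn hσ hn0 hx1 hxy
    have hs : 0 < Real.sqrt n := Real.sqrt_pos.2 (by exact_mod_cast hn0)
    have e : (a n - y₁) / σ n / Real.sqrt n =
        (x n - y₁) / (σ n * Real.sqrt n) + μ n * (Real.sqrt n)⁻¹ := by
      rw [hn]; field_simp; ring
    rw [e]
    refine (norm_add_le _ _).trans (add_le_add ?_ ?_)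
    · rw [norm_div, Real.norm_of_nonneg (mul_pos hσ hs).le, Real.norm_eq_abs, ← mul_div_assoc]
      refine div_le_div_of_nonneg_right ?_ (mul_pos hσ hs).le
      refine (abs_sub _ _).trans ?_
      rw [abs_of_nonneg (by linarith)]
      nlinarith
    · rw [norm_mul, Real.norm_eq_abs, Real.norm_of_nonneg (inv_pos.2 hs).le]
  have hratio : Tendsto (fun n : ℕ => Real.sqrt (n + 1 : ℕ) / Real.sqrt n) atTop (𝓝 1) := by
    have h1 : Tendsto (fun n : ℕ => 1 + 1 / (n : ℝ)) atTop (𝓝 (1 + 0)) :=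
      tendsto_one_div_atTop_nhds_zero_nat.const_add 1
    have h2 := (Real.continuous_sqrt.tendsto _).comp h1
    rw [add_zero, Real.sqrt_one] at h2
    refine h2.congr' ?_
    filter_upwards [eventually_gt_atTop 0] with n hn
    have hn' : (0 : ℝ) < n := by exact_mod_cast hn
    rw [Function.comp, ← Real.sqrt_div (by positivity)]
    congr 1
    push_cast
    field_simp
  -- the local limit theorem for all the variables, and for all of them but one
  have hfull : Tendsto (fun n : ℕ => Real.sqrt n * sumDensity (f n) n (n * μ n)) atTop
      (𝓝 (Real.sqrt (2 * Real.pi))⁻¹) := by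
    have := hG.tendsto_sqrt_mul_sumDensity (x := fun _ => 0) (by simp)
    simpa only [add_zero] using this
  have hG' : GaussianLimit (fun n => f (n + 1)) C :=
    ⟨(tendsto_add_atTop_nat 1).eventually hG.density,
      (tendsto_add_atTop_nat 1).eventually hG.dominated,
      fun z => (hG.tendsto z).comp (tendsto_add_atTop_nat 1)⟩
  have hpart := hG'.tendsto_sqrt_mul_sumDensity (x := fun n => (a (n + 1) - y₁) / σ (n + 1)) (by
    have := (hshift.comp (tendsto_add_atTop_nat 1)).mul hratio
    rw [zero_mul] at this
    refine this.congr' ?_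
    filter_upwards [eventually_gt_atTop 0] with n hn
    have hs : 0 < Real.sqrt n := Real.sqrt_pos.2 (by exact_mod_cast hn)
    have hs1 : 0 < Real.sqrt (n + 1 : ℕ) := Real.sqrt_pos.2 (by positivity)
    simp only [Function.comp]
    field_simp)
  have hκ : 0 < (Real.sqrt (2 * Real.pi))⁻¹ := by
    have := Real.pi_pos
    positivity
  have hFpos : ∀ᶠ n : ℕ in atTop, 0 < sumDensity (f n) n (n * μ n) := by
    filter_upwards [hfull.eventually (lt_mem_nhds hκ)] with n hn
    exact pos_of_mul_pos_right hn (Real.sqrt_nonneg _)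
  have hden : ∀ᶠ n : ℕ in atTop, sumDensity (f n) n (n * μ n) =
      σ n * (Real.exp (h (x n) * (n * a n)) / φ (h (x n)) ^ n) * sumDensity p n (n * a n) := by
    filter_upwards [hfeq, hσpos, hmean, eventually_ge_atTop 1] with n he hσ hm hn
    obtain ⟨k, rfl⟩ : ∃ k, n = k + 1 := ⟨n - 1, by omega⟩
    rw [he, sumDensity_tilted p φ _ _ hσ, hm]
    have : ((k + 1 : ℕ) : ℝ) * (x (k + 1) + σ (k + 1) * μ (k + 1)) =
        (k + 1) * x (k + 1) + σ (k + 1) * (((k + 1 : ℕ) : ℝ) * μ (k + 1)) := by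
      push_cast; ring
    rw [this]
  have hnum : ∀ᶠ n : ℕ in atTop, sumDensity (f (n + 1)) n
      (n * μ (n + 1) + (a (n + 1) - y₁) / σ (n + 1)) =
      σ (n + 1) * (Real.exp (h (x (n + 1)) * ((n + 1 : ℕ) * a (n + 1) - y₁)) /
        φ (h (x (n + 1))) ^ n) * sumDensity p n ((n + 1 : ℕ) * a (n + 1) - y₁) := by
    filter_upwards [(tendsto_add_atTop_nat 1).eventually hfeq,
      (tendsto_add_atTop_nat 1).eventually hσpos,
      (tendsto_add_atTop_nat 1).eventually hmean, eventually_ge_atTop 1] with n he hσ hm hn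
    obtain ⟨k, rfl⟩ : ∃ k, n = k + 1 := ⟨n - 1, by omega⟩
    rw [he, sumDensity_tilted p φ _ _ hσ]
    have : ((k : ℝ) + 1) * x (k + 1 + 1) + σ (k + 1 + 1) * (((k + 1 : ℕ) : ℝ) * μ (k + 1 + 1) +
        (a (k + 1 + 1) - y₁) / σ (k + 1 + 1)) = ((k + 1 + 1 : ℕ) : ℝ) * a (k + 1 + 1) - y₁ := by
      rw [hm]; push_cast; field_simp; ring
    rw [this]
  refine ⟨?_, ?_⟩
  · filter_upwards [hFpos, hden, hσpos, hφ] with n h1 h2 h3 h4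
    rw [h2] at h1
    have h4' := h4.1
    exact pos_of_mul_pos_right h1 (by positivity)
  · set F : ℕ → ℝ := fun n => sumDensity (f n) n (n * μ n) with hF
    set N : ℕ → ℝ := fun n => sumDensity (f n) (n - 1)
      ((n - 1 : ℕ) * μ n + (a n - y₁) / σ n) with hN
    refine ⟨fun n => N n / F n - 1, ?_, ?_⟩
    · rw [← tendsto_add_atTop_iff_nat 1]
      have h1 := ((hpart.div (hfull.comp (tendsto_add_atTop_nat 1)) hκ.ne').mul hratio).sub_const 1
      rw [div_self hκ.ne', one_mul, sub_self] at h1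
      refine h1.congr' ?_
      filter_upwards [eventually_gt_atTop 0,
        (tendsto_add_atTop_nat 1).eventually hFpos] with n hn hFn
      have hs : 0 < Real.sqrt n := Real.sqrt_pos.2 (by exact_mod_cast hn)
      have hs1 : 0 < Real.sqrt (n + 1 : ℕ) := Real.sqrt_pos.2 (by positivity)
      simp only [Pi.div_apply, Function.comp, hN, hF, hμ, Nat.add_sub_cancel] at hFn ⊢
      field_simp
    · have key : ∀ᶠ n : ℕ in atTop, condDensity p (n + 1) ((n + 1 : ℕ) * a (n + 1)) y₁ =
          tiltedDensity p φ (h (x (n + 1))) y₁ * (N (n + 1) / F (n + 1)) := by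
        filter_upwards [hnum, (tendsto_add_atTop_nat 1).eventually hden,
          (tendsto_add_atTop_nat 1).eventually hFpos,
          (tendsto_add_atTop_nat 1).eventually hσpos,
          (tendsto_add_atTop_nat 1).eventually hφ] with n k1 k2 k3 k4 k5
        have k5' := k5.1
        have hP : 0 < sumDensity p (n + 1) ((n + 1 : ℕ) * a (n + 1)) := by
          rw [k2] at k3
          exact pos_of_mul_pos_right k3 (by positivity)
        simp only [hN, hF, Nat.add_sub_cancel]
        rw [k1, k2, condDensity, tiltedDensity, Nat.add_sub_cancel]
        have hexp : Real.exp (h (x (n + 1)) * ((n + 1 : ℕ) * a (n + 1))) =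
            Real.exp (h (x (n + 1)) * y₁) *
              Real.exp (h (x (n + 1)) * ((n + 1 : ℕ) * a (n + 1) - y₁)) := by
          rw [← Real.exp_add]; congr 1; ring
        rw [hexp, pow_succ]
        have e1 := Real.exp_pos (h (x (n + 1)) * y₁)
        have e2 := Real.exp_pos (h (x (n + 1)) * ((n + 1 : ℕ) * a (n + 1) - y₁))
        generalize Real.exp (h (x (n + 1)) * y₁) = E₁ at e1 ⊢
        generalize Real.exp (h (x (n + 1)) * ((n + 1 : ℕ) * a (n + 1) - y₁)) = E₂ at e2 ⊢
        field_simp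
      rw [← eventually_map (m := fun n : ℕ => n + 1)
        (P := fun n : ℕ => condDensity p n (n * a n) y₁ =
          tiltedDensity p φ (h (x n)) y₁ * (N n / F n)), map_add_atTop_eq_nat] at key
      filter_upwards [key] with n hn
      rw [hn, add_sub_cancel]

/-! ### The tilting parameters -/

section Cgf

variable {Ω : Type*} [MeasurableSpace Ω] {P : Measure Ω} {Y : Ω → ℝ}

/-- To the left of the domain of the moment generating function, `cgf` is constant with the
value `0`, and so is its derivative wherever it exists. -/
theorem deriv_cgf_eq_zero_of_notMem (h0 : (0 : ℝ) ∈ interior (integrableExpSet Y P)) {t : ℝ}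
    (ht : t < 0) (hti : t ∉ interior (integrableExpSet Y P)) : deriv (cgf Y P) t = 0 := by
  by_cases hd : DifferentiableAt ℝ (cgf Y P) t
  swap
  · exact deriv_zero_of_not_differentiableAt hd
  have hleft : ∀ s, s < t → cgf Y P s = 0 := by
    intro s hs
    have hsn : s ∉ integrableExpSet Y P := fun hmem => hti <|
      convex_integrableExpSet.openSegment_self_interior_subset_interior hmem h0 <| by
        rw [openSegment_eq_Ioo (hs.trans ht)]
        exact ⟨hs, ht⟩
    rw [cgf, mgf_undef hsn, Real.log_zero]
  have ht0 : cgf Y P t = 0 := by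
    have h1 : Tendsto (cgf Y P) (𝓝[<] t) (𝓝 (cgf Y P t)) :=
      hd.continuousAt.tendsto.mono_left nhdsWithin_le_nhds
    have h2 : Tendsto (cgf Y P) (𝓝[<] t) (𝓝 0) :=
      tendsto_const_nhds.congr' (by
        filter_upwards [self_mem_nhdsWithin] with s hs using (hleft s hs).symm)
    exact tendsto_nhds_unique h1 h2
  have hw : HasDerivWithinAt (cgf Y P) (deriv (cgf Y P) t) (Set.Iic t) t :=
    hd.hasDerivAt.hasDerivWithinAt
  have hz : HasDerivWithinAt (cgf Y P) 0 (Set.Iic t) t :=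
    (hasDerivWithinAt_const t (Set.Iic t) (0 : ℝ)).congr (fun s hs => by
      rcases (Set.mem_Iic.1 hs).lt_or_eq with h | h
      · exact hleft s h
      · rw [h, ht0]) ht0
  exact (uniqueDiffOn_Iic t t Set.self_mem_Iic).eq_deriv _ hw hz

theorem monotoneOn_deriv_cgf [IsProbabilityMeasure P] :
    MonotoneOn (deriv (cgf Y P)) (interior (integrableExpSet Y P)) := by
  have hd : ∀ t ∈ interior (integrableExpSet Y P), DifferentiableAt ℝ (deriv (cgf Y P)) t :=
    fun t ht => (analyticAt_cgf ht).deriv.differentiableAt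
  refine monotoneOn_of_deriv_nonneg convex_integrableExpSet.interior
    (fun t ht => (hd t ht).continuousAt.continuousWithinAt) (fun t ht => ?_) (fun t ht => ?_)
  all_goals rw [interior_interior] at ht
  · exact (hd t ht).differentiableWithinAt
  · have h := iteratedDeriv_two_cgf_eq_integral ht
    rw [iteratedDeriv_succ, iteratedDeriv_one] at h
    rw [h]
    exact div_nonneg (integral_nonneg fun ω => by positivity) mgf_nonneg

/-- If the mean of the tilted law tends to infinity, then so does the tilting parameter, which
moreover lies in the interior of the domain of the moment generating function. -/
theorem tendsto_tilt [IsProbabilityMeasure P]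
    (h0 : (0 : ℝ) ∈ interior (integrableExpSet Y P))
    (hpos : ∀ t, 0 ≤ t → t ∈ interior (integrableExpSet Y P)) {a t : ℕ → ℝ}
    (ha : Tendsto a atTop atTop) (ht : ∀ᶠ n in atTop, deriv (cgf Y P) (t n) = a n) :
    Tendsto t atTop atTop := by
  refine tendsto_atTop.2 fun T => ?_
  filter_upwards [ht, ha.eventually_gt_atTop 0,
    ha.eventually_gt_atTop (deriv (cgf Y P) (max T 0))] with n hn hn0 hnT
  by_contra! hcon
  rw [← hn] at hn0 hnT
  have hmem : t n ∈ interior (integrableExpSet Y P) := by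
    by_contra hmem
    have hneg : t n < 0 := by
      by_contra! hge
      exact hmem (hpos _ hge)
    exact hn0.ne' (deriv_cgf_eq_zero_of_notMem h0 hneg hmem)
  exact absurd (monotoneOn_deriv_cgf hmem (hpos _ (le_max_right T 0))
    (hcon.le.trans (le_max_left T 0))) (not_le.2 hnT)

variable {p : ℝ → ℝ}

theorem integral_comp_eq_of_law (hY : Measurable Y) (hp : Measurable p) (h0 : ∀ x, 0 ≤ p x)
    (hlaw : P.map Y = volume.withDensity fun x => ENNReal.ofReal (p x)) {F : ℝ → ℝ}
    (hF : Measurable F) : ∫ ω, F (Y ω) ∂P = ∫ y, F y * p y := by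
  rw [← integral_map hY.aemeasurable hF.aestronglyMeasurable, hlaw,
    integral_withDensity_eq_integral_toReal_smul (by fun_prop)
      (ae_of_all _ fun x => ENNReal.ofReal_lt_top)]
  refine integral_congr_ae (ae_of_all _ fun y => ?_)
  simp only [smul_eq_mul, ENNReal.toReal_ofReal (h0 y)]
  ring

theorem integrable_comp_iff_of_law (hY : Measurable Y) (hp : Measurable p) (h0 : ∀ x, 0 ≤ p x)
    (hlaw : P.map Y = volume.withDensity fun x => ENNReal.ofReal (p x)) {F : ℝ → ℝ}
    (hF : Measurable F) : Integrable (fun ω => F (Y ω)) P ↔ Integrable fun y => F y * p y := by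
  have h1 : Integrable (fun ω => F (Y ω)) P ↔ Integrable F (P.map Y) :=
    (integrable_map_measure hF.aestronglyMeasurable hY.aemeasurable).symm
  rw [h1, hlaw, integrable_withDensity_iff (by fun_prop)
    (ae_of_all _ fun x => ENNReal.ofReal_lt_top)]
  simp only [ENNReal.toReal_ofReal (h0 _)]

end Cgf

/-- Under the regularity of the tail, the moment generating function is finite on `[0, ∞)`. -/
theorem RegularTail.mem_interior_integrableExpSet {Ω : Type*} [MeasurableSpace Ω] {P : Measure Ω}
    [IsProbabilityMeasure P] {Y : Ω → ℝ} {p q g h h' : ℝ → ℝ} {A c M : ℝ}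
    (H : RegularTail g h h' A) (htend : Tendsto h atTop atTop) (hc : 0 < c)
    (hform : ∀ x, 0 < x → p x = c * Real.exp (-(g x - q x))) (hq : Tendsto q atTop (𝓝 0))
    (hM : ∀ x, p x ≤ M) (hY : Measurable Y) (hp : Measurable p) (h0 : ∀ x, 0 ≤ p x)
    (hlaw : P.map Y = volume.withDensity fun x => ENNReal.ofReal (p x))
    (hcr : (0 : ℝ) ∈ interior (integrableExpSet Y P)) {t : ℝ} (ht : 0 ≤ t) :
    t ∈ interior (integrableExpSet Y P) := by
  obtain ⟨x, hxi, hxt, hxA⟩ := ((H.eventually_integrable_rescaled hc hform hq hM hp h0).and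
    ((htend.eventually_gt_atTop t).and (eventually_ge_atTop A))).exists
  have hσ : Real.sqrt (h' x) ≠ 0 := (Real.sqrt_pos.2 (H.h'_pos x hxA)).ne'
  have hmem : h x ∈ integrableExpSet Y P := by
    refine (integrable_comp_iff_of_law hY hp h0 hlaw (F := fun y => Real.exp (h x * y))
      (by fun_prop)).2 ?_
    have h1 := (((hxi.const_mul c).mul_const (Real.exp (h x * x - g x))).comp_mul_left'
      (R := Real.sqrt (h' x)) hσ).comp_sub_right x
    refine h1.congr (ae_of_all _ fun y => ?_)
    have e' : (Real.sqrt (h' x))⁻¹ * (Real.sqrt (h' x) * (y - x)) = y - x := by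
      rw [inv_mul_cancel_left₀ hσ]
    have hexp : Real.exp (h x * y) =
        Real.exp (g x + h x * (y - x)) * Real.exp (h x * x - g x) := by
      rw [← Real.exp_add]; congr 1; ring
    simp only [rescaled, e', hexp, add_sub_cancel]
    field_simp
  rcases ht.eq_or_lt with rfl | hpos
  · exact hcr
  · exact convex_integrableExpSet.openSegment_interior_self_subset_interior hcr hmem <| by
      rw [openSegment_eq_Ioo (hpos.trans hxt)]
      exact ⟨hpos, hxt⟩

end ExtremeGibbs

end

theorem mainTheorem3 {Ω : Type*} [MeasurableSpace Ω] (P : Measure Ω) [IsProbabilityMeasure P]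
    -- the i.i.d. variables, with a bounded density `p`
    (X : ℕ → Ω → ℝ) (p : ℝ → ℝ)
    (hX_meas : ∀ i, Measurable (X i))
    (hX_indep : iIndepFun X P)
    (hp_meas : Measurable p)
    (hp_nonneg : ∀ x, 0 ≤ p x)
    (hp_bdd : ∃ M : ℝ, ∀ x, p x ≤ M)
    (hX_law : ∀ i, P.map (X i) = volume.withDensity fun x => ENNReal.ofReal (p x))
    -- the moment generating function is finite in a neighbourhood of `0`
    (h_cramer : (0 : ℝ) ∈ interior (integrableExpSet (X 0) P))
    -- the form of the density on the positive half-line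
    (c : ℝ) (hc : 0 < c) (g q h : ℝ → ℝ)
    (hp_form : ∀ x, 0 < x → p x = c * Real.exp (-(g x - q x)))
    (hg_pos : ∀ x, 0 < x → 0 < g x)
    (hg_lim : Tendsto (fun x => g x / x) atTop atTop)
    -- `h = g'` is regular on `(x₀, ∞)`
    (x₀ : ℝ) (hx₀ : 1 ≤ x₀)
    (h_deriv : ∀ x, x₀ < x → HasDerivAt g (h x) x)
    (h_class : ExtremeGibbs.ClassR h x₀)
    (hq : ∃ ϑ : ℝ, 0 < ϑ ∧ ∀ᶠ x in atTop, ∀ v, 0 < v → |v - x| < ϑ * x →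
      |q v| ≤ 1 / Real.sqrt (x * h x))
    -- the conditioning levels `a n` and the tilting parameters `t n`
    (a t : ℕ → ℝ)
    (ha : Tendsto a atTop atTop)
    (ht : ∀ᶠ n in atTop, deriv (cgf (X 0) P) (t n) = a n)
    -- the growth condition, with `ψ` the inverse of `h`
    (h_growth : Tendsto
      (fun n : ℕ => ExtremeGibbs.genInv h x₀ (t n) ^ 2 /
        Real.sqrt (n * deriv (ExtremeGibbs.genInv h x₀) (t n)))
      atTop (𝓝 0))
    (y₁ : ℝ) :
    -- `condDensity p n s` is the density of the conditional law of `X₁` given `S₁ⁿ = s`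
    (∀ n : ℕ, 2 ≤ n → ∀ᵐ s ∂(P.map fun ω => ∑ i ∈ Finset.range n, X i ω),
      condDistrib (X 0) (fun ω => ∑ i ∈ Finset.range n, X i ω) P s =
        volume.withDensity fun y => ENNReal.ofReal (ExtremeGibbs.condDensity p n s y)) ∧
    -- the density of `S₁ⁿ` does not vanish at the conditioning level
    (∀ᶠ n : ℕ in atTop, 0 < ExtremeGibbs.sumDensity p n (n * a n)) ∧
    -- the local Gibbs principle at `y₁`
    ∃ r : ℕ → ℝ, Tendsto r atTop (𝓝 0) ∧
      ∀ᶠ n : ℕ in atTop, ExtremeGibbs.condDensity p n (n * a n) y₁ =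
        ExtremeGibbs.tiltedDensity p (mgf (X 0) P) (t n) y₁ * (1 + r n) := by
  obtain ⟨M, hM⟩ := hp_bdd
  refine ⟨fun n hn => ExtremeGibbs.condDistrib_eq hp_meas hp_nonneg hM hX_meas hX_indep hX_law hn,
    ?_⟩
  obtain ⟨A, h', H, htend, hinv⟩ := h_class.exists_regularTail hx₀ h_deriv
  obtain ⟨hψ, hψtop⟩ := H.eventually_genInv htend hinv
  have hq0 : Tendsto q atTop (𝓝 0) := by
    obtain ⟨ϑ, hϑ, hqb⟩ := hq
    refine squeeze_zero_norm' ?_ (tendsto_inv_atTop_zero.comp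
      (Real.tendsto_sqrt_atTop.comp (tendsto_id.atTop_mul_atTop₀ htend)))
    filter_upwards [hqb, eventually_gt_atTop 0] with x hx hx0
    have := hx x hx0 (by rw [sub_self, abs_zero]; positivity)
    rwa [one_div] at this
  have hint : ∀ s, 0 ≤ s → s ∈ interior (integrableExpSet (X 0) P) := fun s hs =>
    H.mem_interior_integrableExpSet htend hc hp_form hq0 hM (hX_meas 0) hp_meas hp_nonneg
      (hX_law 0) h_cramer hs
  have httop : Tendsto t atTop atTop := ExtremeGibbs.tendsto_tilt h_cramer hint ha ht
  set x : ℕ → ℝ := fun n => ExtremeGibbs.genInv h x₀ (t n) with hx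
  have hxtop : Tendsto x atTop atTop := hψtop.comp httop
  have hxt : ∀ᶠ n in atTop, h (x n) = t n := (httop.eventually hψ).mono fun n hn => hn.1
  have hmgf : ∀ s, mgf (X 0) P s = ∫ y, Real.exp (s * y) * p y := fun s =>
    ExtremeGibbs.integral_comp_eq_of_law (hX_meas 0) hp_meas hp_nonneg (hX_law 0)
      (F := fun y => Real.exp (s * y)) (by fun_prop)
  have hφ : ∀ᶠ n in atTop, 0 < mgf (X 0) P (h (x n)) ∧
      mgf (X 0) P (h (x n)) = ∫ y, Real.exp (h (x n) * y) * p y := by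
    filter_upwards [hxt, httop.eventually_ge_atTop 0] with n hn hn0
    refine ⟨mgf_pos ?_, hmgf _⟩
    rw [hn]
    exact interior_subset (s := integrableExpSet (X 0) P) (hint _ hn0)
  have hmean : ∀ᶠ n in atTop, a n =
      ∫ y, y * ExtremeGibbs.tiltedDensity p (mgf (X 0) P) (h (x n)) y := by
    filter_upwards [hxt, ht, httop.eventually_ge_atTop 0] with n hn hdn hn0
    rw [hn, ← hdn, deriv_cgf (hint _ hn0),
      ExtremeGibbs.integral_comp_eq_of_law (hX_meas 0) hp_meas hp_nonneg (hX_law 0)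
        (F := fun y => y * Real.exp (t n * y)) (by fun_prop), ← integral_div]
    refine integral_congr_ae (ae_of_all _ fun y => ?_)
    simp only [ExtremeGibbs.tiltedDensity]
    ring
  have hgrowth : Tendsto (fun n : ℕ => x n ^ 2 / ((Real.sqrt (h' (x n)))⁻¹ * Real.sqrt n)) atTop
      (𝓝 0) := by
    refine h_growth.congr' ?_
    filter_upwards [httop.eventually hψ] with n hn
    rw [hn.2, Real.sqrt_mul (Nat.cast_nonneg n), Real.sqrt_inv, mul_comm (Real.sqrt n)]
  obtain ⟨hpos, r, hr, hgibbs⟩ := ExtremeGibbs.tendsto_condDensity H hc hp_form hq0 hM hp_meas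
    hp_nonneg hxtop hφ hmean hgrowth y₁
  refine ⟨hpos, r, hr, ?_⟩
  filter_upwards [hgibbs, hxt] with n hn hxn
  rw [hn, hxn]
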